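/- Let $N=2^n$. For $k\ge 2$ and $f_1,\dots,f_k:\{0,1\}^n\to\mathbb R$ put $$\Phi_{f_1,\dots,f_k}=\frac1{2^{(k+1)n/2}}\sum_{x_1,\dots,x_k\in\{0,1\}^n} f_1(x_1)(-1)^{x_1\cdot x_2}f_2(x_2)(-1)^{x_2\cdot x_3}\cdots(-1)^{x_{k-1}\cdot x_k}f_k(x_k).$$ In *$k$-fold Real Forrelation* one is given query access to the values of functions $f_1,\dots,f_{k-2}:\{0,1\}^n\to\{-1,1\}$ and $f_{k-1},f_k:\{0,1\}^n\to\mathbb R$, drawn from one of two measures. Under both, the values of $f_1,\dots,f_{k-2}$ are uniform in $\{-1,1\}$, the values of $f_{k-1}$ are $\mathcal N(0,1)$, and all these values are independent. Under the uniform measure $\mathcal U$ the values of $f_k$ are further independent $\mathcal N(0,1)$ variables; under the forrelated measure $\mathcal F$, $$f_k(x_k)=\frac1{2^{(k-1)n/2}}\sum_{x_1,\dots,x_{k-1}\in\{0,1\}^n} f_1(x_1)(-1)^{x_1\cdot x_2}\cdots(-1)^{x_{k-2}\cdot x_{k-1}}f_{k-1}(x_{k-1})(-1)^{x_{k-1}\cdot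 x_k}.$$ The task is to decide which of $\mathcal U,\mathcal F$ was used. A randomized (adaptive) query algorithm solves it with advantage $\varepsilon$ if it is right with probability at least $\frac12+\varepsilon$ when $\mathcal U$ or $\mathcal F$ is selected by a fair coin (in particular, if it errs with probability at most $\frac12-\varepsilon$ under each of the two measures); it has cost at most $T$ if its expected number of queries is at most $T$ under each of the two measures. In *Boolean $k$-fold Forrelation* one is given query access to $f_1,\dots,f_k:\{0,1\}^n\to\{-1,1\}$ with the promise that $|\Phi_{f_1,\dots,f_k}|\le\frac1{100}$ or $\Phi_{f_1,\dots,f_k}\ge\frac35$, and must decide which. A randomized query algorithm solves it with advantage $\varepsilon$ if it errs with probability at most $\frac12-\varepsilon$ on every input satisfying the promise; it has cost at most $T$ if its expected number of queries is at most $T$ on every such input. **Theorem.** For every $k\ge2$, $k$-fold Real Forrelation requires $\Omega(\sqrt N/\log^{7/2}N)$ randomized queries, and the same bound holds for Boolean $k$-fold Forrelation. That is: for every $\varepsilon>0$ there are $c>0$ and $n_0$, not depending on $k$, such that for all $k\ge2$ and $n\ge n_0$, every randomized query algorithm that solves $k$-fold Real Forrelation with advantage $\varepsilon$ and cost at most $T$,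 and every one that solves Boolean $k$-fold Forrelation with advantage $\varepsilon$ and cost at most $T$, satisfies $$T\ \ge\ c\,\frac{\sqrt N}{\log^{7/2}N}.$$ (An algorithm that never makes more than $T$ queries has cost at most $T$.) -/

import Mathlib

open MeasureTheory ProbabilityTheory
open scoped ENNReal NNReal

universe u

namespace Forrelation

/-! ### Randomized query algorithms with real-valued answers -/

/-- A randomized adaptive query algorithm that queries positions in `I`, sees real answers, and
uses an internal random seed in `Ω`. After `m` queries with answers `a : Fin m → ℝ` it either
halts with an output bit (`halt m ω a = some b`), or it does not halt (`halt m ω a = none`) and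
queries the position `query m ω a`. -/
structure QueryAlg (I : Type*) (Ω : Type*) [MeasurableSpace Ω] where
  query : (m : ℕ) → Ω → (Fin m → ℝ) → I
  halt : (m : ℕ) → Ω → (Fin m → ℝ) → Option Bool
  measurableSet_query : ∀ (m : ℕ) (i : I),
    MeasurableSet {p : Ω × (Fin m → ℝ) | query m p.1 p.2 = i}
  measurableSet_halt : ∀ (m : ℕ) (b : Bool),
    MeasurableSet {p : Ω × (Fin m → ℝ) | halt m p.1 p.2 = some b}

namespace QueryAlg

variable {I : Type*} {Ω : Type*} [MeasurableSpace Ω]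

/-- The first `m` answers on the oracle `z` with seed `ω`. (The sequence is continued formally
beyond the halting time; neither the output nor the query count looks at that part.) -/
def answers (A : QueryAlg I Ω) (ω : Ω) (z : I → ℝ) : (m : ℕ) → Fin m → ℝ
  | 0 => Fin.elim0
  | m + 1 => Fin.snoc (answers A ω z m) (z (A.query m ω (answers A ω z m)))

/-- The algorithm halts, and the bit it outputs at its first halting time is `b`. -/
def Outputs (A : QueryAlg I Ω) (ω : Ω) (z : I → ℝ) (b : Bool) : Prop :=
  ∃ m : ℕ, A.halt m ω (A.answers ω z m) = some b ∧
    ∀ j < m, A.halt j ω (A.answers ω z j) = none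

/-- The number of queries made before halting (`∞` if the algorithm never halts). -/
noncomputable def numQueries (A : QueryAlg I Ω) (ω : Ω) (z : I → ℝ) : ℝ≥0∞ :=
  ⨅ (m : ℕ) (_ : A.halt m ω (A.answers ω z m) ≠ none), (m : ℝ≥0∞)

end QueryAlg

/-! ### The twisted sums -/

/-- The Boolean cube `{0,1}^n`. -/
abbrev Cube (n : ℕ) : Type := Fin n → ZMod 2

/-- `(-1)^(x·y)`. -/
def chi {n : ℕ} (x y : Cube n) : ℝ :=
  (-1) ^ (∑ i, (x i).val * (y i).val)

/-- A `k`-tuple of real functions on `{0,1}^n`; `z (i, x)` is the value at `x` of function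
number `i` (counting from `0`). -/
abbrev Tuple (k n : ℕ) : Type := Fin k × Cube n → ℝ

/-- `(-1)^(x₁·x₂) (-1)^(x₂·x₃) ⋯ (-1)^(x_{k-1}·x_k)`. -/
def chain {k n : ℕ} (x : Fin k → Cube n) : ℝ :=
  ∏ i : Fin k, if h : i.val + 1 < k then chi (x i) (x ⟨i.val + 1, h⟩) else 1

/-- `Φ = 2^{-(k+1)n/2} ∑_{x₁,…,x_k} f₁(x₁) (-1)^(x₁·x₂) f₂(x₂) ⋯ (-1)^(x_{k-1}·x_k) f_k(x_k)`. -/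
noncomputable def phi {k n : ℕ} (z : Tuple k n) : ℝ :=
  1 / (2 : ℝ) ^ (((k : ℝ) + 1) * n / 2) *
    ∑ x : Fin k → Cube n, (∏ i, z (i, x i)) * chain x

/-- `2^{-(k-1)n/2} ∑_{x₁,…,x_{k-1}} f₁(x₁) (-1)^(x₁·x₂) ⋯ f_{k-1}(x_{k-1}) (-1)^(x_{k-1}·y)`,
written as a sum over all `(x₁,…,x_k)` with `x_k = y`. -/
noncomputable def lastTransform {k n : ℕ} (z : Tuple k n) (y : Cube n) : ℝ :=
  1 / (2 : ℝ) ^ (((k : ℝ) - 1) * n / 2) *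
    ∑ x : Fin k → Cube n with (∀ i : Fin k, i.val + 1 = k → x i = y),
      (∏ i : Fin k, if i.val + 1 = k then 1 else z (i, x i)) * chain x

/-- Replace the last function `f_k` by the transform of `f₁,…,f_{k-1}`. -/
noncomputable def forrelate {k n : ℕ} (z : Tuple k n) : Tuple k n :=
  fun p => if p.1.val + 1 = k then lastTransform z p.2 else z p

lemma measurable_forrelate {k n : ℕ} :
    Measurable (forrelate : Tuple k n → Tuple k n) := by
  refine measurable_pi_lambda _ fun p => ?_
  unfold forrelate
  split_ifs with h
  · unfold lastTransform
    refine Measurable.const_mul (Finset.measurable_sum _ fun x _ => ?_) _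
    refine Measurable.mul_const (Finset.measurable_prod _ fun i _ => ?_) _
    split_ifs
    · exact measurable_const
    · exact measurable_pi_apply _
  · exact measurable_pi_apply _

/-! ### The two input distributions of `k`-fold Real Forrelation -/

/-- The uniform distribution on `{-1,1}`. -/
noncomputable def rademacher : Measure ℝ :=
  (2⁻¹ : ℝ≥0∞) • Measure.dirac 1 + (2⁻¹ : ℝ≥0∞) • Measure.dirac (-1)

instance : IsProbabilityMeasure rademacher := by
  constructor
  simp [rademacher, ENNReal.inv_two_add_inv_two]

/-- The law of a single value of function number `i` (counting from `0`): uniform on `{-1,1}` for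
`f₁,…,f_{k-2}`, standard Gaussian for `f_{k-1}` and `f_k`. -/
noncomputable def valueLaw (k : ℕ) (i : Fin k) : Measure ℝ :=
  if i.val + 2 < k then rademacher else gaussianReal 0 1

instance (k : ℕ) (i : Fin k) : IsProbabilityMeasure (valueLaw k i) := by
  unfold valueLaw
  split_ifs <;> infer_instance

/-- The uniform measure `𝒰`: all values are independent. -/
noncomputable def uniformLaw (k n : ℕ) : Measure (Tuple k n) :=
  Measure.pi fun p => valueLaw k p.1

instance (k n : ℕ) : IsProbabilityMeasure (uniformLaw k n) := by
  unfold uniformLaw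
  infer_instance

/-- The forrelated measure `𝓕`: all values of `f₁,…,f_{k-1}` are as under `𝒰`, and `f_k` is the
transform of `f₁,…,f_{k-1}`. -/
noncomputable def forrelatedLaw (k n : ℕ) : Measure (Tuple k n) :=
  (uniformLaw k n).map forrelate

instance (k n : ℕ) : IsProbabilityMeasure (forrelatedLaw k n) :=
  Measure.isProbabilityMeasure_map measurable_forrelate.aemeasurable

/-! ### Solving the two problems -/

variable {k n : ℕ} {Ω : Type*} [MeasurableSpace Ω]

/-- `A` solves `k`-fold Real Forrelation: it should output `false` under `𝒰` and `true` under `𝓕`;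
when one of the two measures is selected by a fair coin, it is right with probability at least
`1/2 + ε`. (This holds in particular if it errs with probability at most `1/2 - ε` under each.) -/
def SolvesReal (A : QueryAlg (Fin k × Cube n) Ω) (P : Measure Ω) (ε : ℝ) : Prop :=
  1 / 2 + ε ≤
    (1 / 2) * (P.prod (uniformLaw k n)).real {p | A.Outputs p.1 p.2 false} +
    (1 / 2) * (P.prod (forrelatedLaw k n)).real {p | A.Outputs p.1 p.2 true}

/-- Under each of the two measures, the expected number of queries is at most `T`. -/
def RealCost (A : QueryAlg (Fin k × Cube n) Ω) (P : Measure Ω) (T : ℝ≥0) : Prop :=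
  ∫⁻ p, A.numQueries p.1 p.2 ∂(P.prod (uniformLaw k n)) ≤ T ∧
  ∫⁻ p, A.numQueries p.1 p.2 ∂(P.prod (forrelatedLaw k n)) ≤ T

/-- `z` is a tuple of Boolean functions `{0,1}^n → {-1,1}`. -/
def IsBoolean (z : Tuple k n) : Prop :=
  ∀ p, z p = 1 ∨ z p = -1

/-- `A` solves Boolean `k`-fold Forrelation with error probability at most `1/2 - ε`: on every
Boolean tuple with `|Φ| ≤ 1/100` (resp. `Φ ≥ 3/5`) it outputs `false` (resp. `true`) with
probability at least `1/2 + ε`. -/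
def SolvesBoolean (A : QueryAlg (Fin k × Cube n) Ω) (P : Measure Ω) (ε : ℝ) : Prop :=
  ∀ z : Tuple k n, IsBoolean z →
    (|phi z| ≤ 1 / 100 → 1 / 2 + ε ≤ P.real {ω | A.Outputs ω z false}) ∧
    (3 / 5 ≤ phi z → 1 / 2 + ε ≤ P.real {ω | A.Outputs ω z true})

/-- On every input that satisfies the promise of Boolean `k`-fold Forrelation, the expected number
of queries is at most `T`. -/
def BooleanCost (A : QueryAlg (Fin k × Cube n) Ω) (P : Measure Ω) (T : ℝ≥0) : Prop :=
  ∀ z : Tuple k n, IsBoolean z → (|phi z| ≤ 1 / 100 ∨ 3 / 5 ≤ phi z) →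
    ∫⁻ ω, A.numQueries ω z ∂P ≤ T

end Forrelation

/-! Condition on f₁,…,f_{k-2}. They act only through their iterated transform g = `iter z (k - 2)`:
under 𝓕 the last two functions are (a, V a), where a is a standard Gaussian vector and V is the
Hadamard matrix times diag(g); under 𝓤 they are two independent Gaussian vectors. So the answers
under 𝓕 are inner products of one Gaussian vector with the 2N vectors `forrVec g`. These have norm 1
by Parseval, and their pairwise inner products are 0, ±g(x)/√N, or normalized Fourier coefficients
of g². Hoeffding's inequality for the random signs bounds all of these by some r of order
n^{3/2}/√N, outside a small event (`measureReal_not_good_le`).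

It remains to see that t adaptive queries do not tell standard Gaussians with correlations at most r
from independent ones (`treeFun_correlated_sub_le`). Given the earlier answers, the next one has a
law N(μ,σ²), and 1 - σ² ≤ 2r²t because the vectors are nearly orthogonal. The Donsker–Varadhan
inequality charges the relative entropy of this law with respect to N(0,1), and induction over the
decision tree adds up the charges (`correlatedVal_le`). The mean μ depends on adaptive choices; the
exponential martingale `pot` controls it at all positions at once, at the price of a factor log²N.
The total charge is of order (r t)² log² N, which tends to 0 when t is of order √N/log^{7/2} N.
Markov's inequality cuts off the runs of an algorithm with expected cost T.

The Boolean problem reduces to this one. Round f_{k-1} and f_k to random signs whose means are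
`squash` of the real values. The rounding acts coordinatewise, so it costs no queries. The Φ of the
rounded tuple concentrates near 0 under 𝓤 and near a number above 0.61 under 𝓕, so the promise holds
with high probability. Concentration comes from the independent rounding seeds and from the Gaussian
Poincaré inequality (`variance_stdGaussian_le`), which is why a smooth function replaces the sign.
`SolvesBoolean.two_mul_le` assembles the reduction, and `exists_parameters` chooses B, r and t
independently of k. -/

namespace Forrelation

/-! ### Resampling coordinates of a product measure -/

/-- Lets one coordinate be integrated separately without splitting the index type. -/
lemma measurePreserving_update {J : Type*} [Fintype J] [DecidableEq J] (μ : J → Measure ℝ)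
    [∀ j, IsProbabilityMeasure (μ j)] (q : J) :
    MeasurePreserving (fun p : (J → ℝ) × ℝ => Function.update p.1 q p.2)
      ((Measure.pi μ).prod (μ q)) (Measure.pi μ) := by
  have hm : Measurable (fun p : (J → ℝ) × ℝ => Function.update p.1 q p.2) := by
    refine measurable_pi_lambda _ fun j => ?_
    by_cases h : j = q
    · subst h; simpa using measurable_snd
    · simp only [Function.update_of_ne h]; fun_prop
  refine ⟨hm, (Measure.pi_eq fun s hs => ?_).symm⟩
  rw [Measure.map_apply hm (MeasurableSet.univ_pi hs)]
  have : (fun p : (J → ℝ) × ℝ => Function.update p.1 q p.2) ⁻¹' (Set.univ.pi s)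
      = (Set.univ.pi (Function.update s q Set.univ)) ×ˢ (s q) := by
    ext p
    simp only [Set.mem_preimage, Set.mem_pi, Set.mem_univ, true_imp_iff, Set.mem_prod]
    constructor
    · intro h
      refine ⟨fun j => ?_, by simpa using h q⟩
      by_cases hj : j = q
      · subst hj; simp
      · simpa [Function.update_of_ne hj] using h j
    · rintro ⟨h, hq⟩ j
      by_cases hj : j = q
      · subst hj; simpa using hq
      · simpa [Function.update_of_ne hj] using h j
  rw [this, Measure.prod_prod, Measure.pi_pi, ← Finset.mul_prod_erase Finset.univ _ (Finset.mem_univ q),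
    ← Finset.mul_prod_erase Finset.univ (fun j => μ j (s j)) (Finset.mem_univ q)]
  simp only [Function.update_self, measure_univ, one_mul]
  rw [mul_comm]
  congr 1
  refine Finset.prod_congr rfl fun j hj => ?_
  rw [Function.update_of_ne (Finset.ne_of_mem_erase hj)]

/-- Replace the coordinates of `z` decoded by `d` by the coordinates of `w`. -/
def overwrite {I J : Type*} (d : J → Option I) (z : J → ℝ) (w : I → ℝ) : J → ℝ :=
  fun j => (d j).elim (z j) w

lemma measurable_overwrite {I J : Type*} (d : J → Option I) :
    Measurable (fun p : (J → ℝ) × (I → ℝ) => overwrite d p.1 p.2) := by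
  refine measurable_pi_lambda _ fun j => ?_
  unfold overwrite
  cases d j <;> simp only [Option.elim] <;> fun_prop

/-- The block version: a fresh independent copy of the coordinates in the range of `e`, with `d` as
partial inverse of `e`. It serves to condition on the other coordinates by Fubini. -/
lemma measurePreserving_overwrite {I J : Type*} [Fintype I] [Fintype J] (μ : J → Measure ℝ)
    [∀ j, IsProbabilityMeasure (μ j)] (e : I → J) (d : J → Option I)
    (hde : ∀ j i, d j = some i ↔ j = e i) :
    MeasurePreserving (fun p : (J → ℝ) × (I → ℝ) => overwrite d p.1 p.2)
      ((Measure.pi μ).prod (Measure.pi fun i => μ (e i))) (Measure.pi μ) := by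
  classical
  have hm := measurable_overwrite d
  refine ⟨hm, (Measure.pi_eq fun s hs => ?_).symm⟩
  rw [Measure.map_apply hm (MeasurableSet.univ_pi hs)]
  have : (fun p : (J → ℝ) × (I → ℝ) => overwrite d p.1 p.2) ⁻¹' (Set.univ.pi s)
      = (Set.univ.pi fun j => if d j = none then s j else Set.univ) ×ˢ
        (Set.univ.pi fun i => s (e i)) := by
    ext p
    simp only [Set.mem_preimage, Set.mem_pi, Set.mem_univ, true_imp_iff, Set.mem_prod, overwrite]
    constructor
    · intro h
      refine ⟨fun j => ?_, fun i => ?_⟩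
      · have := h j
        cases hj : d j <;> simp_all
      · have := h (e i)
        rw [(hde (e i) i).2 rfl] at this
        exact this
    · rintro ⟨h, h'⟩ j
      have := h j
      cases hj : d j with
      | none => simpa [hj] using this
      | some i =>
        rw [(hde j i).1 hj]
        exact h' i
  rw [this, Measure.prod_prod, Measure.pi_pi, Measure.pi_pi]
  have h1 : ∀ j, μ j (if d j = none then s j else Set.univ) = if d j = none then μ j (s j) else 1 := by
    intro j; split_ifs <;> simp
  simp_rw [h1]
  rw [← Finset.prod_filter, ← Finset.prod_filter_mul_prod_filter_not Finset.univ (fun j => d j = none)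
    (fun j => μ j (s j))]
  congr 1
  refine Finset.prod_bij (fun i _ => e i) ?_ ?_ ?_ ?_
  · intro i _
    simp [(hde (e i) i).2 rfl]
  · intro i _ i' _ h
    have h1 := (hde (e i) i).2 rfl
    have h2 := (hde (e i') i').2 rfl
    rw [h, h2] at h1
    exact (Option.some_injective _ h1).symm
  · intro j hj
    simp only [Finset.mem_filter, Finset.mem_univ, true_and] at hj
    obtain ⟨i, hi⟩ := Option.ne_none_iff_exists'.1 hj
    exact ⟨i, Finset.mem_univ _, ((hde j i).1 hi).symm⟩
  · intros; rfl

/-! ### Decision trees on real-valued oracles -/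

/-- `TreeFun t p`: the function `p` is the expected `[0,1]`-valued output of an adaptive decision
tree of depth `t`, measurable in the answers. -/
def TreeFun {I : Type*} : ℕ → ((I → ℝ) → ℝ) → Prop
  | 0, p => ∃ c, 0 ≤ c ∧ c ≤ 1 ∧ p = fun _ => c
  | t + 1, p => ∃ (q : I) (f : ℝ → (I → ℝ) → ℝ), Measurable (Function.uncurry f) ∧
      (∀ a, TreeFun t (f a)) ∧ ∀ z, p z = f (z q) z

lemma TreeFun.measurable {I : Type*} {t : ℕ} {p : (I → ℝ) → ℝ} (h : TreeFun t p) :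
    Measurable p := by
  cases t with
  | zero => obtain ⟨c, -, -, rfl⟩ := h; exact measurable_const
  | succ t =>
    obtain ⟨q, f, hf, -, hp⟩ := h
    have : p = fun z => Function.uncurry f (z q, z) := funext hp
    rw [this]
    exact hf.comp (by fun_prop)

lemma TreeFun.mem_Icc {I : Type*} {t : ℕ} {p : (I → ℝ) → ℝ} (h : TreeFun t p) (z : I → ℝ) :
    p z ∈ Set.Icc (0 : ℝ) 1 := by
  induction t generalizing p with
  | zero => obtain ⟨c, h0, h1, rfl⟩ := h; exact ⟨h0, h1⟩
  | succ t ih =>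
    obtain ⟨q, f, -, hf, hp⟩ := h
    rw [hp]
    exact ih (hf _)

/-- Padding by a query whose answer is ignored. -/
lemma TreeFun.mono_succ {I : Type*} [Nonempty I] {t : ℕ} {p : (I → ℝ) → ℝ} (h : TreeFun t p) :
    TreeFun (t + 1) p := by
  obtain ⟨q⟩ := ‹Nonempty I›
  exact ⟨q, fun _ => p, h.measurable.comp measurable_snd, fun _ => h, fun _ => rfl⟩

/-- Decision trees are closed under coordinatewise changes of the oracle. -/
lemma TreeFun.comp {I J : Type*} [Nonempty I] {t : ℕ} {p : (J → ℝ) → ℝ} (h : TreeFun t p)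
    (Θ : (I → ℝ) → J → ℝ) (hΘ : Measurable Θ)
    (hc : ∀ j, (∃ c, ∀ w, Θ w j = c) ∨ ∃ (i : I) (r : ℝ → ℝ), Measurable r ∧ ∀ w, Θ w j = r (w i)) :
    TreeFun t (fun w => p (Θ w)) := by
  induction t generalizing p with
  | zero => obtain ⟨c, h0, h1, rfl⟩ := h; exact ⟨c, h0, h1, rfl⟩
  | succ t ih =>
    obtain ⟨q, f, hfm, hf, hp⟩ := h
    rcases hc q with ⟨c, hq⟩ | ⟨i, r, hr, hq⟩
    -- A constant coordinate needs no query; the lost level is restored by padding.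
    · have : (fun w => p (Θ w)) = fun w => f c (Θ w) := by
        funext w; rw [hp, hq]
      rw [this]
      exact (ih (hf c)).mono_succ
    · refine ⟨i, fun a w => f (r a) (Θ w), ?_, fun a => ih (hf _), fun w => ?_⟩
      · exact hfm.comp ((hr.comp measurable_fst).prodMk (hΘ.comp measurable_snd))
      · show p (Θ w) = f (r (w i)) (Θ w)
        rw [hp, hq]


/-! ### Donsker–Varadhan for a one-dimensional Gaussian -/

/-- The exponential factor is the density of N(0,1) relative to N(μ,σ²), evaluated at the point μ +
σw; the rest is an affine substitution. -/
lemma integral_gaussianReal_affine (h : ℝ → ℝ) (μ : ℝ) {σ : ℝ} (hσ : 0 < σ) :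
    ∫ w, h (μ + σ * w) * Real.exp (Real.log σ - (μ + σ * w) ^ 2 / 2 + w ^ 2 / 2) ∂gaussianReal 0 1
      = ∫ a, h a ∂gaussianReal 0 1 := by
  rw [integral_gaussianReal_eq_integral_smul one_ne_zero,
    integral_gaussianReal_eq_integral_smul one_ne_zero]
  have key : ∀ w, gaussianPDFReal 0 1 w • (h (μ + σ * w) *
      Real.exp (Real.log σ - (μ + σ * w) ^ 2 / 2 + w ^ 2 / 2))
      = σ * (fun a => gaussianPDFReal 0 1 a • h a) (μ + σ * w) := by
    intro w
    simp only [gaussianPDFReal, smul_eq_mul, NNReal.coe_one, sub_zero, mul_one]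
    have : Real.exp (Real.log σ - (μ + σ * w) ^ 2 / 2 + w ^ 2 / 2) =
        σ * Real.exp (-(μ + σ * w) ^ 2 / 2) * Real.exp (w ^ 2 / 2) := by
      rw [show Real.log σ - (μ + σ * w) ^ 2 / 2 + w ^ 2 / 2 =
        Real.log σ + (-(μ + σ * w) ^ 2 / 2) + w ^ 2 / 2 by ring, Real.exp_add, Real.exp_add,
        Real.exp_log hσ]
    rw [this]
    have h2 : Real.exp (-w ^ 2 / 2) * Real.exp (w ^ 2 / 2) = 1 := by
      rw [← Real.exp_add]; simp [neg_div]
    linear_combination ((Real.sqrt (2 * Real.pi))⁻¹ * h (μ + σ * w) * σ *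
      Real.exp (-(μ + σ * w) ^ 2 / 2)) * h2
  simp_rw [key]
  rw [integral_const_mul, Measure.integral_comp_mul_left
    (fun a => (fun a => gaussianPDFReal 0 1 a • h a) (μ + a)) σ,
    integral_add_left_eq_self (fun a => gaussianPDFReal 0 1 a • h a) μ]
  rw [smul_eq_mul, abs_of_pos (inv_pos.2 hσ)]
  field_simp

lemma integral_sq_gaussianReal : ∫ w, w ^ 2 ∂gaussianReal 0 1 = 1 := by
  have h := variance_of_integral_eq_zero (X := fun x : ℝ => x) (μ := gaussianReal 0 1)
    (by fun_prop) (by simp)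
  have h' := variance_fun_id_gaussianReal (μ := 0) (v := 1)
  rw [h'] at h
  simpa using h.symm

lemma integrable_sq_gaussianReal : Integrable (fun w => w ^ 2) (gaussianReal 0 1) := by
  have := (memLp_id_gaussianReal (μ := 0) (v := 1) 2).integrable_sq
  simpa using this

lemma integrable_id_gaussianReal : Integrable (fun w => w) (gaussianReal 0 1) := by
  have := (memLp_id_gaussianReal (μ := 0) (v := 1) 1).integrable le_rfl
  exact this

/-- The last term is the relative entropy of N(μ,σ²) with respect to N(0,1). The inequality is
Jensen for exp applied to log h + ℓ, where ℓ is the log-density ratio, whose mean is minus that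
entropy. -/
lemma donsker_varadhan_gaussian {h : ℝ → ℝ} (hm : Measurable h) {C : ℝ} (h1 : ∀ a, 1 ≤ h a)
    (h2 : ∀ a, h a ≤ C) (μ : ℝ) {σ : ℝ} (hσ : 0 < σ) :
    ∫ w, Real.log (h (μ + σ * w)) ∂gaussianReal 0 1
      ≤ Real.log (∫ a, h a ∂gaussianReal 0 1) + ((μ ^ 2 + σ ^ 2 - 1) / 2 - Real.log σ) := by
  set γ := gaussianReal 0 1
  set ℓ : ℝ → ℝ := fun w => Real.log σ - (μ + σ * w) ^ 2 / 2 + w ^ 2 / 2 with hℓ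
  have hℓe : ∀ w, ℓ w = (Real.log σ - μ ^ 2 / 2) + (-(μ * σ)) * w + ((1 - σ ^ 2) / 2) * w ^ 2 := by
    intro w; simp only [hℓ]; ring
  have hI1 := integrable_id_gaussianReal
  have hI2 := integrable_sq_gaussianReal
  have hI3 : Integrable (fun w => (Real.log σ - μ ^ 2 / 2) + (-(μ * σ)) * w) γ :=
    (integrable_const _).add (hI1.const_mul _)
  have hℓi : Integrable ℓ γ := by
    rw [funext hℓe]
    exact hI3.add (hI2.const_mul _)
  have hℓv : ∫ w, ℓ w ∂γ = Real.log σ - (μ ^ 2 + σ ^ 2 - 1) / 2 := by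
    simp_rw [hℓe]
    rw [integral_add hI3 (hI2.const_mul _),
      integral_add (integrable_const _) (hI1.const_mul _), integral_const_mul, integral_const_mul,
      integral_sq_gaussianReal]
    simp
    ring
  have hpos : ∀ a, 0 < h a := fun a => lt_of_lt_of_le one_pos (h1 a)
  have hlm : Measurable fun w => Real.log (h (μ + σ * w)) :=
    Real.measurable_log.comp (hm.comp (by fun_prop))
  have hli : Integrable (fun w => Real.log (h (μ + σ * w))) γ := by
    refine Integrable.of_mem_Icc 0 (Real.log C) hlm.aemeasurable (ae_of_all _ fun w => ⟨?_, ?_⟩)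
    · exact Real.log_nonneg (h1 _)
    · exact Real.log_le_log (hpos _) (h2 _)
  have hexp : ∀ w, Real.exp (Real.log (h (μ + σ * w)) + ℓ w) = h (μ + σ * w) * Real.exp (ℓ w) := by
    intro w; rw [Real.exp_add, Real.exp_log (hpos _)]
  have hC : ∀ a, ‖h a‖ ≤ C := fun a => by rw [Real.norm_eq_abs, abs_of_pos (hpos a)]; exact h2 a
  -- A non-integrable function has Bochner integral 0, while the change of variables with h = 1
  -- gives 1.
  have hei : Integrable (fun w => Real.exp (ℓ w)) γ := by
    by_contra hni
    have := integral_gaussianReal_affine (fun _ => 1) μ hσ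
    simp only [one_mul] at this
    rw [integral_undef hni] at this
    simp at this
  have hgi : Integrable (fun w => Real.exp (Real.log (h (μ + σ * w)) + ℓ w)) γ := by
    simp_rw [hexp]
    exact hei.bdd_mul (c := C) (hm.comp (by fun_prop)).aestronglyMeasurable
      (ae_of_all _ fun w => hC _)
  have hJ := convexOn_exp.map_integral_le (μ := γ) (f := fun w => Real.log (h (μ + σ * w)) + ℓ w)
    Real.continuous_exp.continuousOn isClosed_univ (by simp) (hli.add hℓi) hgi
  simp_rw [hexp] at hJ
  rw [integral_gaussianReal_affine h μ hσ, integral_add hli hℓi, hℓv] at hJ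
  have := (Real.le_log_iff_exp_le (lt_of_lt_of_le (Real.exp_pos _) hJ)).2 hJ
  linarith


/-! ### Orthogonal projection away from the queried vectors -/

section Residual

variable {I E : Type*} [DecidableEq I] [NormedAddCommGroup E] [InnerProductSpace ℝ E]
  [FiniteDimensional ℝ E]

/-- The orthogonal complement of the span of the vectors indexed by `Q`. -/
noncomputable def residualSpace (v : I → E) (Q : Finset I) : Submodule ℝ E :=
  (Submodule.span ℝ (v '' (Q : Set I)))ᗮ

/-- The orthogonal projection onto `residualSpace v Q`. -/
noncomputable def residual (v : I → E) (Q : Finset I) : E →L[ℝ] E :=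
  (residualSpace v Q).starProjection

lemma mem_residualSpace {v : I → E} {Q : Finset I} {x : E} :
    x ∈ residualSpace v Q ↔ ∀ i ∈ Q, inner ℝ (v i) x = 0 := by
  unfold residualSpace
  rw [Submodule.mem_orthogonal]
  constructor
  · intro h i hi
    exact h _ (Submodule.subset_span ⟨i, hi, rfl⟩)
  · intro h u hu
    induction hu using Submodule.span_induction with
    | mem x hx => obtain ⟨i, hi, rfl⟩ := hx; exact h i hi
    | zero => simp
    | add x y _ _ hx hy => rw [inner_add_left, hx, hy, add_zero]
    | smul a x _ hx => rw [inner_smul_left, hx, mul_zero]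

lemma residual_mem (v : I → E) (Q : Finset I) (x : E) : residual v Q x ∈ residualSpace v Q :=
  Submodule.starProjection_apply_mem _ _

lemma inner_residual_eq_zero {v : I → E} {Q : Finset I} {i : I} (hi : i ∈ Q) (x : E) :
    inner ℝ (v i) (residual v Q x) = 0 :=
  mem_residualSpace.1 (residual_mem v Q x) i hi

lemma inner_sub_residual {v : I → E} {Q : Finset I} (x : E) {w : E} (hw : w ∈ residualSpace v Q) :
    inner ℝ (x - residual v Q x) w = 0 :=
  Submodule.starProjection_inner_eq_zero x w hw

lemma inner_residual_left {v : I → E} {Q : Finset I} (x : E) {w : E} (hw : w ∈ residualSpace v Q) :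
    inner ℝ (residual v Q x) w = inner ℝ x w := by
  have := inner_sub_residual x hw
  rw [inner_sub_left] at this
  linarith

lemma inner_residual_comm (v : I → E) (Q : Finset I) (x y : E) :
    inner ℝ (residual v Q x) y = inner ℝ x (residual v Q y) := by
  rw [← inner_residual_left x (residual_mem v Q y), real_inner_comm y,
    ← inner_residual_left y (residual_mem v Q x), real_inner_comm]

lemma residual_empty (v : I → E) (x : E) : residual v ∅ x = x := by
  apply Submodule.starProjection_eq_self_iff.2
  exact mem_residualSpace.2 (by simp)

/-- The normalized residual of `v q`. -/
noncomputable def direction (v : I → E) (Q : Finset I) (q : I) : E :=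
  ‖residual v Q (v q)‖⁻¹ • residual v Q (v q)

lemma direction_mem (v : I → E) (Q : Finset I) (q : I) : direction v Q q ∈ residualSpace v Q :=
  Submodule.smul_mem _ _ (residual_mem _ _ _)

variable {v : I → E} {Q : Finset I} {q : I}

lemma inner_direction_self (h : residual v Q (v q) ≠ 0) :
    inner ℝ (v q) (direction v Q q) = ‖residual v Q (v q)‖ := by
  have h0 : ‖residual v Q (v q)‖ ≠ 0 := norm_ne_zero_iff.2 h
  rw [direction, inner_smul_right, ← inner_residual_left (v q) (residual_mem _ _ _),
    real_inner_self_eq_norm_sq]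
  field_simp

lemma norm_direction (h : residual v Q (v q) ≠ 0) : ‖direction v Q q‖ = 1 := by
  have h0 : ‖residual v Q (v q)‖ ≠ 0 := norm_ne_zero_iff.2 h
  rw [direction, norm_smul, norm_inv, norm_norm, inv_mul_cancel₀ h0]

/-- One Gram–Schmidt step: a new query removes exactly one further unit direction. -/
lemma residual_insert (h : residual v Q (v q) ≠ 0) (x : E) :
    residual v (insert q Q) x = residual v Q x - inner ℝ (direction v Q q) x • direction v Q q := by
  have h0 : ‖residual v Q (v q)‖ ≠ 0 := norm_ne_zero_iff.2 h
  have hs : inner ℝ (v q) (residual v Q x) = ‖residual v Q (v q)‖ * inner ℝ (direction v Q q) x := by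
    rw [← inner_residual_comm, direction, inner_smul_left]
    simp only [conj_trivial]
    field_simp
  refine Submodule.eq_starProjection_of_mem_of_inner_eq_zero (mem_residualSpace.2 ?_) ?_
  · intro i hi
    rw [inner_sub_right, inner_smul_right]
    rcases Finset.mem_insert.1 hi with rfl | hi
    · rw [inner_direction_self h, hs]; ring
    · rw [inner_residual_eq_zero hi, mem_residualSpace.1 (direction_mem v Q q) i hi]; ring
  · intro w hw
    have hw' := mem_residualSpace.1 hw
    have hwQ : w ∈ residualSpace v Q :=
      mem_residualSpace.2 fun i hi => hw' i (Finset.mem_insert_of_mem hi)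
    have h1 : inner ℝ (direction v Q q) w = 0 := by
      rw [direction, inner_smul_left, inner_residual_left _ hwQ, hw' q (Finset.mem_insert_self _ _),
        mul_zero]
    rw [← sub_add, inner_add_left, inner_sub_residual x hwQ, inner_smul_left, h1]
    ring

lemma inner_direction_residual_insert (h : residual v Q (v q) ≠ 0) (x : E) :
    inner ℝ (direction v Q q) (residual v (insert q Q) x) = 0 := by
  have : residual v Q (direction v Q q) = direction v Q q :=
    Submodule.starProjection_eq_self_iff.2 (direction_mem v Q q)
  rw [residual_insert h, inner_sub_right, inner_smul_right, real_inner_self_eq_norm_sq,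
    norm_direction h, ← inner_residual_comm, this]
  ring

/-- Pythagoras for that step. For `x = v i` the increment is the variance gained by the conditional
mean at position `i`, which is what makes `pot` a martingale. -/
lemma norm_sub_residual_insert (h : residual v Q (v q) ≠ 0) (x : E) :
    ‖x - residual v (insert q Q) x‖ ^ 2
      = ‖x - residual v Q x‖ ^ 2 + inner ℝ (direction v Q q) x ^ 2 := by
  rw [residual_insert h, ← sub_add, norm_add_sq_real, inner_smul_right,
    inner_sub_residual x (direction_mem v Q q), norm_smul, norm_direction h, mul_one,
    Real.norm_eq_abs, sq_abs]
  ring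

/-- A unit vector is almost orthogonal to the span of few unit vectors with small inner products. -/
lemma norm_sub_residual_le (hv : ∀ i, ‖v i‖ = 1) {ε : ℝ} (hε : 0 ≤ ε)
    (hij : ∀ i j, i ≠ j → |inner ℝ (v i) (v j)| ≤ ε) (hq : q ∉ Q) (hQ : ε * Q.card ≤ 1 / 2) :
    ‖v q - residual v Q (v q)‖ ^ 2 ≤ 2 * ε ^ 2 * Q.card := by
  set w := v q - residual v Q (v q) with hw
  have hmem : w ∈ Submodule.span ℝ (v '' (Q : Set I)) := by
    have : w ∈ (residualSpace v Q)ᗮ := Submodule.sub_starProjection_mem_orthogonal _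
    rwa [residualSpace, Submodule.orthogonal_orthogonal] at this
  obtain ⟨c, hc⟩ := (Submodule.mem_span_image_finset_iff_exists_fun ℝ).1 hmem
  set S1 := ∑ i : Q, |c i| with hS1
  set S2 := ∑ i : Q, c i ^ 2 with hS2
  have hCS : S1 ^ 2 ≤ Q.card * S2 := by
    have := sq_sum_le_card_mul_sum_sq (s := (Finset.univ : Finset Q)) (f := fun i => |c i|)
    simp only [sq_abs, Finset.card_univ, Fintype.card_coe] at this
    exact this
  -- `w` is the projection of `v q` onto the span of the queried vectors.
  have h1 : ‖w‖ ^ 2 = inner ℝ w (v q) := by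
    have : inner ℝ w w = inner ℝ w (v q) := by
      conv_lhs => rw [hw, inner_sub_right]
      rw [← hw, inner_sub_residual _ (residual_mem v Q (v q))]
      simp
    rw [← this, real_inner_self_eq_norm_sq]
  have h2 : ‖w‖ ^ 2 ≤ ε * S1 := by
    rw [h1, ← hc, sum_inner, hS1, Finset.mul_sum]
    refine Finset.sum_le_sum fun i _ => ?_
    rw [inner_smul_left]
    have hne : (i : I) ≠ q := fun h => hq (h ▸ i.2)
    calc _ ≤ |c i * inner ℝ (v i) (v q)| := le_abs_self _
      _ = |c i| * |inner ℝ (v i) (v q)| := abs_mul _ _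
      _ ≤ |c i| * ε := by gcongr; exact hij _ _ hne
      _ = _ := mul_comm _ _
  -- The Gram matrix has diagonal 1 and off-diagonal entries at most ε in absolute value, so the
  -- quadratic form of `c` is at least this.
  have h3 : S2 - ε * S1 ^ 2 ≤ ‖w‖ ^ 2 := by
    rw [← real_inner_self_eq_norm_sq, ← hc, sum_inner, hS1, hS2, sq (∑ i : Q, |c i|),
      Finset.sum_mul, Finset.mul_sum, ← Finset.sum_sub_distrib]
    refine Finset.sum_le_sum fun i _ => ?_
    rw [inner_sum, Finset.mul_sum, Finset.mul_sum, sub_le_iff_le_add, ← Finset.sum_add_distrib]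
    have hnn : ∀ j : Q, 0 ≤ inner ℝ (c i • v i) (c j • v j) + ε * (|c i| * |c j|) ∧
        (j = i → c i ^ 2 ≤ inner ℝ (c i • v i) (c j • v j) + ε * (|c i| * |c j|)) := by
      intro j
      rw [inner_smul_left, inner_smul_right]
      by_cases hj : j = i
      · subst hj
        rw [real_inner_self_eq_norm_sq, hv]
        have : 0 ≤ ε * (|c j| * |c j|) := by positivity
        simp only [conj_trivial]
        constructor <;> intros <;> nlinarith [sq_nonneg (c j)]
      · refine ⟨?_, fun h => absurd h hj⟩
        have hne : (i : I) ≠ j := fun h => hj (Subtype.ext h.symm)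
        have h4 : |c i * (c j * inner ℝ (v i) (v j))| ≤ ε * (|c i| * |c j|) := by
          rw [abs_mul, abs_mul, ← mul_assoc, mul_comm ε]
          gcongr
          exact hij _ _ hne
        have := neg_le_of_abs_le h4
        simp only [conj_trivial]
        linarith
    calc c i ^ 2 ≤ _ := (hnn i).2 rfl
      _ ≤ _ := Finset.single_le_sum (f := fun j : Q => inner ℝ (c i • v i) (c j • v j) +
        ε * (|c i| * |c j|)) (fun j _ => (hnn j).1) (Finset.mem_univ i)
  have hS2n : 0 ≤ S2 := Finset.sum_nonneg fun i _ => sq_nonneg _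
  have hS1n : 0 ≤ S1 := Finset.sum_nonneg fun i _ => abs_nonneg _
  -- By Cauchy–Schwarz and ε|Q| ≤ 1/2 the off-diagonal part eats at most half of `S2`.
  have h4 : S2 ≤ 2 * ‖w‖ ^ 2 := by
    have : ε * S1 ^ 2 ≤ 1 / 2 * S2 := by
      calc ε * S1 ^ 2 ≤ ε * (Q.card * S2) := by gcongr
        _ = (ε * Q.card) * S2 := by ring
        _ ≤ _ := by gcongr
    linarith
  by_contra hlt
  push Not at hlt
  -- Upper and lower bounds for ‖w‖² combine to a self-bounding inequality; one factor ‖w‖² cancels.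
  have h5 : (‖w‖ ^ 2) ^ 2 ≤ 2 * ε ^ 2 * Q.card * ‖w‖ ^ 2 := by
    calc (‖w‖ ^ 2) ^ 2 ≤ (ε * S1) ^ 2 := by gcongr
      _ = ε ^ 2 * S1 ^ 2 := by ring
      _ ≤ ε ^ 2 * (Q.card * (2 * ‖w‖ ^ 2)) := by
        gcongr
        exact hCS.trans (by gcongr)
      _ = _ := by ring
  have h6 : 0 < ‖w‖ ^ 2 := lt_of_le_of_lt (by positivity) hlt
  nlinarith

end Residual

/-! ### Splitting a standard Gaussian vector along one direction -/

section Independence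

variable {I E : Type*} [DecidableEq I] [NormedAddCommGroup E] [InnerProductSpace ℝ E]
  [FiniteDimensional ℝ E] [MeasurableSpace E] [BorelSpace E] {v : I → E} {Q : Finset I} {q : I}

lemma map_inner_stdGaussian {e : E} (he : ‖e‖ = 1) :
    (stdGaussian E).map (fun x => inner ℝ e x) = gaussianReal 0 1 := by
  have hG : HasGaussianLaw (fun x : E => innerSL ℝ e x) (stdGaussian E) :=
    IsGaussian.hasGaussianLaw_id.map_fun _
  have := hG.map_eq_gaussianReal
  have h1 : ∫ x, innerSL ℝ e x ∂stdGaussian E = 0 := integral_strongDual_stdGaussian (innerSL ℝ e)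
  have h2 : Var[fun x => innerSL ℝ e x; stdGaussian E] = 1 := by
    rw [variance_dual_stdGaussian (innerSL ℝ e), innerSL_apply_norm, he, one_pow]
  rw [h1, h2, Real.toNNReal_one] at this
  exact this

/-- Splitting off one direction of a standard Gaussian vector. -/
lemma integral_inner_direction (h : residual v Q (v q) ≠ 0) {G : ℝ → E → ℝ}
    (hG : Measurable (Function.uncurry G)) {C : ℝ} (hC : ∀ w x, |G w x| ≤ C) :
    ∫ x, G (inner ℝ (direction v Q q) x) (residual v (insert q Q) x) ∂stdGaussian E
      = ∫ w, ∫ x, G w (residual v (insert q Q) x) ∂stdGaussian E ∂gaussianReal 0 1 := by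
  set e := direction v Q q
  set P := residual v (insert q Q)
  have hind : IndepFun (fun x : E => inner ℝ e x) (fun x : E => P x) (stdGaussian E) := by
    apply HasGaussianLaw.indepFun_of_covariance_inner
    · exact (IsGaussian.hasGaussianLaw_id (μ := stdGaussian E)).map_fun ((innerSL ℝ e).prod P)
    -- Jointly Gaussian variables are independent once uncorrelated. The covariance here is a
    -- multiple of ⟨e, P y⟩, which vanishes since P projects away from e.
    · intro a y
      have h1 : (fun x : E => inner ℝ a (inner ℝ e x : ℝ)) = fun x => inner ℝ (a • e) x := by
        funext x; rw [inner_smul_left]; simp [mul_comm]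
      have h2 : (fun x : E => inner ℝ y (P x)) = fun x => inner ℝ (P y) x := by
        funext x; exact (inner_residual_comm v _ y x).symm
      rw [h1, h2, ← covarianceBilin_apply_eq_cov (IsGaussian.memLp_two_id), covarianceBilin_stdGaussian,
        innerSL_apply_apply, inner_smul_left, inner_direction_residual_insert h, mul_zero]
  have hmap := (indepFun_iff_map_prod_eq_prod_map_map (by fun_prop) (by fun_prop)).1 hind
  rw [map_inner_stdGaussian (norm_direction h)] at hmap
  have hmP : Measurable (fun x => P x) := by fun_prop
  have : IsProbabilityMeasure ((stdGaussian E).map (fun x => P x)) :=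
    Measure.isProbabilityMeasure_map hmP.aemeasurable
  calc _ = ∫ y, Function.uncurry G y ∂(stdGaussian E).map (fun x => (inner ℝ e x, P x)) := by
        rw [integral_map (by fun_prop) hG.aestronglyMeasurable]; rfl
    _ = _ := by
        rw [hmap, integral_prod]
        · refine integral_congr_ae (ae_of_all _ fun w => ?_)
          show ∫ y, G w y ∂_ = _
          rw [integral_map hmP.aemeasurable]
          exact (hG.comp measurable_prodMk_left).aestronglyMeasurable
        · exact Integrable.of_bound hG.aestronglyMeasurable C (ae_of_all _ fun y => hC _ _)

end Independence


/-! ### Adaptive queries to weakly correlated Gaussians -/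

section Core

variable {I E : Type*} [Fintype I] [DecidableEq I] [NormedAddCommGroup E] [InnerProductSpace ℝ E]
  [FiniteDimensional ℝ E] [MeasurableSpace E] [BorelSpace E]

/-- The expectation of `p` on the correlated oracle, when the answers on `Q` are known and `m` is
the conditional mean of the underlying Gaussian vector. -/
noncomputable def correlatedVal (v : I → E) (p : (I → ℝ) → ℝ) (Q : Finset I) (m : E) : ℝ :=
  ∫ x, p (fun i => inner ℝ (v i) (m + residual v Q x)) ∂stdGaussian E

/-- The oracle `z`, with the values on `Q` replaced by the known ones. -/
noncomputable def mix (v : I → E) (Q : Finset I) (m : E) (z : I → ℝ) : I → ℝ :=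
  fun i => if i ∈ Q then inner ℝ (v i) m else z i

/-- The log-moment of `p` on the independent oracle, when the answers on `Q` are known. -/
noncomputable def logVal (v : I → E) (κ : ℝ) (p : (I → ℝ) → ℝ) (Q : Finset I) (m : E) : ℝ :=
  Real.log (∫ z, Real.exp (κ * p (mix v Q m z)) ∂Measure.pi fun _ : I => gaussianReal 0 1)

/-- The exponential potential that controls the conditional means of all unqueried values. -/
noncomputable def pot (v : I → E) (l : ℝ) (Q : Finset I) (m : E) : ℝ :=
  ∑ i, (Real.exp (l * inner ℝ (v i) m) + Real.exp (-l * inner ℝ (v i) m)) *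
    Real.exp (-(l ^ 2 / 2) * ‖v i - residual v Q (v i)‖ ^ 2)

variable {v : I → E} {Q : Finset I} {q : I}

lemma measurable_mix (v : I → E) (Q : Finset I) (m : E) : Measurable (mix v Q m) := by
  refine measurable_pi_lambda _ fun i => ?_
  unfold mix
  split_ifs <;> fun_prop

/-- Moving the conditional mean along the new direction leaves the recorded answers alone, since
that direction is orthogonal to all queried vectors. At `q` it produces mean ⟨v q, m⟩ and standard
deviation ‖residual‖. -/
lemma mix_insert (h : residual v Q (v q) ≠ 0) (hq : q ∉ Q) (m : E) (w : ℝ) (z : I → ℝ) :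
    mix v (insert q Q) (m + w • direction v Q q) z
      = Function.update (mix v Q m z) q (inner ℝ (v q) m + ‖residual v Q (v q)‖ * w) := by
  funext i
  by_cases hi : i = q
  · subst hi
    simp [mix, inner_add_right, inner_smul_right, inner_direction_self h, mul_comm]
  · rw [Function.update_of_ne hi]
    simp only [mix, Finset.mem_insert, hi, false_or]
    split_ifs with hQ
    · rw [inner_add_right, inner_smul_right, mem_residualSpace.1 (direction_mem v Q q) i hQ]
      ring
    · rfl

lemma mix_update (hq : q ∉ Q) (m : E) (z : I → ℝ) (a : ℝ) :
    mix v Q m (Function.update z q a) = Function.update (mix v Q m z) q a := by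
  funext i
  by_cases hi : i = q
  · subst hi; simp [mix, hq]
  · simp [mix, Function.update_of_ne hi]

lemma integral_exp_mul_gaussianReal (s : ℝ) :
    ∫ w, Real.exp (s * w) ∂gaussianReal 0 1 = Real.exp (s ^ 2 / 2) := by
  have := congrFun (mgf_fun_id_gaussianReal (μ := 0) (v := 1)) s
  simpa [mgf] using this

/-- The martingale property of the potential. A Gaussian step along `e` multiplies exp(±l⟨v i, m⟩)
by a factor of mean exp((l⟨v i, e⟩)²/2), and by Pythagoras the compensating factor in `pot` shrinks
by exactly that. -/
lemma integral_pot_insert (h : residual v Q (v q) ≠ 0) (l : ℝ) (m : E) :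
    Integrable (fun w => pot v l (insert q Q) (m + w • direction v Q q)) (gaussianReal 0 1) ∧
    ∫ w, pot v l (insert q Q) (m + w • direction v Q q) ∂gaussianReal 0 1 = pot v l Q m := by
  set e := direction v Q q with he
  have hterm : ∀ i w, (Real.exp (l * inner ℝ (v i) (m + w • e)) +
      Real.exp (-l * inner ℝ (v i) (m + w • e))) *
        Real.exp (-(l ^ 2 / 2) * ‖v i - residual v (insert q Q) (v i)‖ ^ 2)
      = (Real.exp (l * inner ℝ (v i) m) * Real.exp ((l * inner ℝ (v i) e) * w) +
        Real.exp (-l * inner ℝ (v i) m) * Real.exp ((-l * inner ℝ (v i) e) * w)) *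
        (Real.exp (-(l ^ 2 / 2) * ‖v i - residual v Q (v i)‖ ^ 2) *
          Real.exp (-((l * inner ℝ (v i) e) ^ 2 / 2))) := by
    intro i w
    rw [norm_sub_residual_insert h, ← he, real_inner_comm (v i) e, inner_add_right, inner_smul_right,
      ← Real.exp_add, ← Real.exp_add, ← Real.exp_add]
    congr 1
    · congr 2 <;> ring
    · congr 1; ring
  have hI : ∀ s, Integrable (fun w => Real.exp (s * w)) (gaussianReal 0 1) :=
    fun s => integrable_exp_mul_gaussianReal s
  have hIt : ∀ i ∈ Finset.univ, Integrable (fun w => (Real.exp (l * inner ℝ (v i) (m + w • e)) +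
      Real.exp (-l * inner ℝ (v i) (m + w • e))) *
        Real.exp (-(l ^ 2 / 2) * ‖v i - residual v (insert q Q) (v i)‖ ^ 2)) (gaussianReal 0 1) := by
    intro i _
    simp_rw [hterm]
    exact (((hI _).const_mul _).add ((hI _).const_mul _)).mul_const _
  refine ⟨integrable_finsetSum _ hIt, ?_⟩
  unfold pot
  rw [integral_finsetSum _ hIt]
  refine Finset.sum_congr rfl fun i _ => ?_
  simp_rw [hterm]
  rw [integral_mul_const, integral_add ((hI _).const_mul _) ((hI _).const_mul _),
    integral_const_mul, integral_const_mul, integral_exp_mul_gaussianReal,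
    integral_exp_mul_gaussianReal]
  have : Real.exp ((l * inner ℝ (v i) e) ^ 2 / 2) * Real.exp (-((l * inner ℝ (v i) e) ^ 2 / 2)) = 1 := by
    rw [← Real.exp_add]; simp
  rw [show (-l * inner ℝ (v i) e) ^ 2 = (l * inner ℝ (v i) e) ^ 2 by ring]
  linear_combination ((Real.exp (l * inner ℝ (v i) m) + Real.exp (-l * inner ℝ (v i) m)) *
    Real.exp (-(l ^ 2 / 2) * ‖v i - residual v Q (v i)‖ ^ 2)) * this

/-- Tower property: the component of the residual Gaussian along the new direction determines the
answer at `q`, and the remainder is independent of it. -/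
lemma correlatedVal_step (h : residual v Q (v q) ≠ 0) {p : (I → ℝ) → ℝ} {f : ℝ → (I → ℝ) → ℝ}
    (hf : Measurable (Function.uncurry f)) (hf1 : ∀ a z, f a z ∈ Set.Icc (0 : ℝ) 1)
    (hp : ∀ z, p z = f (z q) z) (m : E) :
    correlatedVal v p Q m = ∫ w, correlatedVal v
      (f (inner ℝ (v q) m + ‖residual v Q (v q)‖ * w)) (insert q Q) (m + w • direction v Q q)
        ∂gaussianReal 0 1 := by
  set e := direction v Q q with he
  set G : ℝ → E → ℝ := fun w y => f (inner ℝ (v q) m + ‖residual v Q (v q)‖ * w)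
    (fun i => inner ℝ (v i) (m + w • e + y)) with hG
  have hGm : Measurable (Function.uncurry G) := by
    have h2 : Measurable fun y : ℝ × E => fun i => inner ℝ (v i) (m + y.1 • e + y.2) :=
      measurable_pi_lambda _ fun i => by fun_prop
    have h1 : Measurable fun y : ℝ × E => inner ℝ (v q) m + ‖residual v Q (v q)‖ * y.1 := by
      fun_prop
    exact hf.comp (h1.prodMk h2)
  have hmain := integral_inner_direction h hGm (C := 1) (fun w x =>
    abs_le.2 ⟨by linarith [(hf1 (inner ℝ (v q) m + ‖residual v Q (v q)‖ * w)
      (fun i => inner ℝ (v i) (m + w • e + x))).1], (hf1 _ _).2⟩)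
  unfold correlatedVal
  rw [← hmain]
  refine integral_congr_ae (ae_of_all _ fun x => ?_)
  have hx : ∀ i, inner ℝ (v i) (m + residual v Q x)
      = inner ℝ (v i) (m + inner ℝ e x • e + residual v (insert q Q) x) := by
    intro i
    rw [residual_insert h, ← he]
    congr 1
    abel
  have hxq : inner ℝ (v q) (m + residual v Q x)
      = inner ℝ (v q) m + ‖residual v Q (v q)‖ * inner ℝ e x := by
    rw [hx, inner_add_right, inner_residual_eq_zero (Finset.mem_insert_self _ _), inner_add_right,
      inner_smul_right, inner_direction_self h]
    ring
  show p _ = G _ _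
  rw [hp, hG]
  simp only [hxq]
  congr 1
  exact funext hx

/-- On the independent oracle the answer at `q` is N(0,1), while the left side averages over
N(μ,σ²). Donsker–Varadhan for the inner exponential moment `H` pays for the change of law. -/
lemma logVal_step (h : residual v Q (v q) ≠ 0) (hq : q ∉ Q) {p : (I → ℝ) → ℝ}
    {f : ℝ → (I → ℝ) → ℝ} (hf : Measurable (Function.uncurry f))
    (hf1 : ∀ a z, f a z ∈ Set.Icc (0 : ℝ) 1) (hp : ∀ z, p z = f (z q) z) {κ : ℝ} (hκ : 0 ≤ κ)
    (m : E) :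
    Integrable (fun w => logVal v κ (f (inner ℝ (v q) m + ‖residual v Q (v q)‖ * w)) (insert q Q)
      (m + w • direction v Q q)) (gaussianReal 0 1) ∧
    ∫ w, logVal v κ (f (inner ℝ (v q) m + ‖residual v Q (v q)‖ * w)) (insert q Q)
      (m + w • direction v Q q) ∂gaussianReal 0 1
      ≤ logVal v κ p Q m + ((inner ℝ (v q) m ^ 2 + ‖residual v Q (v q)‖ ^ 2 - 1) / 2
        - Real.log ‖residual v Q (v q)‖) := by
  set μ := inner ℝ (v q) m
  set σ := ‖residual v Q (v q)‖
  have hσ : 0 < σ := norm_pos_iff.2 h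
  set ν := Measure.pi fun _ : I => gaussianReal 0 1
  set g : ℝ → (I → ℝ) → ℝ := fun a z => Real.exp (κ * f a (Function.update (mix v Q m z) q a)) with hg
  set H : ℝ → ℝ := fun a => ∫ z, g a z ∂ν with hH
  have hupd : Measurable fun y : ℝ × (I → ℝ) => Function.update (mix v Q m y.2) q y.1 := by
    refine measurable_pi_lambda _ fun j => ?_
    by_cases hj : j = q
    · subst hj; simpa using measurable_fst
    · simp only [Function.update_of_ne hj]
      exact (measurable_pi_apply j).comp ((measurable_mix v Q m).comp measurable_snd)
  have hgm : Measurable (Function.uncurry g) :=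
    Real.measurable_exp.comp ((hf.comp (measurable_fst.prodMk hupd)).const_mul κ)
  have hg1 : ∀ a z, 1 ≤ g a z := fun a z =>
    Real.one_le_exp (mul_nonneg hκ (hf1 _ _).1)
  have hg2 : ∀ a z, g a z ≤ Real.exp κ := fun a z =>
    Real.exp_le_exp.2 (mul_le_of_le_one_right hκ (hf1 _ _).2)
  have hgi : ∀ a, Integrable (g a) ν := fun a =>
    Integrable.of_mem_Icc 1 (Real.exp κ) (hgm.comp measurable_prodMk_left).aemeasurable
      (ae_of_all _ fun z => ⟨hg1 a z, hg2 a z⟩)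
  have hHm : Measurable H := (hgm.stronglyMeasurable.integral_prod_right).measurable
  have hH1 : ∀ a, 1 ≤ H a := fun a => by
    have := integral_mono (integrable_const (1 : ℝ)) (hgi a) (hg1 a)
    simpa using this
  have hH2 : ∀ a, H a ≤ Real.exp κ := fun a => by
    have := integral_mono (hgi a) (integrable_const (Real.exp κ)) (hg2 a)
    simpa using this
  have hlog : ∀ w, logVal v κ (f (μ + σ * w)) (insert q Q) (m + w • direction v Q q)
      = Real.log (H (μ + σ * w)) := by
    intro w
    unfold logVal
    simp_rw [mix_insert h hq]
    rfl
  -- Resampling coordinate `q` exhibits the answer as a separate Gaussian variable.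
  have hU : logVal v κ p Q m = Real.log (∫ a, H a ∂gaussianReal 0 1) := by
    unfold logVal
    congr 1
    have hmp := measurePreserving_update (fun _ : I => gaussianReal 0 1) q
    have hpm : Measurable p := by
      have : p = fun z => Function.uncurry f (z q, z) := funext hp
      rw [this]
      exact hf.comp (by fun_prop)
    have hem : Measurable fun z => Real.exp (κ * p (mix v Q m z)) :=
      Real.measurable_exp.comp ((hpm.comp (measurable_mix v Q m)).const_mul κ)
    rw [← hmp.map_eq, integral_map hmp.measurable.aemeasurable hem.aestronglyMeasurable]
    have hsw : ∀ y : (I → ℝ) × ℝ, Real.exp (κ * p (mix v Q m (Function.update y.1 q y.2)))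
        = g y.2 y.1 := by
      intro y
      rw [mix_update hq, hp, Function.update_self]
    simp_rw [hsw]
    rw [integral_prod_symm]
    exact Integrable.of_mem_Icc 1 (Real.exp κ) (hgm.comp measurable_swap).aemeasurable
      (ae_of_all _ fun y => ⟨hg1 _ _, hg2 _ _⟩)
  simp_rw [hlog]
  rw [hU]
  refine ⟨?_, donsker_varadhan_gaussian hHm hH1 hH2 μ hσ⟩
  refine Integrable.of_mem_Icc 0 κ (Real.measurable_log.comp (hHm.comp (by fun_prop))).aemeasurable
    (ae_of_all _ fun w => ⟨Real.log_nonneg (hH1 _), ?_⟩)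
  exact (Real.log_le_iff_le_exp (lt_of_lt_of_le one_pos (hH1 _))).2 (hH2 _)

/-- Replaces a square by an exponential moment above a threshold `K`, which is later the logarithm
of the initial potential. -/
lemma sq_le_two_mul_sq_add_exp {y K : ℝ} (hy : 0 ≤ y) (hK : 0 ≤ K) :
    y ^ 2 ≤ 2 * K ^ 2 + 4 * Real.exp (y - K) := by
  rcases le_total y K with h | h
  · have := Real.exp_pos (y - K)
    nlinarith
  · have := Real.quadratic_le_exp_of_nonneg (sub_nonneg.2 h)
    nlinarith [sq_nonneg (y - 2 * K)]

/-- The charge for one answer. With σ² = 1 - V the variance part is of second order, at most V² ≤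
ε²t. The mean part μ²/2 is bounded by the potential at the scale l = 1/(ε√t), where l²V ≤ 2, so that
the compensating factor in `pot` costs no more than a factor e. -/
lemma relative_entropy_le (hv : ∀ i, ‖v i‖ = 1) {ε : ℝ} (hε : 0 < ε)
    (hij : ∀ i j, i ≠ j → |inner ℝ (v i) (v j)| ≤ ε) (hq : q ∉ Q) {t : ℝ} (ht : 0 < t)
    (hQt : Q.card ≤ t) (hεt : ε * t ≤ 1 / 2) {l : ℝ} (hl : 0 < l) (hl2 : l ^ 2 * (ε ^ 2 * t) = 1)
    {K : ℝ} (hK : 0 ≤ K) (m : E) :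
    residual v Q (v q) ≠ 0 ∧
    (inner ℝ (v q) m ^ 2 + ‖residual v Q (v q)‖ ^ 2 - 1) / 2 - Real.log ‖residual v Q (v q)‖
      ≤ ε ^ 2 * t * (K ^ 2 + 1) + 6 * (ε ^ 2 * t) * Real.exp (-K) * pot v l Q m := by
  set μ := inner ℝ (v q) m
  set σ := ‖residual v Q (v q)‖ with hσ
  set V := ‖v q - residual v Q (v q)‖ ^ 2 with hV
  have hVle : V ≤ 2 * ε ^ 2 * t := by
    refine (norm_sub_residual_le hv hε.le hij hq ?_).trans (by gcongr)
    exact (by gcongr : ε * Q.card ≤ ε * t).trans hεt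
  have hpyth : σ ^ 2 = 1 - V := by
    have h1 : v q = (v q - residual v Q (v q)) + residual v Q (v q) := by abel
    have h2 : ‖v q‖ ^ 2 = V + σ ^ 2 := by
      conv_lhs => rw [h1]
      rw [norm_add_sq_real, inner_sub_residual _ (residual_mem v Q (v q))]
      ring
    rw [hv] at h2
    linarith
  have hs : ε ^ 2 * t * (ε * t) ≤ ε ^ 2 * t * (1 / 2) := by gcongr
  have hV0 : 0 ≤ V := sq_nonneg _
  -- If `Q` is empty, then V = 0; otherwise t ≥ 1 and ε²t ≤ (εt)² ≤ 1/4.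
  have hVhalf : V ≤ 1 / 2 := by
    rcases Finset.eq_empty_or_nonempty Q with rfl | hne
    · rw [hV, residual_empty]; simp
    · have h1 : (1 : ℝ) ≤ t := le_trans (by exact_mod_cast hne.card_pos) hQt
      nlinarith [mul_pos hε ht]
  have hσ0 : 0 < σ := by
    rcases (norm_nonneg (residual v Q (v q))).eq_or_lt with h | h
    · rw [hσ, ← h] at hpyth; nlinarith
    · exact h
  refine ⟨norm_pos_iff.1 hσ0, ?_⟩
  have hlog : (σ ^ 2 - 1) / 2 - Real.log σ ≤ ε ^ 2 * t := by
    have h1 : Real.log σ = Real.log (σ ^ 2) / 2 := by rw [Real.log_pow]; push_cast; ring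
    have h2 : -Real.log (σ ^ 2) ≤ 1 / σ ^ 2 - 1 := by
      have := Real.log_le_sub_one_of_pos (show 0 < (σ ^ 2)⁻¹ by positivity)
      rw [Real.log_inv] at this
      simpa using this
    have h3 : 1 / σ ^ 2 - 1 ≤ V + 2 * V ^ 2 := by
      rw [hpyth, div_sub_one (by linarith), div_le_iff₀ (by linarith)]
      nlinarith
    have h4 : V ^ 2 ≤ ε ^ 2 * t := by
      calc V ^ 2 = V * V := sq V
        _ ≤ (1 / 2) * (2 * ε ^ 2 * t) := by gcongr
        _ = _ := by ring
    rw [h1]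
    linarith
  have hexp : Real.exp (l * |μ|) ≤ Real.exp 1 * pot v l Q m := by
    have h1 : Real.exp (l * |μ|) ≤ Real.exp (l * μ) + Real.exp (-l * μ) := by
      rcases abs_cases μ with ⟨h, -⟩ | ⟨h, -⟩ <;> rw [h]
      · linarith [Real.exp_pos (-l * μ)]
      · rw [mul_neg, ← neg_mul]; linarith [Real.exp_pos (l * μ)]
    have h2 : 1 ≤ Real.exp 1 * Real.exp (-(l ^ 2 / 2) * V) := by
      rw [← Real.exp_add]
      refine Real.one_le_exp ?_
      have : l ^ 2 * V ≤ l ^ 2 * (2 * ε ^ 2 * t) := by gcongr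
      nlinarith
    have h3 : (Real.exp (l * μ) + Real.exp (-l * μ)) * Real.exp (-(l ^ 2 / 2) * V) ≤ pot v l Q m :=
      Finset.single_le_sum (f := fun i => (Real.exp (l * inner ℝ (v i) m) +
        Real.exp (-l * inner ℝ (v i) m)) * Real.exp (-(l ^ 2 / 2) * ‖v i - residual v Q (v i)‖ ^ 2))
        (fun i _ => by positivity) (Finset.mem_univ q)
    calc _ ≤ (Real.exp (l * μ) + Real.exp (-l * μ)) * 1 := by rw [mul_one]; exact h1
      _ ≤ (Real.exp (l * μ) + Real.exp (-l * μ)) * (Real.exp 1 * Real.exp (-(l ^ 2 / 2) * V)) := by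
        gcongr
      _ = Real.exp 1 * ((Real.exp (l * μ) + Real.exp (-l * μ)) * Real.exp (-(l ^ 2 / 2) * V)) := by
        ring
      _ ≤ _ := by gcongr
  have hμ : μ ^ 2 = ε ^ 2 * t * (l * |μ|) ^ 2 := by
    rw [mul_pow, sq_abs]; linear_combination (-μ ^ 2) * hl2
  have hy := sq_le_two_mul_sq_add_exp (mul_nonneg hl.le (abs_nonneg μ)) hK
  have hμ2 : μ ^ 2 / 2 ≤ ε ^ 2 * t * (K ^ 2 + 2 * (Real.exp 1 * pot v l Q m * Real.exp (-K))) := by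
    have : (l * |μ|) ^ 2 / 2 ≤ K ^ 2 + 2 * (Real.exp 1 * pot v l Q m * Real.exp (-K)) := by
      rw [sub_eq_add_neg, Real.exp_add] at hy
      have := mul_le_mul_of_nonneg_right hexp (Real.exp_pos (-K)).le
      linarith
    rw [hμ, mul_div_assoc]
    gcongr
  -- Turns the factor 2e into the 6 of the statement.
  have he : Real.exp 1 ≤ 3 := by linarith [Real.exp_one_lt_d9]
  have hpot : 0 ≤ pot v l Q m := Finset.sum_nonneg fun i _ => by positivity
  have h5 : ε ^ 2 * t * (2 * (Real.exp 1 * pot v l Q m * Real.exp (-K))) ≤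
      ε ^ 2 * t * (2 * (3 * pot v l Q m * Real.exp (-K))) := by gcongr
  nlinarith

/-- The chain rule for relative entropy, as an induction over the tree for arbitrary known answers.
Every remaining query is charged in terms of the present value of `pot`, because the mean of `pot`
after the next answer is its present value. -/
lemma correlatedVal_le (hv : ∀ i, ‖v i‖ = 1) {ε : ℝ} (hε : 0 < ε)
    (hij : ∀ i j, i ≠ j → |inner ℝ (v i) (v j)| ≤ ε) {T : ℝ} (hT : 0 < T)
    (hεT : ε * T ≤ 1 / 2) {l : ℝ} (hl : 0 < l) (hl2 : l ^ 2 * (ε ^ 2 * T) = 1)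
    {K : ℝ} (hK : 0 ≤ K) {κ : ℝ} (hκ : 0 ≤ κ) {t : ℕ} {p : (I → ℝ) → ℝ} (hp : TreeFun t p)
    (Q : Finset I) (m : E) (hQ : (Q.card : ℝ) + t ≤ T) :
    κ * correlatedVal v p Q m ≤ logVal v κ p Q m +
      t * (ε ^ 2 * T * (K ^ 2 + 1) + 6 * (ε ^ 2 * T) * Real.exp (-K) * pot v l Q m) := by
  have hpot : ∀ Q m, 0 ≤ pot v l Q m := fun Q m => Finset.sum_nonneg fun i _ => by positivity
  induction t generalizing p Q m with
  | zero =>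
    obtain ⟨c, h0, h1, rfl⟩ := hp
    simp [correlatedVal, logVal]
  | succ t ih =>
    obtain ⟨q, f, hfm, hf, hpf⟩ := hp
    by_cases hq : q ∈ Q
    -- A repeated query: its answer is already determined by `m` on both sides, so nothing is
    -- charged.
    · have h1 : correlatedVal v p Q m = correlatedVal v (f (inner ℝ (v q) m)) Q m := by
        unfold correlatedVal
        refine integral_congr_ae (ae_of_all _ fun x => ?_)
        simp only [hpf]
        rw [inner_add_right, inner_residual_eq_zero hq, add_zero]
      have h2 : logVal v κ p Q m = logVal v κ (f (inner ℝ (v q) m)) Q m := by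
        unfold logVal
        simp_rw [hpf]
        simp [mix, hq]
      rw [h1, h2]
      refine (ih (hf _) Q m (by push_cast at hQ; linarith)).trans ?_
      have := hpot Q m
      gcongr
      linarith
    · obtain ⟨hres, hent⟩ := relative_entropy_le hv hε hij hq hT
        (by push_cast at hQ; linarith [(Nat.cast_nonneg t : (0 : ℝ) ≤ t)]) hεT hl hl2 hK m
      have hf1 : ∀ a z, f a z ∈ Set.Icc (0 : ℝ) 1 := fun a z => (hf a).mem_Icc z
      obtain ⟨hLi, hL⟩ := logVal_step hres hq hfm hf1 hpf hκ m
      obtain ⟨hPi, hP⟩ := integral_pot_insert (v := v) (Q := Q) (q := q) hres l m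
      rw [correlatedVal_step hres hfm hf1 hpf m, ← integral_const_mul]
      set α := ε ^ 2 * T * (K ^ 2 + 1)
      set β := 6 * (ε ^ 2 * T) * Real.exp (-K)
      have hcard : ((insert q Q).card : ℝ) + t ≤ T := by
        rw [Finset.card_insert_of_notMem hq]; push_cast at hQ ⊢; linarith
      have hRi : Integrable (fun w => (t : ℝ) * (α + β * pot v l (insert q Q)
          (m + w • direction v Q q))) (gaussianReal 0 1) :=
        ((integrable_const _).add (hPi.const_mul _)).const_mul _
      -- The left side need only be nonnegative, so its measurability in the answer is not required.
      refine (integral_mono_of_nonneg (ae_of_all _ fun w => ?_) (hLi.add hRi)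
        (ae_of_all _ fun w => ih (hf _) (insert q Q) (m + w • direction v Q q) hcard)).trans ?_
      · exact mul_nonneg hκ (integral_nonneg fun x => (hf1 _ _).1)
      · simp only [Pi.add_apply]
        clear_value α β
        rw [integral_add hLi hRi, integral_const_mul,
          integral_add (integrable_const _) (hPi.const_mul _), integral_const_mul, hP]
        simp only [integral_const, probReal_univ, smul_eq_mul, one_mul]
        push_cast
        linarith

/-- Few adaptive queries to weakly correlated Gaussian variables do not distinguish them from
independent ones. -/
theorem treeFun_correlated_sub_le [Nonempty I] (hv : ∀ i, ‖v i‖ = 1) {ε : ℝ} (hε : 0 < ε)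
    (hij : ∀ i j, i ≠ j → |inner ℝ (v i) (v j)| ≤ ε) {t : ℕ} (ht : 0 < t)
    (hεt : ε * t ≤ 1 / 2) {κ : ℝ} (hκ : 0 < κ) (hκ1 : κ ≤ 1) {p : (I → ℝ) → ℝ} (hp : TreeFun t p) :
    ∫ x, p (fun i => inner ℝ (v i) x) ∂stdGaussian E
      - ∫ z, p z ∂Measure.pi (fun _ : I => gaussianReal 0 1)
      ≤ κ + (ε * t) ^ 2 * (Real.log (2 * Fintype.card I) ^ 2 + 7) / κ := by
  have ht' : (0 : ℝ) < t := by exact_mod_cast ht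
  -- At the root the potential is 2|I|, so exp(-K) times it is 1; the constant 7 below is 1 + 6.
  set K := Real.log (2 * Fintype.card I) with hKdef
  have hI : (1 : ℝ) ≤ Fintype.card I := by exact_mod_cast Fintype.card_pos
  have hK : 0 ≤ K := Real.log_nonneg (by linarith)
  have hl : 0 < (ε * Real.sqrt t)⁻¹ := by positivity
  have hl2 : (ε * Real.sqrt t)⁻¹ ^ 2 * (ε ^ 2 * t) = 1 := by
    rw [inv_pow, mul_pow, Real.sq_sqrt ht'.le]
    field_simp
  have key := correlatedVal_le hv hε hij ht' hεt hl hl2 hK hκ.le hp ∅ 0 (by simp)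
  have hpot : pot v (ε * Real.sqrt t)⁻¹ ∅ 0 = 2 * Fintype.card I := by
    simp [pot, residual_empty]
    ring
  have hKe : Real.exp (-K) * (2 * Fintype.card I) = 1 := by
    rw [Real.exp_neg, hKdef, Real.exp_log (by linarith)]
    exact inv_mul_cancel₀ (by linarith)
  have hc : correlatedVal v p ∅ 0 = ∫ x, p (fun i => inner ℝ (v i) x) ∂stdGaussian E := by
    simp [correlatedVal, residual_empty]
  set ν := Measure.pi (fun _ : I => gaussianReal 0 1)
  have hpi : Integrable p ν := Integrable.of_mem_Icc 0 1 hp.measurable.aemeasurable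
    (ae_of_all _ fun z => hp.mem_Icc z)
  -- By exp x ≤ 1 + x + x² for 0 ≤ x ≤ 1 and log y ≤ y - 1, a small κ linearizes the log-moment.
  have hlv : logVal v κ p ∅ 0 ≤ κ * ∫ z, p z ∂ν + κ ^ 2 := by
    have hmix : ∀ z, mix v ∅ 0 z = z := fun z => by funext i; simp [mix]
    unfold logVal
    simp_rw [hmix]
    have h1 : ∫ z, Real.exp (κ * p z) ∂ν ≤ ∫ z, (1 + κ * p z + κ ^ 2) ∂ν := by
      refine integral_mono_of_nonneg (ae_of_all _ fun z => (Real.exp_pos _).le)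
        (((integrable_const _).add (hpi.const_mul _)).add (integrable_const _))
        (ae_of_all _ fun z => ?_)
      have hz := hp.mem_Icc z
      have h0 : 0 ≤ κ * p z := mul_nonneg hκ.le hz.1
      have h2 : κ * p z ≤ κ := mul_le_of_le_one_right hκ.le hz.2
      have := Real.abs_exp_sub_one_sub_id_le (x := κ * p z) (by rw [abs_of_nonneg h0]; linarith)
      have h3 := (abs_le.1 this).2
      show Real.exp (κ * p z) ≤ 1 + κ * p z + κ ^ 2
      nlinarith
    have h2 : ∫ z, (1 + κ * p z + κ ^ 2) ∂ν = 1 + (κ * ∫ z, p z ∂ν + κ ^ 2) := by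
      have hpi' : Integrable (fun z => 1 + κ * p z) ν := (integrable_const _).add (hpi.const_mul _)
      rw [integral_add hpi' (integrable_const _),
        integral_add (integrable_const _) (hpi.const_mul _), integral_const_mul]
      simp
      ring
    have h3 : 0 < ∫ z, Real.exp (κ * p z) ∂ν := by
      refine integral_exp_pos ?_
      exact Integrable.of_mem_Icc 0 (Real.exp κ)
        (Real.measurable_exp.comp (hp.measurable.const_mul κ)).aemeasurable
        (ae_of_all _ fun z => ⟨(Real.exp_pos _).le,
          Real.exp_le_exp.2 (mul_le_of_le_one_right hκ.le (hp.mem_Icc z).2)⟩)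
    have := Real.log_le_sub_one_of_pos h3
    linarith
  rw [hc, hpot, mul_assoc _ (Real.exp (-K)), hKe] at key
  have : κ * (∫ x, p (fun i => inner ℝ (v i) x) ∂stdGaussian E - ∫ z, p z ∂ν)
      ≤ κ * (κ + (ε * t) ^ 2 * (K ^ 2 + 7) / κ) := by
    have h9 : κ * (κ + (ε * t) ^ 2 * (K ^ 2 + 7) / κ) = κ ^ 2 + (ε * t) ^ 2 * (K ^ 2 + 7) := by
      field_simp
    rw [h9]
    nlinarith
  exact le_of_mul_le_mul_left this hκ

end Core


/-! ### The Walsh–Hadamard transform -/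

section Hadamard

variable {n : ℕ}

lemma chi_eq_prod (x y : Cube n) : chi x y = ∏ i, (-1 : ℝ) ^ ((x i).val * (y i).val) := by
  rw [chi, Finset.prod_pow_eq_pow_sum]

lemma chi_comm (x y : Cube n) : chi x y = chi y x := by
  simp only [chi, mul_comm]

lemma chi_mul_chi (x y w : Cube n) : chi x w * chi y w = chi (x + y) w := by
  simp only [chi_eq_prod, ← Finset.prod_mul_distrib]
  refine Finset.prod_congr rfl fun i _ => ?_
  have : ∀ a b c : ZMod 2, (-1 : ℝ) ^ (a.val * c.val) * (-1) ^ (b.val * c.val)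
      = (-1) ^ ((a + b).val * c.val) := by
    intro a b c
    rw [← pow_add, neg_one_pow_eq_pow_mod_two, neg_one_pow_eq_pow_mod_two (n := (a + b).val * c.val)]
    congr 1
    revert a b c; decide
  exact this _ _ _

lemma chi_sq (x y : Cube n) : chi x y ^ 2 = 1 := by
  rw [chi, ← pow_mul, mul_comm, pow_mul]; simp

lemma abs_chi (x y : Cube n) : |chi x y| = 1 := by
  rw [← sq_eq_sq₀ (abs_nonneg _) zero_le_one, sq_abs, chi_sq, one_pow]

lemma chi_zero_left (y : Cube n) : chi 0 y = 1 := by simp [chi]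

lemma sum_chi_eq_zero {s : Cube n} (hs : s ≠ 0) : ∑ y, chi s y = 0 := by
  obtain ⟨i, hi⟩ := Function.ne_iff.1 hs
  simp_rw [chi_eq_prod]
  have := Finset.prod_univ_sum (fun _ : Fin n => (Finset.univ : Finset (ZMod 2)))
    (fun i b => (-1 : ℝ) ^ ((s i).val * b.val))
  rw [Fintype.piFinset_univ] at this
  rw [← this]
  refine Finset.prod_eq_zero (Finset.mem_univ i) ?_
  have h1 : s i = 1 := by
    have : ∀ a : ZMod 2, a ≠ 0 → a = 1 := by decide
    exact this _ hi
  rw [h1, show (Finset.univ : Finset (ZMod 2)) = {0, 1} from rfl, Finset.sum_pair (by decide)]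
  simp [show (1 : ZMod 2).val = 1 from rfl]

lemma card_cube : Fintype.card (Cube n) = 2 ^ n := by
  rw [Fintype.card_fun, ZMod.card, Fintype.card_fin]

lemma add_self_cube (x : Cube n) : x + x = 0 := by
  funext i
  have : ∀ a : ZMod 2, a + a = 0 := by decide
  exact this _

lemma add_eq_zero_iff_cube {x y : Cube n} : x + y = 0 ↔ x = y := by
  constructor
  · intro h
    calc x = x + (y + y) := by rw [add_self_cube, add_zero]
      _ = (x + y) + y := by abel
      _ = y := by rw [h, zero_add]
  · rintro rfl; exact add_self_cube x

/-- `√N` for `N = 2 ^ n`. -/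
noncomputable def rootN (n : ℕ) : ℝ := Real.sqrt (2 ^ n)

lemma rootN_pos (n : ℕ) : 0 < rootN n := Real.sqrt_pos.2 (by positivity)

lemma rootN_sq (n : ℕ) : rootN n ^ 2 = 2 ^ n := Real.sq_sqrt (by positivity)

/-- The normalized Walsh–Hadamard transform. -/
noncomputable def had (f : Cube n → ℝ) (y : Cube n) : ℝ :=
  (rootN n)⁻¹ * ∑ x, chi x y * f x

lemma sum_had_mul (f g : Cube n → ℝ) : ∑ y, had f y * g y = ∑ x, f x * had g x := by
  simp only [had, Finset.mul_sum, Finset.sum_mul]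
  rw [Finset.sum_comm]
  refine Finset.sum_congr rfl fun x _ => Finset.sum_congr rfl fun y _ => ?_
  rw [chi_comm x y]; ring

lemma had_had (f : Cube n → ℝ) : had (had f) = f := by
  funext y
  simp only [had]
  have h1 : ∀ x, chi x y * ((rootN n)⁻¹ * ∑ w, chi w x * f w)
      = (rootN n)⁻¹ * ∑ w, f w * chi (w + y) x := by
    intro x
    rw [← mul_assoc, mul_comm (chi x y), mul_assoc, Finset.mul_sum]
    congr 1
    refine Finset.sum_congr rfl fun w _ => ?_
    rw [← chi_mul_chi, chi_comm x y]; ring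
  simp_rw [h1]
  rw [← Finset.mul_sum, Finset.sum_comm]
  simp_rw [← Finset.mul_sum]
  rw [Finset.sum_eq_single y]
  · rw [add_self_cube]
    simp only [chi_zero_left, Finset.sum_const, Finset.card_univ, card_cube, nsmul_eq_mul, mul_one]
    push_cast
    rw [← rootN_sq]
    have := (rootN_pos n).ne'
    field_simp
  · intro w _ hw
    rw [sum_chi_eq_zero (fun h => hw (add_eq_zero_iff_cube.1 h)), mul_zero]
  · simp

lemma sum_had_sq (f : Cube n → ℝ) : ∑ y, had f y ^ 2 = ∑ x, f x ^ 2 := by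
  simp_rw [sq]
  rw [sum_had_mul, had_had]

end Hadamard

/-! ### Iterated transforms -/

section Iter

variable {k n : ℕ}

/-- The `j`-th function of the tuple `z`, extended by `0`. -/
def blk (z : Tuple k n) (j : ℕ) (x : Cube n) : ℝ :=
  if h : j < k then z (⟨j, h⟩, x) else 0

/-- `iter z j` is the transform of the first `j` functions of `z`. -/
noncomputable def iter (z : Tuple k n) : ℕ → Cube n → ℝ
  | 0 => fun _ => 1
  | j + 1 => had fun x => blk z j x * iter z j x

lemma iter_congr {z z' : Tuple k n} {j : ℕ} (h : ∀ i < j, ∀ x, blk z i x = blk z' i x) :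
    iter z j = iter z' j := by
  induction j with
  | zero => rfl
  | succ j ih =>
    simp only [iter]
    rw [ih fun i hi => h i (by omega)]
    congr 1
    funext x
    rw [h j (by omega)]

/-- Parseval: neither the transform nor multiplication by signs changes the ℓ² norm, and the
constant 1 has square norm N. -/
lemma sum_iter_sq {z : Tuple k n} {j : ℕ} (h : ∀ i < j, ∀ x, blk z i x ^ 2 = 1) :
    ∑ x, iter z j x ^ 2 = 2 ^ n := by
  induction j with
  | zero => simp [iter]
  | succ j ih =>
    simp only [iter]
    rw [sum_had_sq, ← ih fun i hi => h i (by omega)]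
    refine Finset.sum_congr rfl fun x _ => ?_
    rw [mul_pow, h j (by omega), one_mul]

lemma chain_succ {m : ℕ} (x : Fin (m + 1) → Cube n) :
    chain x = ∏ i : Fin m, chi (x i.castSucc) (x i.succ) := by
  rw [chain, Fin.prod_univ_castSucc]
  simp only [Fin.val_castSucc, Fin.val_last, lt_irrefl, dite_false, mul_one]
  refine Finset.prod_congr rfl fun i _ => ?_
  rw [dif_pos (by omega)]
  rfl

/-- Summing out the last point of the chain absorbs it into the test function, which is why `g` is
arbitrary. An indicator gives `lastTransform`, the last function gives `phi`. -/
lemma sum_chain (z : Tuple k n) (m : ℕ) (g : Cube n → ℝ) :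
    ∑ x : Fin (m + 1) → Cube n, (∏ i : Fin m, blk z i (x i.castSucc)) * chain x * g (x (Fin.last m))
      = rootN n ^ m * ∑ u, iter z m u * g u := by
  induction m generalizing g with
  | zero =>
    simp only [chain_succ, Finset.univ_eq_empty, Finset.prod_empty, iter, pow_zero, one_mul]
    exact (Equiv.funUnique (Fin 1) (Cube n)).sum_comp g
  | succ m ih =>
    rw [← (Fin.snocEquiv (fun _ : Fin (m + 2) => Cube n)).sum_comp, Fintype.sum_prod_type,
      Finset.sum_comm]
    have h1 : ∀ (x : Fin (m + 1) → Cube n) (y : Cube n),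
        (∏ i : Fin (m + 1), blk z i (Fin.snocEquiv (fun _ : Fin (m + 2) => Cube n) (y, x) i.castSucc)) *
          chain (Fin.snocEquiv (fun _ : Fin (m + 2) => Cube n) (y, x)) *
          g (Fin.snocEquiv (fun _ : Fin (m + 2) => Cube n) (y, x) (Fin.last (m + 1)))
        = (∏ i : Fin m, blk z i (x i.castSucc)) * chain x *
          (blk z m (x (Fin.last m)) * (chi (x (Fin.last m)) y * g y)) := by
      intro x y
      rw [chain_succ, chain_succ, Fin.prod_univ_castSucc, Fin.prod_univ_castSucc]
      simp only [Fin.snocEquiv_apply, Fin.snoc_castSucc, Fin.snoc_last, Fin.val_castSucc,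
        Fin.val_last, Fin.succ_last, ← Fin.castSucc_succ]
      ring
    simp_rw [h1, ← Finset.mul_sum]
    rw [ih (fun u => blk z m u * ∑ y, chi u y * g y)]
    simp only [iter, had, Finset.mul_sum, Finset.sum_mul]
    rw [Finset.sum_comm]
    refine Finset.sum_congr rfl fun y _ => Finset.sum_congr rfl fun u _ => ?_
    have := (rootN_pos n).ne'
    field_simp
    ring

lemma two_rpow_eq (n m : ℕ) : (2 : ℝ) ^ ((m : ℝ) * n / 2) = rootN n ^ m := by
  rw [rootN, Real.sqrt_eq_rpow, ← Real.rpow_natCast 2 n, ← Real.rpow_mul (by norm_num),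
    ← Real.rpow_natCast _ m, ← Real.rpow_mul (by norm_num)]
  congr 1; ring

lemma lastTransform_eq (hk : 1 ≤ k) (z : Tuple k n) : lastTransform z = iter z (k - 1) := by
  obtain ⟨m, rfl⟩ : ∃ m, k = m + 1 := ⟨k - 1, by omega⟩
  funext y
  have h := sum_chain z m (fun u => if u = y then 1 else 0)
  simp only [mul_ite, mul_one, mul_zero, Finset.sum_ite_eq', Finset.mem_univ, if_true] at h
  rw [lastTransform, show ((m + 1 : ℕ) : ℝ) - 1 = (m : ℝ) by push_cast; ring, two_rpow_eq,
    Finset.sum_filter]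
  have h2 : ∀ x : Fin (m + 1) → Cube n,
      (if (∀ i : Fin (m + 1), i.val + 1 = m + 1 → x i = y) then
        (∏ i : Fin (m + 1), if i.val + 1 = m + 1 then 1 else z (i, x i)) * chain x else 0)
      = if x (Fin.last m) = y then (∏ i : Fin m, blk z i (x i.castSucc)) * chain x else 0 := by
    intro x
    have h3 : (∀ i : Fin (m + 1), i.val + 1 = m + 1 → x i = y) ↔ x (Fin.last m) = y := by
      constructor
      · intro h; exact h _ rfl
      · intro h i hi
        rw [← h]; congr 1; exact Fin.ext (by simp; omega)
    rw [Fin.prod_univ_castSucc]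
    simp only [h3, Fin.val_castSucc, Fin.val_last, if_true, mul_one]
    congr 2
    refine Finset.prod_congr rfl fun i _ => ?_
    have : i.val < m + 1 := by omega
    rw [if_neg (by omega), blk, dif_pos this]
    rfl
  simp_rw [h2]
  rw [h]
  have := (rootN_pos n).ne'
  simp only [Nat.add_sub_cancel]
  field_simp

lemma phi_eq (hk : 1 ≤ k) (z : Tuple k n) :
    phi z = (2 ^ n)⁻¹ * ∑ y, blk z (k - 1) y * iter z (k - 1) y := by
  obtain ⟨m, rfl⟩ : ∃ m, k = m + 1 := ⟨k - 1, by omega⟩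
  have h := sum_chain z m (blk z m)
  rw [phi, show ((m + 1 : ℕ) : ℝ) + 1 = ((m + 2 : ℕ) : ℝ) by push_cast; ring, two_rpow_eq]
  have h2 : ∀ x : Fin (m + 1) → Cube n, (∏ i, z (i, x i)) * chain x =
      (∏ i : Fin m, blk z i (x i.castSucc)) * chain x * blk z m (x (Fin.last m)) := by
    intro x
    rw [Fin.prod_univ_castSucc]
    have h3 : z (Fin.last m, x (Fin.last m)) = blk z m (x (Fin.last m)) := by
      rw [blk, dif_pos (by omega)]; rfl
    have h4 : ∏ i : Fin m, z (i.castSucc, x i.castSucc) = ∏ i : Fin m, blk z i (x i.castSucc) := by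
      refine Finset.prod_congr rfl fun i _ => ?_
      have : i.val < m + 1 := by omega
      rw [blk, dif_pos this]; rfl
    rw [h3, h4]; ring
  simp_rw [h2]
  rw [h, ← rootN_sq]
  have := (rootN_pos n).ne'
  simp only [Nat.add_sub_cancel]
  rw [pow_add]
  field_simp
  refine Finset.sum_congr rfl fun u _ => by ring

end Iter


/-! ### Concentration by random signs -/

/-- The sign of a bit. -/
def sgn (b : Bool) : ℝ := if b then 1 else -1

/-- The sum factorizes over the points, and cosh s ≤ exp(s²/2). -/
lemma sum_exp_sgn_le {X : Type*} [Fintype X] [DecidableEq X] (d : X → ℝ) (l : ℝ) :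
    ∑ s : X → Bool, Real.exp (l * ∑ x, sgn (s x) * d x)
      ≤ Fintype.card (X → Bool) * Real.exp (l ^ 2 * (∑ x, d x ^ 2) / 2) := by
  have h1 : ∀ s : X → Bool, Real.exp (l * ∑ x, sgn (s x) * d x)
      = ∏ x, Real.exp (l * (sgn (s x) * d x)) := by
    intro s; rw [Finset.mul_sum, Real.exp_sum]
  have h2 := Finset.prod_univ_sum (fun _ : X => (Finset.univ : Finset Bool))
    (fun x b => Real.exp (l * (sgn b * d x)))
  rw [Fintype.piFinset_univ] at h2
  simp_rw [h1]
  rw [← h2]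
  calc ∏ x, ∑ b, Real.exp (l * (sgn b * d x)) ≤ ∏ x, 2 * Real.exp ((l * d x) ^ 2 / 2) := by
        refine Finset.prod_le_prod (fun x _ => Finset.sum_nonneg fun b _ => (Real.exp_pos _).le)
          fun x _ => ?_
        have := Real.cosh_le_exp_half_sq (l * d x)
        rw [Real.cosh_eq] at this
        simp only [Fintype.sum_bool, sgn, if_true, Bool.false_eq_true, if_false, one_mul, neg_mul,
          mul_neg]
        linarith
    _ = _ := by
        rw [Finset.prod_mul_distrib, ← Real.exp_sum]
        simp only [Finset.prod_const, Finset.card_univ, Fintype.card_fun, Fintype.card_bool]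
        push_cast
        congr 2
        rw [Finset.mul_sum, Finset.sum_div]
        exact Finset.sum_congr rfl fun x _ => by ring

/-- Hoeffding's inequality for random signs. -/
lemma card_abs_sum_sgn_ge_le {X : Type*} [Fintype X] [DecidableEq X] (d : X → ℝ) {V r : ℝ}
    (hV : 0 < V) (hd : ∑ x, d x ^ 2 ≤ V) (hr : 0 ≤ r) :
    (Fintype.card {s : X → Bool // r ≤ |∑ x, sgn (s x) * d x|} : ℝ)
      ≤ 2 * Real.exp (-(r ^ 2 / (2 * V))) * Fintype.card (X → Bool) := by
  -- Minimizes the Chernoff exponent l²V/2 - lr.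
  set l := r / V with hl
  have hl0 : 0 ≤ l := by positivity
  have h1 : (Fintype.card {s : X → Bool // r ≤ |∑ x, sgn (s x) * d x|} : ℝ) * Real.exp (l * r)
      ≤ ∑ s : X → Bool, (Real.exp (l * ∑ x, sgn (s x) * d x) +
        Real.exp (-l * ∑ x, sgn (s x) * d x)) := by
    set g : (X → Bool) → ℝ := fun s => Real.exp (l * ∑ x, sgn (s x) * d x) +
      Real.exp (-l * ∑ x, sgn (s x) * d x) with hg
    set S : Finset (X → Bool) := Finset.univ.filter fun s => r ≤ |∑ x, sgn (s x) * d x| with hS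
    have hcard : Fintype.card {s : X → Bool // r ≤ |∑ x, sgn (s x) * d x|} = S.card :=
      Fintype.card_subtype _
    have hle : ∑ s ∈ S, g s ≤ ∑ s, g s :=
      Finset.sum_le_sum_of_subset_of_nonneg (Finset.subset_univ _) fun s _ _ => by positivity
    refine le_trans ?_ hle
    rw [hcard, ← nsmul_eq_mul]
    refine Finset.card_nsmul_le_sum S g _ fun s hs => ?_
    rw [hg]
    have hs' := (Finset.mem_filter.1 hs).2
    rcases le_abs.1 hs' with h | h
    · have : Real.exp (l * r) ≤ Real.exp (l * ∑ x, sgn (s x) * d x) :=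
        Real.exp_le_exp.2 (mul_le_mul_of_nonneg_left h hl0)
      have := Real.exp_pos (-l * ∑ x, sgn (s x) * d x)
      linarith
    · have : Real.exp (l * r) ≤ Real.exp (-l * ∑ x, sgn (s x) * d x) := by
        refine Real.exp_le_exp.2 ?_
        rw [neg_mul, ← mul_neg]
        exact mul_le_mul_of_nonneg_left h hl0
      have := Real.exp_pos (l * ∑ x, sgn (s x) * d x)
      linarith
  have h2 := sum_exp_sgn_le d l
  have h3 := sum_exp_sgn_le d (-l)
  rw [neg_sq] at h3
  rw [Finset.sum_add_distrib] at h1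
  have h4 : Real.exp (l ^ 2 * (∑ x, d x ^ 2) / 2) ≤ Real.exp (l ^ 2 * V / 2) :=
    Real.exp_le_exp.2 (by gcongr)
  have h5 : Real.exp (l ^ 2 * V / 2) = Real.exp (-(r ^ 2 / (2 * V))) * Real.exp (l * r) := by
    rw [← Real.exp_add]
    congr 1
    rw [hl]
    field_simp
    ring
  have h6 : (Fintype.card (X → Bool) : ℝ) * Real.exp (l ^ 2 * (∑ x, d x ^ 2) / 2)
      ≤ Fintype.card (X → Bool) * (Real.exp (-(r ^ 2 / (2 * V))) * Real.exp (l * r)) := by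
    rw [← h5]; gcongr
  refine le_of_mul_le_mul_right ?_ (Real.exp_pos (l * r))
  linarith

/-- All sets `F s ⁻¹' D` have the measure of `D`, so averaging over `s` turns a count of bad sign
patterns at almost every fixed point into a probability bound, with no conditioning. -/
lemma measureReal_le_of_card_le {α S : Type*} [MeasurableSpace α] {μ : Measure α}
    [IsProbabilityMeasure μ] [Fintype S] [Nonempty S] {F : S → α → α}
    (hF : ∀ s, MeasurePreserving (F s) μ μ) {D : Set α} (hD : MeasurableSet D) {δ : ℝ}
    (h : ∀ᵐ z ∂μ, (Nat.card {s // F s z ∈ D} : ℝ) ≤ δ * Fintype.card S) : μ.real D ≤ δ := by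
  classical
  have hi : ∀ s ∈ (Finset.univ : Finset S),
      Integrable (fun z => Set.indicator (F s ⁻¹' D) (fun _ => (1 : ℝ)) z) μ := fun s _ =>
    (integrable_const _).indicator ((hF s).measurable hD)
  have h1 : ∫ z, ∑ s, Set.indicator (F s ⁻¹' D) (fun _ => (1 : ℝ)) z ∂μ = Fintype.card S * μ.real D := by
    rw [integral_finsetSum _ hi]
    have : ∀ s, ∫ z, Set.indicator (F s ⁻¹' D) (fun _ => (1 : ℝ)) z ∂μ = μ.real D := by
      intro s
      rw [integral_indicator ((hF s).measurable hD), setIntegral_const, smul_eq_mul, mul_one,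
        measureReal_def, (hF s).measure_preimage hD.nullMeasurableSet]
      rfl
    simp [this]
  have h2 : ∫ z, ∑ s, Set.indicator (F s ⁻¹' D) (fun _ => (1 : ℝ)) z ∂μ ≤ ∫ z, δ * Fintype.card S ∂μ := by
    refine integral_mono_ae (integrable_finsetSum _ hi) (integrable_const _) ?_
    filter_upwards [h] with z hz
    refine le_trans (le_of_eq ?_) hz
    rw [Nat.card_eq_fintype_card, Fintype.card_subtype, Finset.card_filter]
    push_cast
    refine Finset.sum_congr rfl fun s _ => ?_
    simp [Set.indicator_apply]
  rw [h1] at h2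
  simp only [integral_const, probReal_univ, smul_eq_mul, one_mul] at h2
  have hc : (0 : ℝ) < Fintype.card S := by exact_mod_cast Fintype.card_pos
  rw [mul_comm δ] at h2
  exact le_of_mul_le_mul_left h2 hc

/-! ### Concentration of the iterated transforms under random sign flips -/

section Flip

variable {k n : ℕ}

/-- Multiply the values of function number `j` on `A` by the signs `s`. -/
noncomputable def flip (j : ℕ) (A : Finset (Cube n)) (s : Cube n → Bool) (z : Tuple k n) :
    Tuple k n :=
  fun p => (if p.1.val = j ∧ p.2 ∈ A then sgn (s p.2) else 1) * z p

lemma blk_flip (j : ℕ) (A : Finset (Cube n)) (s : Cube n → Bool) (z : Tuple k n) (i : ℕ)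
    (x : Cube n) : blk (flip j A s z) i x = (if i = j ∧ x ∈ A then sgn (s x) else 1) * blk z i x := by
  unfold blk flip
  split_ifs <;> simp_all

lemma iter_flip (j : ℕ) (A : Finset (Cube n)) (s : Cube n → Bool) (z : Tuple k n) :
    iter (flip j A s z) j = iter z j := by
  refine iter_congr fun i hi x => ?_
  rw [blk_flip, if_neg (by omega), one_mul]

lemma measurePreserving_mul_rademacher (b : Bool) :
    MeasurePreserving (fun x => sgn b * x) rademacher rademacher := by
  refine ⟨by fun_prop, ?_⟩
  have hm : Measurable fun x : ℝ => sgn b * x := by fun_prop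
  rw [rademacher, Measure.map_add _ _ hm, Measure.map_smul, Measure.map_smul,
    Measure.map_dirac' hm, Measure.map_dirac' hm]
  cases b
  · simp [sgn, add_comm]
  · simp [sgn]

lemma measurePreserving_flip {j : ℕ} (hj : j + 2 < k) (A : Finset (Cube n)) (s : Cube n → Bool) :
    MeasurePreserving (flip j A s) (uniformLaw k n) (uniformLaw k n) := by
  refine measurePreserving_pi (f := fun (p : Fin k × Cube n) (a : ℝ) =>
    (if p.1.val = j ∧ p.2 ∈ A then sgn (s p.2) else 1) * a) _ _ fun p => ?_
  by_cases h : p.1.val = j ∧ p.2 ∈ A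
  · simp only [h, and_self, if_true]
    have : valueLaw k p.1 = rademacher := by
      rw [valueLaw, if_pos (by omega)]
    rw [this]
    exact measurePreserving_mul_rademacher _
  · simp only [if_neg h, one_mul]
    exact MeasurePreserving.id _

lemma measurable_blk (i : ℕ) (x : Cube n) : Measurable fun z : Tuple k n => blk z i x := by
  unfold blk
  split_ifs <;> fun_prop

lemma measurable_iter (j : ℕ) (x : Cube n) : Measurable fun z : Tuple k n => iter z j x := by
  induction j generalizing x with
  | zero => exact measurable_const
  | succ j ih =>
    simp only [iter, had]
    exact (Finset.measurable_sum _ fun y _ =>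
      ((measurable_blk j y).mul (ih y)).const_mul _).const_mul _

lemma ae_blk_sq_eq_one : ∀ᵐ z ∂uniformLaw k n, ∀ i, i + 2 < k → ∀ x, blk z i x ^ 2 = 1 := by
  have h : ∀ᵐ z ∂uniformLaw k n, ∀ p : Fin k × Cube n, p.1.val + 2 < k → z p ^ 2 = 1 := by
    rw [ae_all_iff]
    intro p
    by_cases hp : p.1.val + 2 < k
    · have h1 : ∀ᵐ a ∂valueLaw k p.1, a ^ 2 = 1 := by
        rw [valueLaw, if_pos hp, rademacher, ae_add_measure_iff]
        constructor
        · refine Measure.ae_smul_measure ?_ _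
          rw [ae_dirac_iff (measurableSet_eq_fun (by fun_prop) (by fun_prop))]; norm_num
        · refine Measure.ae_smul_measure ?_ _
          rw [ae_dirac_iff (measurableSet_eq_fun (by fun_prop) (by fun_prop))]; norm_num
      filter_upwards [(measurePreserving_eval (fun p : Fin k × Cube n => valueLaw k p.1)
        p).quasiMeasurePreserving.ae h1] with z hz _
      exact hz
    · exact ae_of_all _ fun z h => absurd h hp
  filter_upwards [h] with z hz i hi x
  rw [blk, dif_pos (by omega)]
  exact hz _ hi

/-- For fixed earlier functions this transform is a linear form in the signs of function number `j`,
and its coefficients have square sum 1 by Parseval; Hoeffding applies. -/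
lemma measureReal_iter_ge_le {j : ℕ} (hj : j + 2 < k) (y : Cube n) {r : ℝ} (hr : 0 ≤ r) :
    (uniformLaw k n).real {z | r ≤ |iter z (j + 1) y|} ≤ 2 * Real.exp (-(r ^ 2 / 2)) := by
  refine measureReal_le_of_card_le (fun s => measurePreserving_flip hj Finset.univ s)
    (measurableSet_le measurable_const (measurable_iter _ _).abs) ?_
  filter_upwards [ae_blk_sq_eq_one] with z hz
  set d : Cube n → ℝ := fun x => (rootN n)⁻¹ * (chi x y * (blk z j x * iter z j x)) with hd
  have h1 : ∀ s : Cube n → Bool, iter (flip j Finset.univ s z) (j + 1) y = ∑ x, sgn (s x) * d x := by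
    intro s
    simp only [iter, had, Finset.mul_sum, iter_flip, blk_flip, Finset.mem_univ, and_true, if_true, hd]
    exact Finset.sum_congr rfl fun x _ => by ring
  have h2 : ∑ x, d x ^ 2 = 1 := by
    have h3 : ∀ x, d x ^ 2 = (2 ^ n)⁻¹ * iter z j x ^ 2 := by
      intro x
      rw [hd]
      simp only [mul_pow, chi_sq, hz j hj, inv_pow, rootN_sq, one_mul]
    simp_rw [h3]
    rw [← Finset.mul_sum, sum_iter_sq fun i hi x => hz i (by omega) x]
    exact inv_mul_cancel₀ (by positivity)
  simp only [h1]
  rw [Nat.card_eq_fintype_card]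
  simpa using card_abs_sum_sgn_ge_le d one_pos h2.le hr

/-- Multiplying by a character on the transform side is a translation by `s`; Parseval then gives
the autocorrelation of `f`. -/
lemma sum_had_sq_mul_chi (f : Cube n → ℝ) (s : Cube n) :
    ∑ x, had f x ^ 2 * chi x s = ∑ u, f u * f (u + s) := by
  have h1 : ∀ x, had (fun u => f (u + s)) x = chi x s * had f x := by
    intro x
    have e : ∑ u, chi u x * f (u + s) = chi x s * ∑ u, chi u x * f u := by
      rw [← Equiv.sum_comp (Equiv.addRight s) (fun u => chi u x * f (u + s)), Finset.mul_sum]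
      refine Finset.sum_congr rfl fun u _ => ?_
      simp only [Equiv.coe_addRight, add_assoc, add_self_cube, add_zero]
      rw [← chi_mul_chi, chi_comm x s]; ring
    simp only [had]
    rw [e]; ring
  have h2 : ∀ x, had f x ^ 2 * chi x s = had f x * had (fun u => f (u + s)) x := by
    intro x; rw [h1]; ring
  simp_rw [h2]
  rw [sum_had_mul, had_had]

/-- The autocorrelation is quadratic in the signs of function number `j`. Flipping only the signs on
a half-space that contains exactly one of u and u + s makes it linear in the flips, so Hoeffding
applies again, with V = 4B⁴/N. -/
lemma measureReal_autocorrelation_ge_le {j : ℕ} (hj : j + 2 < k) {s : Cube n} (hs : s ≠ 0)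
    {B r : ℝ} (hB : 0 < B) (hr : 0 ≤ r) :
    (uniformLaw k n).real {z | (∀ u, |iter z j u| ≤ B) ∧
      r ≤ |(2 ^ n)⁻¹ * ∑ x, iter z (j + 1) x ^ 2 * chi x s|}
      ≤ 2 * Real.exp (-(r ^ 2 * 2 ^ n / (8 * B ^ 4))) := by
  obtain ⟨i, hi⟩ := Function.ne_iff.1 hs
  have hi' : s i ≠ 0 := hi
  -- Since s i ≠ 0, translation by s exchanges `A` and its complement.
  set A : Finset (Cube n) := Finset.univ.filter fun u => u i = 0 with hA
  have hmem : ∀ u, u + s ∈ A ↔ u ∉ A := by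
    intro u
    simp only [hA, Finset.mem_filter, Finset.mem_univ, true_and, Pi.add_apply]
    have : ∀ a b : ZMod 2, b ≠ 0 → (a + b = 0 ↔ a ≠ 0) := by decide
    exact this _ _ hi'
  refine measureReal_le_of_card_le (fun s => measurePreserving_flip hj A s) ?_ ?_
  · have h1 : MeasurableSet {z : Tuple k n | ∀ u, |iter z j u| ≤ B} := by
      rw [Set.ofPred_forall]
      exact MeasurableSet.iInter fun u => measurableSet_le (measurable_iter _ _).abs measurable_const
    exact h1.inter (measurableSet_le measurable_const ((Finset.measurable_sum _ fun x _ =>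
      ((measurable_iter _ _).pow_const 2).mul_const _).const_mul _).abs)
  filter_upwards [ae_blk_sq_eq_one] with z hz
  simp only [iter_flip]
  -- The flips do not touch the earlier functions, so this condition holds for all of them or for
  -- none.
  by_cases hzB : ∀ u, |iter z j u| ≤ B
  swap
  · simp only [hzB, false_and]
    simp
    positivity
  simp only [hzB, implies_true, true_and]
  set F : Cube n → ℝ := fun u => blk z j u * iter z j u with hF
  set d : Cube n → ℝ := fun u => if u ∈ A then (2 ^ n)⁻¹ * (2 * (F u * F (u + s))) else 0 with hd
  have h1 : ∀ σ : Cube n → Bool, (2 ^ n)⁻¹ * ∑ x, iter (flip j A σ z) (j + 1) x ^ 2 * chi x s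
      = ∑ u, sgn (σ u) * d u := by
    intro σ
    simp only [iter, iter_flip, blk_flip, true_and]
    rw [sum_had_sq_mul_chi]
    set G : Cube n → ℝ := fun u => (if u ∈ A then sgn (σ u) else 1) * F u with hG
    have hG' : ∀ u, (if u ∈ A then sgn (σ u) else 1) * blk z j u * iter z j u = G u := by
      intro u; rw [hG, hF]; ring
    simp_rw [hG']
    -- Each unordered pair {u, u + s} occurs twice and meets `A` once.
    have hsplit : ∑ u, G u * G (u + s) = 2 * ∑ u, if u ∈ A then G u * G (u + s) else 0 := by
      have e1 : ∀ u, G u * G (u + s) = (if u ∈ A then G u * G (u + s) else 0) +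
          (if u + s ∈ A then G (u + s) * G (u + s + s) else 0) := by
        intro u
        rw [add_assoc, add_self_cube, add_zero]
        by_cases hu : u ∈ A
        · have : u + s ∉ A := fun h => (hmem u).1 h hu
          simp [hu, this]
        · have := (hmem u).2 hu
          simp [hu, this, mul_comm]
      rw [Finset.sum_congr rfl fun u _ => e1 u, Finset.sum_add_distrib,
        show ∑ u, (if u + s ∈ A then G (u + s) * G (u + s + s) else 0) =
          ∑ u, if u ∈ A then G u * G (u + s) else 0 from
          Equiv.sum_comp (Equiv.addRight s) (fun u => if u ∈ A then G u * G (u + s) else 0)]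
      ring
    rw [hsplit, Finset.mul_sum, Finset.mul_sum]
    refine Finset.sum_congr rfl fun u _ => ?_
    by_cases hu : u ∈ A
    · have : u + s ∉ A := fun h => (hmem u).1 h hu
      simp only [hd, hG, hu, this, if_true, if_false]
      ring
    · simp [hd, hu]
  have hFB : ∀ u, F u ^ 2 ≤ B ^ 2 := by
    intro u
    rw [hF]
    simp only [mul_pow, hz j hj, one_mul]
    exact sq_le_sq' (abs_le.1 (hzB u)).1 (abs_le.1 (hzB u)).2
  have h2 : ∑ u, d u ^ 2 ≤ 4 * B ^ 4 / 2 ^ n := by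
    have h3 : ∀ u, d u ^ 2 ≤ ((2 : ℝ) ^ n)⁻¹ ^ 2 * (4 * B ^ 4) := by
      intro u
      simp only [hd]
      split_ifs
      · rw [mul_pow]
        gcongr
        calc (2 * (F u * F (u + s))) ^ 2 = 4 * (F u ^ 2 * F (u + s) ^ 2) := by ring
          _ ≤ 4 * (B ^ 2 * B ^ 2) := by
            have := mul_le_mul (hFB u) (hFB (u + s)) (sq_nonneg _) (sq_nonneg _)
            linarith
          _ = _ := by ring
      · rw [zero_pow two_ne_zero]; positivity
    refine (Finset.sum_le_sum fun u _ => h3 u).trans (le_of_eq ?_)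
    simp only [Finset.sum_const, Finset.card_univ, card_cube, nsmul_eq_mul]
    push_cast
    field_simp
  simp only [h1]
  rw [Nat.card_eq_fintype_card]
  convert card_abs_sum_sgn_ge_le d (by positivity) h2 hr using 4
  field_simp
  ring

/-- The pseudorandomness conditions on the first `k - 2` functions. -/
def Good (B r : ℝ) (z : Tuple k n) : Prop :=
  (∀ i, i + 2 < k → ∀ x, blk z i x ^ 2 = 1) ∧ (∀ x, |iter z (k - 2) x| ≤ B) ∧
    ∀ s : Cube n, s ≠ 0 → |(2 ^ n)⁻¹ * ∑ x, iter z (k - 2) x ^ 2 * chi x s| ≤ r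

lemma measureReal_exists_iter_ge_le {j : ℕ} (hj : j + 1 < k) {B : ℝ} (hB : 1 < B) :
    (uniformLaw k n).real {z | ∃ y, B ≤ |iter z j y|} ≤ 2 ^ n * (2 * Real.exp (-(B ^ 2 / 2))) := by
  cases j with
  | zero =>
    have : {z : Tuple k n | ∃ y : Cube n, B ≤ |iter z 0 y|} = ∅ := by
      ext z; simp [iter, hB]
    rw [this, measureReal_empty]
    positivity
  | succ j =>
    have : {z : Tuple k n | ∃ y, B ≤ |iter z (j + 1) y|} = ⋃ y, {z | B ≤ |iter z (j + 1) y|} := by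
      ext z; simp
    rw [this]
    refine (measureReal_iUnion_fintype_le _).trans ((Finset.sum_le_sum fun y _ =>
      measureReal_iter_ge_le (by omega) y (by linarith)).trans (le_of_eq ?_))
    simp

/-- For k = 2 there are no sign functions: g = 1, and the Fourier coefficients vanish by
orthogonality. For k ≥ 3 this is a union bound over points and shifts. -/
lemma measureReal_not_good_le (hk : 2 ≤ k) {B r : ℝ} (hB : 1 < B) (hr : 0 ≤ r) :
    (uniformLaw k n).real {z | ¬ Good B r z} ≤
      2 ^ n * (4 * Real.exp (-(B ^ 2 / 2)) + 2 * Real.exp (-(r ^ 2 * 2 ^ n / (8 * B ^ 4)))) := by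
  obtain rfl | hk3 := hk.eq_or_lt
  · have : {z : Tuple 2 n | ¬ Good B r z} = ∅ := by
      ext z
      simp only [Set.mem_ofPred_eq, Set.mem_empty_iff_false, not_not, iff_false]
      refine ⟨fun i hi => by omega, fun x => ?_, fun s hs => ?_⟩
      · simp [iter, hB.le]
      · have : ∑ x : Cube n, iter z (2 - 2) x ^ 2 * chi x s = 0 := by
          simp only [Nat.sub_self, iter, one_pow, one_mul]
          simp_rw [chi_comm _ s]
          exact sum_chi_eq_zero hs
        rw [this]; simpa using hr
    rw [this, measureReal_empty]
    positivity
  · obtain ⟨j, rfl⟩ : ∃ j, k = j + 3 := ⟨k - 3, by omega⟩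
    set μ := uniformLaw (j + 3) n
    set S0 := {z : Tuple (j + 3) n | ¬ ∀ i, i + 2 < j + 3 → ∀ x, blk z i x ^ 2 = 1}
    set S1 := {z : Tuple (j + 3) n | ∃ y, B ≤ |iter z (j + 1) y|}
    -- One level below g = `iter z (j + 1)`; the autocorrelation bound needs this level to be
    -- bounded too.
    set S2 := {z : Tuple (j + 3) n | ∃ y, B ≤ |iter z j y|}
    set S3 := fun s : Cube n => if s = 0 then ∅ else {z : Tuple (j + 3) n | (∀ u, |iter z j u| ≤ B) ∧
      r ≤ |(2 ^ n)⁻¹ * ∑ x, iter z (j + 1) x ^ 2 * chi x s|} with hS3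
    have h0 : μ.real S0 = 0 := by
      rw [measureReal_def, show μ S0 = 0 from ae_iff.1 ae_blk_sq_eq_one, ENNReal.toReal_zero]
    have h1 : μ.real S1 ≤ 2 ^ n * (2 * Real.exp (-(B ^ 2 / 2))) :=
      measureReal_exists_iter_ge_le (by omega) hB
    have h2 : μ.real S2 ≤ 2 ^ n * (2 * Real.exp (-(B ^ 2 / 2))) :=
      measureReal_exists_iter_ge_le (by omega) hB
    have h3 : μ.real (⋃ s, S3 s) ≤ 2 ^ n * (2 * Real.exp (-(r ^ 2 * 2 ^ n / (8 * B ^ 4)))) := by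
      refine (measureReal_iUnion_fintype_le _).trans ((Finset.sum_le_sum (g := fun _ =>
        2 * Real.exp (-(r ^ 2 * 2 ^ n / (8 * B ^ 4)))) fun s _ => ?_).trans (le_of_eq ?_))
      · simp only [hS3]
        split_ifs with h
        · rw [measureReal_empty]; positivity
        · exact measureReal_autocorrelation_ge_le (by omega) h (by linarith) hr
      · simp
    have hsub : {z : Tuple (j + 3) n | ¬ Good B r z} ⊆ S0 ∪ S1 ∪ S2 ∪ ⋃ s, S3 s := by
      intro z hz
      by_contra hcon
      simp only [Set.mem_union, not_or] at hcon
      obtain ⟨⟨⟨n0, n1⟩, n2⟩, n3⟩ := hcon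
      simp only [S0, S1, S2, Set.mem_ofPred_eq, not_not, not_exists, not_le] at n0 n1 n2
      refine hz ⟨n0, fun x => (n1 x).le, fun s hs => ?_⟩
      by_contra hlt
      refine n3 (Set.mem_iUnion.2 ⟨s, ?_⟩)
      simp only [hS3, if_neg hs, Set.mem_ofPred_eq]
      exact ⟨fun u => (n2 u).le, (not_le.1 hlt).le⟩
    have h4 := measureReal_mono (μ := μ) hsub
    have h5 := measureReal_union_le (μ := μ) (S0 ∪ S1 ∪ S2) (⋃ s, S3 s)
    have h6 := measureReal_union_le (μ := μ) (S0 ∪ S1) S2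
    have h7 := measureReal_union_le (μ := μ) S0 S1
    linarith

end Flip


/-! ### Indistinguishability of the two laws by shallow decision trees -/

section Tree

variable {k n : ℕ}

/-- The positions of the last two functions. -/
def lastTwo (hk : 2 ≤ k) : Cube n ⊕ Cube n → Fin k × Cube n :=
  Sum.elim (fun x => (⟨k - 2, by omega⟩, x)) (fun y => (⟨k - 1, by omega⟩, y))

/-- The partial inverse of `lastTwo`. -/
def decodeTwo (p : Fin k × Cube n) : Option (Cube n ⊕ Cube n) :=
  if p.1.val = k - 2 then some (Sum.inl p.2) else if p.1.val = k - 1 then some (Sum.inr p.2) else none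

lemma decodeTwo_eq_some (hk : 2 ≤ k) (p : Fin k × Cube n) (i : Cube n ⊕ Cube n) :
    decodeTwo p = some i ↔ p = lastTwo hk i := by
  obtain ⟨⟨a, ha⟩, x⟩ := p
  unfold decodeTwo lastTwo
  rcases i with y | y
  · simp only [Sum.elim_inl, Prod.mk.injEq, Fin.mk.injEq]
    split_ifs with h1 h2 <;> simp_all
  · simp only [Sum.elim_inr, Prod.mk.injEq, Fin.mk.injEq]
    split_ifs with h1 h2
    · simp; omega
    · simp_all
    · simp_all

/-- The positions of the last function but one. -/
def lastButOne (hk : 2 ≤ k) (x : Cube n) : Fin k × Cube n := (⟨k - 2, by omega⟩, x)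

/-- The partial inverse of `lastButOne`. -/
def decodeOne (p : Fin k × Cube n) : Option (Cube n) :=
  if p.1.val = k - 2 then some p.2 else none

lemma decodeOne_eq_some (hk : 2 ≤ k) (p : Fin k × Cube n) (x : Cube n) :
    decodeOne p = some x ↔ p = lastButOne hk x := by
  obtain ⟨⟨a, ha⟩, y⟩ := p
  unfold decodeOne lastButOne
  simp only [Prod.mk.injEq, Fin.mk.injEq]
  split_ifs <;> simp_all

lemma valueLaw_lastTwo (hk : 2 ≤ k) (i : Cube n ⊕ Cube n) :
    valueLaw k (lastTwo hk i).1 = gaussianReal 0 1 := by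
  rcases i with x | x
  · exact if_neg (show ¬ k - 2 + 2 < k by omega)
  · exact if_neg (show ¬ k - 1 + 2 < k by omega)

/-- `V a`, where `V` is the Hadamard matrix times the diagonal matrix with entries `g`. -/
noncomputable def twist (g a : Cube n → ℝ) : Cube n → ℝ := had fun x => a x * g x

/-- The vectors whose inner products with a Gaussian vector give `a` and `V a`. -/
noncomputable def forrVec (g : Cube n → ℝ) : Cube n ⊕ Cube n → EuclideanSpace ℝ (Cube n) :=
  Sum.elim (fun x => EuclideanSpace.single x 1)
    (fun y => WithLp.toLp 2 fun x => (rootN n)⁻¹ * (chi x y * g x))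

lemma inner_forrVec_inl (g : Cube n → ℝ) (x : Cube n) (u : EuclideanSpace ℝ (Cube n)) :
    inner ℝ (forrVec g (Sum.inl x)) u = u x := by
  simp [forrVec, EuclideanSpace.inner_single_left]

lemma inner_forrVec_inr (g : Cube n → ℝ) (y : Cube n) (a : Cube n → ℝ) :
    inner ℝ (forrVec g (Sum.inr y)) (WithLp.toLp 2 a) = twist g a y := by
  simp only [forrVec, Sum.elim_inr, PiLp.inner_apply, twist, had, Finset.mul_sum]
  refine Finset.sum_congr rfl fun x _ => ?_
  simp
  ring

lemma norm_forrVec {g : Cube n → ℝ} (hg : ∑ x, g x ^ 2 = 2 ^ n) (i : Cube n ⊕ Cube n) :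
    ‖forrVec g i‖ = 1 := by
  rcases i with x | y
  · simp [forrVec]
  · rw [← sq_eq_sq₀ (norm_nonneg _) zero_le_one, forrVec, Sum.elim_inr, EuclideanSpace.norm_sq_eq]
    have : ∀ x, ‖(rootN n)⁻¹ * (chi x y * g x)‖ ^ 2 = (2 ^ n)⁻¹ * g x ^ 2 := by
      intro x
      rw [Real.norm_eq_abs, sq_abs, mul_pow, mul_pow, chi_sq, inv_pow, rootN_sq, one_mul]
    simp only [this]
    rw [← Finset.mul_sum, hg, one_pow]
    exact inv_mul_cancel₀ (by positivity)

/-- Basis vectors are orthogonal; a basis vector and a row of V pair to ±g(x)/√N; two rows of V pair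
to the normalized Fourier coefficient of g² at y + y'. -/
lemma abs_inner_forrVec_le {g : Cube n → ℝ} {B r ε : ℝ} (hg1 : ∀ x, |g x| ≤ B)
    (hg2 : ∀ s : Cube n, s ≠ 0 → |(2 ^ n)⁻¹ * ∑ x, g x ^ 2 * chi x s| ≤ r)
    (hB : B / rootN n ≤ ε) (hr : r ≤ ε) (i j : Cube n ⊕ Cube n) (hij : i ≠ j) :
    |inner ℝ (forrVec g i) (forrVec g j)| ≤ ε := by
  have hN := rootN_pos n
  have hε : 0 ≤ ε := le_trans (by have := (abs_nonneg _).trans (hg1 0); positivity) hB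
  have hcross : ∀ x y, |inner ℝ (forrVec g (Sum.inl x)) (forrVec g (Sum.inr y))| ≤ ε := by
    intro x y
    rw [inner_forrVec_inl]
    simp only [forrVec, Sum.elim_inr]
    rw [abs_mul, abs_mul, abs_chi, one_mul, abs_of_pos (inv_pos.2 hN), inv_mul_eq_div]
    exact (div_le_div_of_nonneg_right (hg1 x) hN.le).trans hB
  rcases i with x | y <;> rcases j with x' | y'
  · rw [inner_forrVec_inl]
    have : x ≠ x' := fun h => hij (by rw [h])
    simp [forrVec, this, hε]
  · exact hcross _ _
  · rw [real_inner_comm]; exact hcross _ _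
  · have hy : y + y' ≠ 0 := fun h => hij (by rw [add_eq_zero_iff_cube.1 h])
    refine le_trans (le_of_eq ?_) ((hg2 (y + y') hy).trans hr)
    congr 1
    simp only [forrVec, Sum.elim_inr, PiLp.inner_apply, Finset.mul_sum]
    refine Finset.sum_congr rfl fun x _ => ?_
    rw [chi_comm x (y + y'), ← chi_mul_chi, chi_comm y, chi_comm y', ← rootN_sq]
    simp
    field_simp

lemma blk_overwrite_of_lt (z : Tuple k n) (w : Cube n ⊕ Cube n → ℝ) {i : ℕ} (hi : i + 2 < k)
    (x : Cube n) : blk (overwrite decodeTwo z w) i x = blk z i x := by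
  rw [blk, blk, dif_pos (by omega), dif_pos (by omega), overwrite]
  have : decodeTwo ((⟨i, by omega⟩, x) : Fin k × Cube n) = none := by
    unfold decodeTwo
    rw [if_neg (by simp; omega), if_neg (by simp; omega)]
  rw [this]; rfl

lemma blk_overwrite_inl (hk : 2 ≤ k) (z : Tuple k n) (w : Cube n ⊕ Cube n → ℝ) (x : Cube n) :
    blk (overwrite decodeTwo z w) (k - 2) x = w (Sum.inl x) := by
  have h : decodeTwo ((⟨k - 2, by omega⟩, x) : Fin k × Cube n) = some (Sum.inl x) :=
    (decodeTwo_eq_some hk _ _).2 rfl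
  rw [blk, dif_pos (by omega), overwrite, h]; rfl

lemma blk_overwrite_inr (hk : 2 ≤ k) (z : Tuple k n) (w : Cube n ⊕ Cube n → ℝ) (x : Cube n) :
    blk (overwrite decodeTwo z w) (k - 1) x = w (Sum.inr x) := by
  have h : decodeTwo ((⟨k - 1, by omega⟩, x) : Fin k × Cube n) = some (Sum.inr x) :=
    (decodeTwo_eq_some hk _ _).2 rfl
  rw [blk, dif_pos (by omega), overwrite, h]; rfl

lemma iter_overwrite (z : Tuple k n) (w : Cube n ⊕ Cube n → ℝ) :
    iter (overwrite decodeTwo z w) (k - 2) = iter z (k - 2) :=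
  iter_congr fun _ hi x => blk_overwrite_of_lt z w (by omega) x

lemma iter_overwrite_last (hk : 2 ≤ k) (z : Tuple k n) (w : Cube n ⊕ Cube n → ℝ) :
    iter (overwrite decodeTwo z w) (k - 1) = twist (iter z (k - 2)) fun x => w (Sum.inl x) := by
  rw [show k - 1 = (k - 2) + 1 by omega, iter, iter_overwrite, twist]
  congr 1
  funext x
  rw [blk_overwrite_inl hk]

/-- Conditionally on the first k - 2 functions, the forrelated law is the law of (a, V a). -/
lemma forrelate_overwrite (hk : 2 ≤ k) (z : Tuple k n) (a : Cube n → ℝ) :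
    forrelate (overwrite decodeOne z a)
      = overwrite decodeTwo z (Sum.elim a (twist (iter z (k - 2)) a)) := by
  have hz : ∀ i < k - 1, ∀ x, blk (overwrite decodeOne z a) i x
      = blk (overwrite decodeTwo z (Sum.elim a (twist (iter z (k - 2)) a))) i x := by
    intro i hi x
    rw [blk, blk, dif_pos (by omega), dif_pos (by omega), overwrite, overwrite]
    unfold decodeOne decodeTwo
    by_cases h : i = k - 2
    · simp [h]
    · simp only [h, if_false]
      rw [if_neg (by omega)]; rfl
  funext p
  unfold forrelate
  split_ifs with h
  · rw [lastTransform_eq (by omega), iter_congr hz, iter_overwrite_last hk, overwrite]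
    have : decodeTwo p = some (Sum.inr p.2) := by
      rw [decodeTwo, if_neg (by omega), if_pos (by omega)]
    rw [this]; rfl
  · rw [overwrite, overwrite]
    unfold decodeOne decodeTwo
    by_cases h' : p.1.val = k - 2
    · simp [h']
    · simp only [h', if_false]
      rw [if_neg (by omega)]; rfl

/-- Conditioning on the first k - 2 functions; the last two functions of the outer `z` are
overwritten and play no role. -/
lemma integral_uniformLaw_eq (hk : 2 ≤ k) {p : Tuple k n → ℝ} (hp : Measurable p)
    (hp1 : ∀ z, p z ∈ Set.Icc (0 : ℝ) 1) :
    ∫ z, p z ∂uniformLaw k n = ∫ z, ∫ w, p (overwrite decodeTwo z w)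
      ∂Measure.pi (fun _ : Cube n ⊕ Cube n => gaussianReal 0 1) ∂uniformLaw k n := by
  have h := measurePreserving_overwrite (fun q : Fin k × Cube n => valueLaw k q.1) (lastTwo hk)
    decodeTwo (decodeTwo_eq_some hk)
  simp only [valueLaw_lastTwo] at h
  unfold uniformLaw
  conv_lhs => rw [← h.map_eq]
  rw [integral_map h.measurable.aemeasurable hp.aestronglyMeasurable, integral_prod]
  exact Integrable.of_mem_Icc 0 1 (hp.comp h.measurable).aemeasurable (ae_of_all _ fun _ => hp1 _)

lemma integral_forrelatedLaw_eq (hk : 2 ≤ k) {p : Tuple k n → ℝ} (hp : Measurable p)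
    (hp1 : ∀ z, p z ∈ Set.Icc (0 : ℝ) 1) :
    ∫ z, p z ∂forrelatedLaw k n = ∫ z, ∫ a, p (overwrite decodeTwo z
      (Sum.elim a (twist (iter z (k - 2)) a)))
      ∂Measure.pi (fun _ : Cube n => gaussianReal 0 1) ∂uniformLaw k n := by
  have h := measurePreserving_overwrite (fun q : Fin k × Cube n => valueLaw k q.1) (lastButOne hk)
    decodeOne (decodeOne_eq_some hk)
  have hv : ∀ x : Cube n, valueLaw k (lastButOne hk x).1 = gaussianReal 0 1 :=
    fun x => valueLaw_lastTwo hk (Sum.inl x)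
  simp only [hv] at h
  have hm : Measurable fun z : Tuple k n => p (forrelate z) := hp.comp measurable_forrelate
  rw [forrelatedLaw, integral_map measurable_forrelate.aemeasurable hp.aestronglyMeasurable]
  simp_rw [← forrelate_overwrite hk]
  unfold uniformLaw
  conv_lhs => rw [← h.map_eq]
  rw [integral_map h.measurable.aemeasurable hm.aestronglyMeasurable, integral_prod]
  exact Integrable.of_mem_Icc 0 1 (hm.comp h.measurable).aemeasurable (ae_of_all _ fun _ => hp1 _)

lemma measurableSet_good (B r : ℝ) : MeasurableSet {z : Tuple k n | Good B r z} := by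
  have h1 : MeasurableSet {z : Tuple k n | ∀ i, i + 2 < k → ∀ x, blk z i x ^ 2 = 1} := by
    simp only [Set.ofPred_forall]
    exact MeasurableSet.iInter fun i => MeasurableSet.iInter fun _ => MeasurableSet.iInter fun x =>
      measurableSet_eq_fun ((measurable_blk i x).pow_const 2) measurable_const
  have h2 : MeasurableSet {z : Tuple k n | ∀ x, |iter z (k - 2) x| ≤ B} := by
    simp only [Set.ofPred_forall]
    exact MeasurableSet.iInter fun x => measurableSet_le (measurable_iter _ x).abs measurable_const
  have h3 : MeasurableSet {z : Tuple k n | ∀ s : Cube n, s ≠ 0 →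
      |(2 ^ n)⁻¹ * ∑ x, iter z (k - 2) x ^ 2 * chi x s| ≤ r} := by
    simp only [Set.ofPred_forall]
    exact MeasurableSet.iInter fun s => MeasurableSet.iInter fun _ =>
      measurableSet_le ((Finset.measurable_sum _ fun x _ =>
        ((measurable_iter _ x).pow_const 2).mul_const _).const_mul _).abs measurable_const
  exact h1.inter (h2.inter h3)

lemma sum_iter_sq_of_good {B r : ℝ} {z : Tuple k n} (hz : Good B r z) :
    ∑ x, iter z (k - 2) x ^ 2 = 2 ^ n :=
  sum_iter_sq fun i hi x => hz.1 i (by omega) x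

lemma overwrite_treeFun {t : ℕ} {p : Tuple k n → ℝ} (hp : TreeFun t p) (z : Tuple k n) :
    TreeFun t fun w : Cube n ⊕ Cube n → ℝ => p (overwrite decodeTwo z w) := by
  refine hp.comp (fun w => overwrite decodeTwo z w)
    ((measurable_overwrite decodeTwo).comp measurable_prodMk_left) fun j => ?_
  unfold overwrite
  cases h : decodeTwo j with
  | none => exact Or.inl ⟨z j, fun w => rfl⟩
  | some i => exact Or.inr ⟨i, id, measurable_id, fun w => rfl⟩

lemma measurable_twist {α : Type*} [MeasurableSpace α] {g a : α → Cube n → ℝ}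
    (hg : ∀ x, Measurable fun u => g u x) (ha : ∀ x, Measurable fun u => a u x) (y : Cube n) :
    Measurable fun u => twist (g u) (a u) y := by
  simp only [twist, had]
  exact (Finset.measurable_sum _ fun x _ => ((ha x).mul (hg x)).const_mul _).const_mul _

lemma measurable_overwrite_twist :
    Measurable fun y : Tuple k n × (Cube n → ℝ) => overwrite decodeTwo y.1
      (Sum.elim y.2 (twist (iter y.1 (k - 2)) y.2)) := by
  refine (measurable_overwrite decodeTwo).comp (measurable_fst.prodMk ?_)
  refine measurable_pi_lambda _ fun i => ?_
  rcases i with x | y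
  · simp only; fun_prop
  · exact measurable_twist (fun x => (measurable_iter _ x).comp measurable_fst)
      (fun x => by fun_prop) y

/-- Shallow decision trees do not distinguish the forrelated from the uniform law. -/
theorem integral_forrelatedLaw_sub_le (hk : 2 ≤ k) {t : ℕ} (ht : 0 < t) {p : Tuple k n → ℝ}
    (hp : TreeFun t p) {B r ε κ : ℝ} (hε : 0 < ε) (hB : B / rootN n ≤ ε) (hr : r ≤ ε)
    (hεt : ε * t ≤ 1 / 2) (hκ : 0 < κ) (hκ1 : κ ≤ 1) :
    ∫ z, p z ∂forrelatedLaw k n - ∫ z, p z ∂uniformLaw k n ≤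
      (uniformLaw k n).real {z | ¬ Good B r z} + (κ + (ε * t) ^ 2 *
        (Real.log (2 * (2 ^ n + 2 ^ n)) ^ 2 + 7) / κ) := by
  set D := κ + (ε * t) ^ 2 * (Real.log (2 * (2 ^ n + 2 ^ n)) ^ 2 + 7) / κ with hD
  have hD0 : 0 ≤ D := by positivity
  have hpm := hp.measurable
  rw [integral_forrelatedLaw_eq hk hpm hp.mem_Icc, integral_uniformLaw_eq hk hpm hp.mem_Icc]
  set ν := Measure.pi (fun _ : Cube n => gaussianReal 0 1)
  set ρ := Measure.pi (fun _ : Cube n ⊕ Cube n => gaussianReal 0 1)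
  set f1 : Tuple k n → ℝ := fun z => ∫ a, p (overwrite decodeTwo z
    (Sum.elim a (twist (iter z (k - 2)) a))) ∂ν with hf1
  set f2 : Tuple k n → ℝ := fun z => ∫ w, p (overwrite decodeTwo z w) ∂ρ with hf2
  have hm1 : Measurable f1 :=
    (StronglyMeasurable.integral_prod_right (f := fun z a => p (overwrite decodeTwo z
      (Sum.elim a (twist (iter z (k - 2)) a))))
      (hpm.comp measurable_overwrite_twist).stronglyMeasurable).measurable
  have hm2 : Measurable f2 :=
    (StronglyMeasurable.integral_prod_right (f := fun z w => p (overwrite decodeTwo z w))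
      (hpm.comp (measurable_overwrite decodeTwo)).stronglyMeasurable).measurable
  have hint : ∀ {α : Type} [MeasurableSpace α] (μ : Measure α) [IsProbabilityMeasure μ]
      (f : α → ℝ), (∀ x, f x ∈ Set.Icc (0 : ℝ) 1) → ∫ x, f x ∂μ ∈ Set.Icc (0 : ℝ) 1 := by
    intro α _ μ _ f hf
    refine ⟨integral_nonneg fun x => (hf x).1, ?_⟩
    have := integral_mono_of_nonneg (μ := μ) (ae_of_all _ fun x => (hf x).1)
      (integrable_const (1 : ℝ)) (ae_of_all _ fun x => (hf x).2)
    simpa using this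
  have hr1 : ∀ z, f1 z ∈ Set.Icc (0 : ℝ) 1 := fun z => hint ν _ fun a => hp.mem_Icc _
  have hr2 : ∀ z, f2 z ∈ Set.Icc (0 : ℝ) 1 := fun z => hint ρ _ fun a => hp.mem_Icc _
  have hi1 : Integrable f1 (uniformLaw k n) :=
    Integrable.of_mem_Icc 0 1 hm1.aemeasurable (ae_of_all _ hr1)
  have hi2 : Integrable f2 (uniformLaw k n) :=
    Integrable.of_mem_Icc 0 1 hm2.aemeasurable (ae_of_all _ hr2)
  have hgood : MeasurableSet {z : Tuple k n | ¬ Good B r z} := (measurableSet_good B r).compl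
  -- For good `z` the restricted tree meets weakly correlated Gaussians; for the others the trivial
  -- bound 1 is used.
  have hle : ∀ z, f1 z - f2 z ≤ Set.indicator {z | ¬ Good B r z} (fun _ => (1 : ℝ)) z + D := by
    intro z
    by_cases hz : Good B r z
    · rw [Set.indicator_of_notMem (by simpa using hz), zero_add]
      have hN := sum_iter_sq_of_good hz
      have key := treeFun_correlated_sub_le (norm_forrVec hN) hε
        (abs_inner_forrVec_le hz.2.1 hz.2.2 hB hr) ht hεt hκ hκ1 (overwrite_treeFun hp z)
      have hmap := map_pi_eq_stdGaussian (ι := Cube n)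
      have hmeas : Measurable fun x : EuclideanSpace ℝ (Cube n) =>
          p (overwrite decodeTwo z fun i => inner ℝ (forrVec (iter z (k - 2)) i) x) :=
        hpm.comp (((measurable_overwrite decodeTwo).comp measurable_prodMk_left).comp
          (measurable_pi_lambda _ fun i => by fun_prop))
      rw [← hmap, integral_map (by fun_prop) hmeas.aestronglyMeasurable] at key
      have hE : ∀ a : Cube n → ℝ, (fun i => inner ℝ (forrVec (iter z (k - 2)) i) (WithLp.toLp 2 a))
          = Sum.elim a (twist (iter z (k - 2)) a) := by
        intro a
        funext i
        rcases i with x | y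
        · rw [inner_forrVec_inl]; rfl
        · rw [inner_forrVec_inr]; rfl
      simp only [hE, Fintype.card_sum, card_cube] at key
      push_cast at key
      exact key
    · rw [Set.indicator_of_mem (by simpa using hz)]
      have := (hr1 z).2
      have := (hr2 z).1
      linarith
  rw [← integral_sub hi1 hi2]
  have hind : Integrable (Set.indicator {z : Tuple k n | ¬ Good B r z} (fun _ => (1 : ℝ)))
      (uniformLaw k n) := (integrable_const _).indicator hgood
  refine (integral_mono (hi1.sub hi2) (hind.add (integrable_const D)) hle).trans (le_of_eq ?_)
  simp only [Pi.add_apply]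
  rw [integral_add hind (integrable_const D)]
  have : ∫ z, Set.indicator {z : Tuple k n | ¬ Good B r z} (fun _ => (1 : ℝ)) z ∂uniformLaw k n
      = (uniformLaw k n).real {z | ¬ Good B r z} := by
    rw [integral_indicator hgood, setIntegral_const, smul_eq_mul, mul_one]
  rw [this]
  simp

end Tree


/-! ### Truncated runs of a query algorithm -/

namespace QueryAlg

variable {I Ω : Type*} [MeasurableSpace Ω]

open Classical in
/-- Continue the run after `m` queries with answers `a` for at most `t` further queries; the value
is `1` if the algorithm halts by then with output `true`, and `0` otherwise. -/
noncomputable def run (A : QueryAlg I Ω) :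
    ℕ → (m : ℕ) → Ω → (Fin m → ℝ) → (I → ℝ) → ℝ
  | 0, m, ω, a, _ => if A.halt m ω a = some true then 1 else 0
  | t + 1, m, ω, a, z => if A.halt m ω a = some true then 1 else
      if A.halt m ω a = some false then 0 else
        run A t (m + 1) ω (Fin.snoc a (z (A.query m ω a))) z

lemma measurable_snoc {α : Type*} [MeasurableSpace α] {m : ℕ} {a : α → Fin m → ℝ} {b : α → ℝ}
    (ha : Measurable a) (hb : Measurable b) :
    Measurable fun u => (Fin.snoc (a u) (b u) : Fin (m + 1) → ℝ) := by
  refine measurable_pi_lambda _ fun i => ?_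
  refine Fin.lastCases ?_ (fun j => ?_) i
  · simpa using hb
  · simp only [Fin.snoc_castSucc]
    exact (measurable_pi_apply j).comp ha

/-- The queried position takes finitely many values, so the answer is a finite sum of measurable
pieces. -/
lemma measurable_query [Fintype I] (A : QueryAlg I Ω) {α : Type*} [MeasurableSpace α] {m : ℕ}
    {ω : α → Ω} {a : α → Fin m → ℝ} {z : α → I → ℝ} (hω : Measurable ω) (ha : Measurable a)
    (hz : Measurable z) : Measurable fun u => z u (A.query m (ω u) (a u)) := by
  classical
  have : (fun u => z u (A.query m (ω u) (a u))) =
      fun u => ∑ i, if A.query m (ω u) (a u) = i then z u i else 0 := by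
    funext u; simp
  rw [this]
  refine Finset.measurable_sum _ fun i _ => Measurable.ite ?_ ((measurable_pi_apply i).comp hz)
    measurable_const
  exact (hω.prodMk ha) (A.measurableSet_query m i)

lemma measurable_run [Fintype I] (A : QueryAlg I Ω) {α : Type*} [MeasurableSpace α] (t : ℕ) {m : ℕ}
    {ω : α → Ω} {a : α → Fin m → ℝ} {z : α → I → ℝ} (hω : Measurable ω) (ha : Measurable a)
    (hz : Measurable z) : Measurable fun u => A.run t m (ω u) (a u) (z u) := by
  induction t generalizing m with
  | zero =>
    exact Measurable.ite ((hω.prodMk ha) (A.measurableSet_halt m true)) measurable_const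
      measurable_const
  | succ t ih =>
    refine Measurable.ite ((hω.prodMk ha) (A.measurableSet_halt m true)) measurable_const
      (Measurable.ite ((hω.prodMk ha) (A.measurableSet_halt m false)) measurable_const ?_)
    exact ih (measurable_snoc ha (A.measurable_query hω ha hz))

lemma treeFun_const [Nonempty I] (t : ℕ) {c : ℝ} (h0 : 0 ≤ c) (h1 : c ≤ 1) :
    TreeFun t (fun _ : I → ℝ => c) := by
  induction t with
  | zero => exact ⟨c, h0, h1, rfl⟩
  | succ t ih => exact ih.mono_succ

lemma treeFun_run [Fintype I] [Nonempty I] (A : QueryAlg I Ω) (ω : Ω) (t m : ℕ) (a : Fin m → ℝ) :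
    TreeFun t (A.run t m ω a) := by
  induction t generalizing m with
  | zero =>
    by_cases h : A.halt m ω a = some true
    · exact ⟨1, zero_le_one, le_rfl, by funext z; simp [run, h]⟩
    · exact ⟨0, le_rfl, zero_le_one, by funext z; simp [run, h]⟩
  | succ t ih =>
    by_cases h : A.halt m ω a = some true
    · have : A.run (t + 1) m ω a = fun _ => 1 := by funext z; simp [run, h]
      rw [this]; exact treeFun_const _ zero_le_one le_rfl
    by_cases h' : A.halt m ω a = some false
    · have : A.run (t + 1) m ω a = fun _ => 0 := by funext z; simp [run, h']
      rw [this]; exact treeFun_const _ le_rfl zero_le_one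
    · refine ⟨A.query m ω a, fun b z => A.run t (m + 1) ω (Fin.snoc a b) z, ?_, fun b => ih _ _,
        fun z => by simp [run, h, h']⟩
      exact A.measurable_run t measurable_const (measurable_snoc measurable_const measurable_fst)
        measurable_snd

lemma run_eq_zero_or_one (A : QueryAlg I Ω) (t m : ℕ) (ω : Ω) (a : Fin m → ℝ) (z : I → ℝ) :
    A.run t m ω a z = 0 ∨ A.run t m ω a z = 1 := by
  induction t generalizing m with
  | zero => unfold run; split_ifs <;> simp
  | succ t ih => unfold run; split_ifs <;> simp [ih]

lemma run_eq_one_iff (A : QueryAlg I Ω) (t m : ℕ) (ω : Ω) (z : I → ℝ) :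
    A.run t m ω (A.answers ω z m) z = 1 ↔ ∃ m', m ≤ m' ∧ m' ≤ m + t ∧
      A.halt m' ω (A.answers ω z m') = some true ∧
      ∀ j, m ≤ j → j < m' → A.halt j ω (A.answers ω z j) = none := by
  induction t generalizing m with
  | zero =>
    unfold run
    constructor
    · intro h
      split_ifs at h with h1
      · exact ⟨m, le_rfl, le_rfl, h1, fun j _ _ => by omega⟩
      · simp at h
    · rintro ⟨m', h1, h2, h3, -⟩
      obtain rfl : m' = m := by omega
      rw [if_pos h3]
  | succ t ih =>
    have hs : A.answers ω z (m + 1)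
        = Fin.snoc (A.answers ω z m) (z (A.query m ω (A.answers ω z m))) := rfl
    unfold run
    rw [← hs]
    constructor
    · intro h
      split_ifs at h with h1 h2
      · exact ⟨m, le_rfl, by omega, h1, fun j _ _ => by omega⟩
      · simp at h
      · obtain ⟨m', g1, g2, g3, g4⟩ := (ih (m + 1)).1 h
        refine ⟨m', by omega, by omega, g3, fun j hj hj' => ?_⟩
        rcases hj.eq_or_lt with rfl | hj
        · cases hh : A.halt m ω (A.answers ω z m) with
          | none => rfl
          | some b => cases b <;> simp_all
        · exact g4 j hj hj'
    · rintro ⟨m', h1, h2, h3, h4⟩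
      rcases h1.eq_or_lt with rfl | h1
      · rw [if_pos h3]
      · have := h4 m le_rfl h1
        rw [if_neg (by simp [this]), if_neg (by simp [this])]
        exact (ih (m + 1)).2 ⟨m', h1, by omega, h3, fun j hj hj' => h4 j (by omega) hj'⟩

/-- The output of the run that is cut off after `t` queries. -/
noncomputable def accept (A : QueryAlg I Ω) (t : ℕ) (ω : Ω) (z : I → ℝ) : ℝ :=
  A.run t 0 ω Fin.elim0 z

/-- The algorithm has not halted after `t` queries. -/
def Running (A : QueryAlg I Ω) (t : ℕ) (ω : Ω) (z : I → ℝ) : Prop :=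
  ∀ j ≤ t, A.halt j ω (A.answers ω z j) = none

lemma accept_eq_one_iff (A : QueryAlg I Ω) (t : ℕ) (ω : Ω) (z : I → ℝ) :
    A.accept t ω z = 1 ↔ ∃ m' ≤ t, A.halt m' ω (A.answers ω z m') = some true ∧
      ∀ j < m', A.halt j ω (A.answers ω z j) = none := by
  have := A.run_eq_one_iff t 0 ω z
  simp only [zero_le, zero_add, true_and, true_imp_iff] at this
  exact this

lemma accept_mem_Icc (A : QueryAlg I Ω) (t : ℕ) (ω : Ω) (z : I → ℝ) :
    A.accept t ω z ∈ Set.Icc (0 : ℝ) 1 := by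
  rcases A.run_eq_zero_or_one t 0 ω Fin.elim0 z with h | h <;> simp [accept, h]

lemma accept_ne_one_of_outputs_false (A : QueryAlg I Ω) (t : ℕ) {ω : Ω} {z : I → ℝ}
    (h : A.Outputs ω z false) : A.accept t ω z = 0 := by
  refine (A.run_eq_zero_or_one t 0 ω Fin.elim0 z).resolve_right fun h1 => ?_
  obtain ⟨m, hm, hm'⟩ := h
  obtain ⟨m', -, h2, h3⟩ := (A.accept_eq_one_iff t ω z).1 h1
  rcases lt_trichotomy m m' with hlt | rfl | hlt
  · have := h3 m hlt; rw [hm] at this; simp at this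
  · rw [hm] at h2; simp at h2
  · have := hm' m' hlt; rw [h2] at this; simp at this

lemma accept_or_running_of_outputs_true (A : QueryAlg I Ω) (t : ℕ) {ω : Ω} {z : I → ℝ}
    (h : A.Outputs ω z true) : A.accept t ω z = 1 ∨ A.Running t ω z := by
  obtain ⟨m, hm, hm'⟩ := h
  by_cases hmt : m ≤ t
  · exact Or.inl ((A.accept_eq_one_iff t ω z).2 ⟨m, hmt, hm, hm'⟩)
  · exact Or.inr fun j hj => hm' j (by omega)

/-- `Running` excludes halting at the times 0,…,t, so one query more than `t` is made; hence the t +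
1 in Markov's bound. -/
lemma le_numQueries_of_running (A : QueryAlg I Ω) {t : ℕ} {ω : Ω} {z : I → ℝ}
    (h : A.Running t ω z) : ((t + 1 : ℕ) : ℝ≥0∞) ≤ A.numQueries ω z := by
  unfold numQueries
  refine le_iInf₂ fun m hm => ?_
  by_contra hlt
  push Not at hlt
  have : m < t + 1 := by exact_mod_cast hlt
  exact hm (h m (by omega))

variable [Fintype I]

lemma measurable_answers (A : QueryAlg I Ω) {α : Type*} [MeasurableSpace α] {ω : α → Ω}
    {z : α → I → ℝ} (hω : Measurable ω) (hz : Measurable z) (m : ℕ) :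
    Measurable fun u => A.answers (ω u) (z u) m := by
  induction m with
  | zero => exact measurable_const
  | succ m ih => exact measurable_snoc ih (A.measurable_query hω ih hz)

lemma measurable_accept (A : QueryAlg I Ω) {α : Type*} [MeasurableSpace α] {ω : α → Ω}
    {z : α → I → ℝ} (hω : Measurable ω) (hz : Measurable z) (t : ℕ) :
    Measurable fun u => A.accept t (ω u) (z u) :=
  A.measurable_run t hω measurable_const hz

lemma measurableSet_running (A : QueryAlg I Ω) {α : Type*} [MeasurableSpace α] {ω : α → Ω}
    {z : α → I → ℝ} (hω : Measurable ω) (hz : Measurable z) (t : ℕ) :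
    MeasurableSet {u | A.Running t (ω u) (z u)} := by
  simp only [Running, Set.ofPred_forall]
  refine MeasurableSet.iInter fun j => MeasurableSet.iInter fun _ => ?_
  have hp := hω.prodMk (A.measurable_answers hω hz j)
  have : {u | A.halt j (ω u) (A.answers (ω u) (z u) j) = none} =
      ({u | A.halt j (ω u) (A.answers (ω u) (z u) j) = some true} ∪
        {u | A.halt j (ω u) (A.answers (ω u) (z u) j) = some false})ᶜ := by
    ext u
    simp only [Set.mem_ofPred_eq, Set.mem_compl_iff, Set.mem_union]
    cases A.halt j (ω u) (A.answers (ω u) (z u) j) with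
    | none => simp
    | some b => cases b <;> simp
  rw [this]
  exact ((hp (A.measurableSet_halt j true)).union (hp (A.measurableSet_halt j false))).compl

lemma measureReal_running_le (A : QueryAlg I Ω) {α : Type*} [MeasurableSpace α] (μ : Measure α)
    [IsProbabilityMeasure μ] {ω : α → Ω} {z : α → I → ℝ} (hω : Measurable ω) (hz : Measurable z)
    (t : ℕ) {T : ℝ≥0} (hT : ∫⁻ u, A.numQueries (ω u) (z u) ∂μ ≤ T) :
    μ.real {u | A.Running t (ω u) (z u)} ≤ T / (t + 1) := by
  have hm := A.measurableSet_running hω hz t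
  have h1 : ((t + 1 : ℕ) : ℝ≥0∞) * μ {u | A.Running t (ω u) (z u)} ≤ T := by
    refine le_trans (le_trans (le_of_eq ?_) (lintegral_mono
      (f := Set.indicator {u | A.Running t (ω u) (z u)} fun _ => ((t + 1 : ℕ) : ℝ≥0∞)) fun u => ?_)) hT
    · rw [lintegral_indicator_const hm]
    · by_cases h : A.Running t (ω u) (z u)
      · rw [Set.indicator_of_mem (show u ∈ {u | A.Running t (ω u) (z u)} from h)]
        exact A.le_numQueries_of_running h
      · rw [Set.indicator_of_notMem (show u ∉ {u | A.Running t (ω u) (z u)} from h)]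
        exact zero_le
  have h2 := ENNReal.toReal_mono (by simp) h1
  rw [ENNReal.toReal_mul] at h2
  simp only [ENNReal.toReal_natCast, ENNReal.coe_toReal] at h2
  rw [le_div_iff₀ (by positivity), mul_comm]
  push_cast at h2
  exact h2

/-- A run that is cut off counts as output `false`, so truncation costs nothing on this side and no
query bound is needed. -/
lemma measureReal_outputs_false_le (A : QueryAlg I Ω) {α : Type*} [MeasurableSpace α]
    (μ : Measure α) [IsProbabilityMeasure μ] {ω : α → Ω} {z : α → I → ℝ} (hω : Measurable ω)
    (hz : Measurable z) (t : ℕ) :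
    μ.real {u | A.Outputs (ω u) (z u) false} ≤ 1 - ∫ u, A.accept t (ω u) (z u) ∂μ := by
  have hm := A.measurable_accept hω hz t
  have hs : MeasurableSet {u | A.accept t (ω u) (z u) = 0} := hm (measurableSet_singleton 0)
  have h1 : ∫ u, A.accept t (ω u) (z u) ∂μ = 1 - μ.real {u | A.accept t (ω u) (z u) = 0} := by
    have : ∀ u, A.accept t (ω u) (z u) =
        1 - Set.indicator {u | A.accept t (ω u) (z u) = 0} (fun _ => (1 : ℝ)) u := by
      intro u
      rcases A.run_eq_zero_or_one t 0 (ω u) Fin.elim0 (z u) with h | h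
      · rw [Set.indicator_of_mem (show u ∈ {u | A.accept t (ω u) (z u) = 0} from h)]
        simpa [accept] using h
      · rw [Set.indicator_of_notMem (show u ∉ {u | A.accept t (ω u) (z u) = 0} from fun h' =>
          one_ne_zero (h.symm.trans h'))]
        simpa [accept] using h
    rw [integral_congr_ae (ae_of_all _ this), integral_sub (integrable_const _)
      ((integrable_const _).indicator hs), integral_indicator hs, setIntegral_const]
    simp
  rw [h1, sub_sub_cancel]
  exact measureReal_mono fun u hu => A.accept_ne_one_of_outputs_false t hu

/-- Truncation loses only the runs that are still going, which Markov's inequality bounds. -/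
lemma measureReal_outputs_true_le (A : QueryAlg I Ω) {α : Type*} [MeasurableSpace α]
    (μ : Measure α) [IsProbabilityMeasure μ] {ω : α → Ω} {z : α → I → ℝ} (hω : Measurable ω)
    (hz : Measurable z) (t : ℕ) {T : ℝ≥0} (hT : ∫⁻ u, A.numQueries (ω u) (z u) ∂μ ≤ T) :
    μ.real {u | A.Outputs (ω u) (z u) true}
      ≤ ∫ u, A.accept t (ω u) (z u) ∂μ + T / (t + 1) := by
  have hm := A.measurable_accept hω hz t
  have hs : MeasurableSet {u | A.accept t (ω u) (z u) = 1} := hm (measurableSet_singleton 1)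
  have h1 : μ.real {u | A.accept t (ω u) (z u) = 1} ≤ ∫ u, A.accept t (ω u) (z u) ∂μ := by
    have h2 : ∫ u, Set.indicator {u | A.accept t (ω u) (z u) = 1} (fun _ => (1 : ℝ)) u ∂μ
        = μ.real {u | A.accept t (ω u) (z u) = 1} := by
      rw [integral_indicator hs, setIntegral_const, smul_eq_mul, mul_one]
    rw [← h2]
    refine integral_mono ((integrable_const _).indicator hs) (Integrable.of_mem_Icc 0 1
      hm.aemeasurable (ae_of_all _ fun u => A.accept_mem_Icc _ _ _)) fun u => ?_
    by_cases h : A.accept t (ω u) (z u) = 1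
    · rw [Set.indicator_of_mem (show u ∈ {u | A.accept t (ω u) (z u) = 1} from h), h]
    · rw [Set.indicator_of_notMem (show u ∉ {u | A.accept t (ω u) (z u) = 1} from h)]
      exact (A.accept_mem_Icc _ _ _).1
  have h3 : {u | A.Outputs (ω u) (z u) true} ⊆ {u | A.accept t (ω u) (z u) = 1} ∪
      {u | A.Running t (ω u) (z u)} := fun u hu => A.accept_or_running_of_outputs_true t hu
  have h4 := (measureReal_mono (μ := μ) h3).trans (measureReal_union_le _ _)
  have h5 := A.measureReal_running_le μ hω hz t hT
  linarith

end QueryAlg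

/-- The advantage of an algorithm for Real Forrelation is at most the distinguishing advantage of
its truncation plus the probability of a long run. -/
lemma SolvesReal.two_mul_le {k n : ℕ} {Ω : Type*} [MeasurableSpace Ω] {P : Measure Ω}
    [IsProbabilityMeasure P] {A : QueryAlg (Fin k × Cube n) Ω} {ε : ℝ} (hk : 2 ≤ k)
    (h : SolvesReal A P ε) {T : ℝ≥0} (hT : RealCost A P T) (t : ℕ) {D : ℝ}
    (hD : ∀ p : Tuple k n → ℝ, TreeFun t p →
      ∫ z, p z ∂forrelatedLaw k n - ∫ z, p z ∂uniformLaw k n ≤ D) :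
    2 * ε ≤ D + T / (t + 1) := by
  have : Nonempty (Fin k) := ⟨⟨0, by omega⟩⟩
  have h1 := A.measureReal_outputs_false_le (P.prod (uniformLaw k n)) measurable_fst
    measurable_snd t
  have h2 := A.measureReal_outputs_true_le (P.prod (forrelatedLaw k n)) measurable_fst
    measurable_snd t hT.2
  have hint : ∀ (μ : Measure (Tuple k n)) [IsProbabilityMeasure μ],
      Integrable (fun q : Ω × Tuple k n => A.accept t q.1 q.2) (P.prod μ) := fun μ _ =>
    Integrable.of_mem_Icc 0 1 (A.measurable_accept measurable_fst measurable_snd t).aemeasurable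
      (ae_of_all _ fun _ => A.accept_mem_Icc _ _ _)
  -- For each fixed seed the truncated run is a tree; the bound D is averaged over seeds.
  have h3 : ∫ q, A.accept t q.1 q.2 ∂P.prod (forrelatedLaw k n) -
      ∫ q, A.accept t q.1 q.2 ∂P.prod (uniformLaw k n) ≤ D := by
    rw [integral_prod _ (hint _), integral_prod _ (hint _),
      ← integral_sub (hint _).integral_prod_left (hint _).integral_prod_left]
    refine (integral_mono ((hint _).integral_prod_left.sub (hint _).integral_prod_left)
      (integrable_const D) fun ω => hD _ (A.treeFun_run ω t 0 Fin.elim0)).trans (by simp)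
  unfold SolvesReal at h
  linarith


/-! ### The Gaussian Poincaré inequality -/

section Poincare

variable {E : Type*} [NormedAddCommGroup E] [InnerProductSpace ℝ E] [FiniteDimensional ℝ E]
  [MeasurableSpace E] [BorelSpace E]

lemma integral_inner_sq_stdGaussian (d : E) : ∫ b, inner ℝ d b ^ 2 ∂stdGaussian E = ‖d‖ ^ 2 := by
  have h1 : ∫ x, innerSL ℝ d x ∂stdGaussian E = 0 := integral_strongDual_stdGaussian (innerSL ℝ d)
  have h2 := variance_dual_stdGaussian (innerSL ℝ d)
  rw [variance_of_integral_eq_zero (by fun_prop) h1, innerSL_apply_norm] at h2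
  exact h2

/-- Cauchy–Schwarz, read off from the nonnegativity of ∫ (f - m)² with m the mean of f. -/
lemma sq_intervalIntegral_le {f : ℝ → ℝ} (hf : Continuous f) {L : ℝ} (hL : 0 ≤ L) :
    (∫ s in (0 : ℝ)..L, f s) ^ 2 ≤ L * ∫ s in (0 : ℝ)..L, f s ^ 2 := by
  rcases hL.eq_or_lt with rfl | hL
  · simp
  set m := (∫ s in (0 : ℝ)..L, f s) / L with hm
  have h1 : 0 ≤ ∫ s in (0 : ℝ)..L, (f s - m) ^ 2 :=
    intervalIntegral.integral_nonneg hL.le fun s _ => sq_nonneg _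
  have h2 : ∫ s in (0 : ℝ)..L, (f s - m) ^ 2
      = (∫ s in (0 : ℝ)..L, f s ^ 2) - 2 * m * (∫ s in (0 : ℝ)..L, f s) + m ^ 2 * L := by
    have e : ∀ s, (f s - m) ^ 2 = f s ^ 2 - 2 * m * f s + m ^ 2 := fun s => by ring
    simp_rw [e]
    rw [intervalIntegral.integral_add, intervalIntegral.integral_sub,
      intervalIntegral.integral_const_mul]
    · simp; ring
    all_goals exact Continuous.intervalIntegrable (by fun_prop) _ _
  have h3 : (∫ s in (0 : ℝ)..L, f s) = m * L := by rw [hm]; field_simp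
  rw [h2, h3] at h1
  rw [h3]
  nlinarith

/-- The Gaussian Poincaré inequality, up to the value of the constant. -/
theorem variance_stdGaussian_le {F : E → ℝ} {D : E → E} (hF : ∀ a, HasFDerivAt F (innerSL ℝ (D a)) a)
    (hD : Continuous D) {L C : ℝ} (hL : ∀ a, ‖D a‖ ^ 2 ≤ L) (hC : ∀ a, |F a| ≤ C) :
    Var[F; stdGaussian E] ≤ 2 * L := by
  set μ := stdGaussian E
  have hFc : Continuous F := continuous_iff_continuousAt.2 fun a => (hF a).continuousAt
  have hFL : MemLp F 2 μ := MemLp.of_bound hFc.aestronglyMeasurable C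
    (ae_of_all _ fun a => by rw [Real.norm_eq_abs]; exact hC a)
  have hFi : Integrable F μ := hFL.integrable (by norm_num)
  have hFi2 : Integrable (fun a => F a ^ 2) μ := hFL.integrable_sq
  -- Two independent copies are joined by the path cos θ · q.1 + sin θ · q.2. The squared derivative
  -- of `F` along it is `h` at the rotated pair, and the law of the pair is invariant under
  -- rotation, so the mean of `H θ` does not depend on θ.
  set h : E × E → ℝ := fun q => inner ℝ (D q.1) q.2 ^ 2 with hh
  set H : ℝ → E × E → ℝ := fun θ q => h (ContinuousLinearMap.rotation θ q) with hH
  have hHe : ∀ θ q, H θ q = inner ℝ (D (Real.cos θ • q.1 + Real.sin θ • q.2))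
      (-Real.sin θ • q.1 + Real.cos θ • q.2) ^ 2 := fun θ q => rfl
  have hL0 : 0 ≤ L := (sq_nonneg _).trans (hL 0)
  have hhc : Continuous h := by
    have : Continuous fun q : E × E => D q.1 := hD.comp continuous_fst
    fun_prop
  have hHc : Continuous fun y : ℝ × (E × E) => H y.1 y.2 := by
    simp only [hHe]
    have h1 : Continuous fun y : ℝ × (E × E) => D (Real.cos y.1 • y.2.1 + Real.sin y.1 • y.2.2) :=
      hD.comp (by fun_prop)
    fun_prop
  -- fundamental theorem of calculus along the rotation path
  have hpt : ∀ q : E × E, (F q.2 - F q.1) ^ 2 ≤ Real.pi / 2 * ∫ θ in (0 : ℝ)..(Real.pi / 2), H θ q := by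
    intro q
    set f : ℝ → ℝ := fun θ => inner ℝ (D (Real.cos θ • q.1 + Real.sin θ • q.2))
      (-Real.sin θ • q.1 + Real.cos θ • q.2) with hf
    have hfc : Continuous f := by
      have h1 : Continuous fun θ : ℝ => D (Real.cos θ • q.1 + Real.sin θ • q.2) :=
        hD.comp (by fun_prop)
      simp only [hf]
      fun_prop
    have hder : ∀ θ, HasDerivAt (fun θ : ℝ => F (Real.cos θ • q.1 + Real.sin θ • q.2)) (f θ) θ := by
      intro θ
      have hγ : HasDerivAt (fun θ : ℝ => Real.cos θ • q.1 + Real.sin θ • q.2)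
          (-Real.sin θ • q.1 + Real.cos θ • q.2) θ :=
        ((Real.hasDerivAt_cos θ).smul_const _).add ((Real.hasDerivAt_sin θ).smul_const _)
      exact (hF _).comp_hasDerivAt θ hγ
    have hftc := intervalIntegral.integral_eq_sub_of_hasDerivAt
      (a := 0) (b := Real.pi / 2) (fun θ _ => hder θ) (hfc.intervalIntegrable _ _)
    simp only [Real.cos_pi_div_two, Real.sin_pi_div_two, Real.cos_zero, Real.sin_zero, zero_smul,
      one_smul, zero_add, add_zero] at hftc
    rw [← hftc]
    exact sq_intervalIntegral_le hfc (by positivity)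
  have hn2 : Integrable (fun a : E => ‖a‖ ^ 2) μ := by
    have := (IsGaussian.memLp_two_id (μ := μ)).norm.integrable_sq
    simpa using this
  set V := volume.restrict (Set.Ioc (0 : ℝ) (Real.pi / 2))
  have hdom : Integrable (fun y : ℝ × (E × E) => H y.1 y.2) (V.prod (μ.prod μ)) := by
    have hg : Integrable (fun q : E × E => L * (2 * ‖q.1‖ ^ 2 + 2 * ‖q.2‖ ^ 2)) (μ.prod μ) :=
      (((hn2.comp_fst μ).const_mul 2).add ((hn2.comp_snd μ).const_mul 2)).const_mul L
    refine (hg.comp_snd V).mono' hHc.aestronglyMeasurable (ae_of_all _ fun y => ?_)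
    rw [hHe, Real.norm_eq_abs, abs_of_nonneg (sq_nonneg _)]
    have hcs := abs_real_inner_le_norm (D (Real.cos y.1 • y.2.1 + Real.sin y.1 • y.2.2))
      (-Real.sin y.1 • y.2.1 + Real.cos y.1 • y.2.2)
    have hno : ‖-Real.sin y.1 • y.2.1 + Real.cos y.1 • y.2.2‖ ≤ ‖y.2.1‖ + ‖y.2.2‖ := by
      refine (norm_add_le _ _).trans (add_le_add ?_ ?_)
      · rw [norm_smul, norm_neg, Real.norm_eq_abs]
        exact mul_le_of_le_one_left (norm_nonneg _) (Real.abs_sin_le_one _)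
      · rw [norm_smul, Real.norm_eq_abs]
        exact mul_le_of_le_one_left (norm_nonneg _) (Real.abs_cos_le_one _)
    rw [← sq_abs]
    calc _ ≤ (‖D (Real.cos y.1 • y.2.1 + Real.sin y.1 • y.2.2)‖ *
          ‖-Real.sin y.1 • y.2.1 + Real.cos y.1 • y.2.2‖) ^ 2 := by gcongr
      _ ≤ L * (‖y.2.1‖ + ‖y.2.2‖) ^ 2 := by
          rw [mul_pow]
          gcongr
          exact hL _
      _ ≤ _ := by
          gcongr
          nlinarith [sq_nonneg (‖y.2.1‖ - ‖y.2.2‖)]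
  have hrot : ∀ θ, ∫ q, H θ q ∂μ.prod μ ≤ L := by
    intro θ
    have hr := IsGaussian.map_rotation_eq_self (μ := μ) integral_id_stdGaussian θ
    have : ∫ q, H θ q ∂μ.prod μ = ∫ q, h q ∂μ.prod μ := by
      conv_rhs => rw [← hr]
      rw [integral_map (by fun_prop) hhc.aestronglyMeasurable]
    rw [this]
    have hhi : Integrable h (μ.prod μ) := by
      refine Integrable.mono' ((hn2.comp_snd μ).const_mul L) hhc.aestronglyMeasurable
        (ae_of_all _ fun q => ?_)
      rw [Real.norm_eq_abs, abs_of_nonneg (sq_nonneg _)]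
      calc inner ℝ (D q.1) q.2 ^ 2 ≤ (‖D q.1‖ * ‖q.2‖) ^ 2 :=
            sq_le_sq' (neg_le_of_abs_le (abs_real_inner_le_norm _ _)) (real_inner_le_norm _ _)
        _ ≤ L * ‖q.2‖ ^ 2 := by
            rw [mul_pow]
            exact mul_le_mul_of_nonneg_right (hL _) (sq_nonneg _)
    -- Given the first component, the inner product with the second is Gaussian of variance ‖D a‖².
    rw [integral_prod _ hhi]
    have h2 : ∀ a : E, ∫ b, h (a, b) ∂μ = ‖D a‖ ^ 2 := fun a =>
      integral_inner_sq_stdGaussian (D a)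
    simp_rw [h2]
    refine (integral_mono_of_nonneg (ae_of_all _ fun a => sq_nonneg _) (integrable_const L)
      (ae_of_all _ hL)).trans (by simp)
  have hpair : ∫ q, (F q.2 - F q.1) ^ 2 ∂μ.prod μ = 2 * Var[F; μ] := by
    have e : ∀ q : E × E, (F q.2 - F q.1) ^ 2 = (F q.2 ^ 2 + F q.1 ^ 2) - 2 * (F q.1 * F q.2) :=
      fun q => by ring
    simp_rw [e]
    have i1 : Integrable (fun q : E × E => F q.2 ^ 2) (μ.prod μ) := hFi2.comp_snd μ
    have i2 : Integrable (fun q : E × E => F q.1 ^ 2) (μ.prod μ) := hFi2.comp_fst μ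
    have i3 : Integrable (fun q : E × E => F q.1 * F q.2) (μ.prod μ) := hFi.mul_prod hFi
    have i4 : Integrable (fun q : E × E => F q.2 ^ 2 + F q.1 ^ 2) (μ.prod μ) := i1.add i2
    rw [integral_sub i4 (i3.const_mul 2), integral_add i1 i2, integral_const_mul,
      integral_prod_mul, variance_eq_sub hFL,
      integral_fun_snd (fun a => F a ^ 2), integral_fun_fst (fun a => F a ^ 2)]
    simp only [probReal_univ, one_smul, Pi.pow_apply]
    ring
  have hswap : ∫ q, (∫ θ in (0 : ℝ)..(Real.pi / 2), H θ q) ∂μ.prod μ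
      = ∫ θ in (0 : ℝ)..(Real.pi / 2), ∫ q, H θ q ∂μ.prod μ := by
    simp_rw [intervalIntegral.integral_of_le (show (0 : ℝ) ≤ Real.pi / 2 by positivity)]
    exact (integral_integral_swap hdom).symm
  have hle1 : ∫ q, (F q.2 - F q.1) ^ 2 ∂μ.prod μ ≤
      Real.pi / 2 * ∫ q, (∫ θ in (0 : ℝ)..(Real.pi / 2), H θ q) ∂μ.prod μ := by
    rw [← integral_const_mul]
    refine integral_mono_of_nonneg (ae_of_all _ fun q => sq_nonneg _) ?_ (ae_of_all _ hpt)
    simp_rw [intervalIntegral.integral_of_le (show (0 : ℝ) ≤ Real.pi / 2 by positivity)]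
    exact hdom.integral_prod_right.const_mul _
  have hle2 : ∫ θ in (0 : ℝ)..(Real.pi / 2), ∫ q, H θ q ∂μ.prod μ ≤ Real.pi / 2 * L := by
    rw [intervalIntegral.integral_of_le (show (0 : ℝ) ≤ Real.pi / 2 by positivity)]
    refine (integral_mono hdom.integral_prod_left (integrable_const L) hrot).trans ?_
    rw [setIntegral_const, Real.volume_real_Ioc_of_le (by positivity), sub_zero, smul_eq_mul]
  rw [hpair, hswap] at hle1
  have hpi := Real.pi_lt_d2
  have hpi0 := Real.pi_pos
  have h1 : Real.pi / 2 * ∫ θ in (0 : ℝ)..(Real.pi / 2), ∫ q, H θ q ∂μ.prod μ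
      ≤ Real.pi / 2 * (Real.pi / 2 * L) := by gcongr
  -- Rotation yields Var ≤ (π²/8) L, rounded up here to 2L.
  have h2 : Real.pi / 2 * (Real.pi / 2 * L) ≤ 4 * L := by
    rw [← mul_assoc]; gcongr; nlinarith
  linarith

end Poincare


/-! ### A smooth approximation of the sign function -/

/-- A smooth approximation of the sign function. -/
noncomputable def squash (x : ℝ) : ℝ := 2 / Real.pi * Real.arctan (50 * x)

/-- The derivative of `squash`. -/
noncomputable def squashDeriv (x : ℝ) : ℝ := 2 / Real.pi * (50 / (1 + (50 * x) ^ 2))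

lemma two_div_pi_le_one : 2 / Real.pi ≤ 1 := by
  rw [div_le_one Real.pi_pos]; linarith [Real.pi_gt_three]

lemma two_div_pi_pos : 0 < 2 / Real.pi := div_pos two_pos Real.pi_pos

lemma hasDerivAt_squash (x : ℝ) : HasDerivAt squash (squashDeriv x) x := by
  have h := (((hasDerivAt_id x).const_mul 50).arctan).const_mul (2 / Real.pi)
  refine HasDerivAt.congr_deriv (f := squash) h ?_
  simp only [squashDeriv, id, mul_one]
  ring

lemma continuous_squash : Continuous squash :=
  continuous_iff_continuousAt.2 fun x => (hasDerivAt_squash x).continuousAt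

lemma continuous_squashDeriv : Continuous squashDeriv := by
  unfold squashDeriv
  have : ∀ x : ℝ, 1 + (50 * x) ^ 2 ≠ 0 := fun x => by positivity
  fun_prop (disch := assumption)

@[fun_prop] lemma measurable_squash : Measurable squash := continuous_squash.measurable

@[fun_prop] lemma measurable_squashDeriv : Measurable squashDeriv := continuous_squashDeriv.measurable

lemma abs_squash_le (x : ℝ) : |squash x| ≤ 1 := by
  have h1 := (Real.arctan_lt_pi_div_two (50 * x)).le
  have h2 := (Real.neg_pi_div_two_lt_arctan (50 * x)).le
  have h : |Real.arctan (50 * x)| ≤ Real.pi / 2 := abs_le.2 ⟨by linarith, h1⟩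
  rw [squash, abs_mul, abs_of_pos two_div_pi_pos]
  calc _ ≤ 2 / Real.pi * (Real.pi / 2) := by gcongr
    _ = 1 := by field_simp

lemma squash_neg (x : ℝ) : squash (-x) = -squash x := by
  simp [squash]

lemma squashDeriv_nonneg (x : ℝ) : 0 ≤ squashDeriv x := by
  unfold squashDeriv; positivity

lemma squashDeriv_le (x : ℝ) : squashDeriv x ≤ 50 := by
  unfold squashDeriv
  have : 50 / (1 + (50 * x) ^ 2) ≤ 50 := div_le_self (by norm_num) (by nlinarith [sq_nonneg (50 * x)])
  nlinarith [two_div_pi_le_one, two_div_pi_pos, show 0 ≤ 50 / (1 + (50 * x) ^ 2) by positivity]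

lemma abs_squashDeriv_sub_le (x y : ℝ) : |squashDeriv x - squashDeriv y| ≤ 2500 * |x - y| := by
  set s := 50 * x
  set t := 50 * y
  have key : |1 / (1 + s ^ 2) - 1 / (1 + t ^ 2)| ≤ |s - t| := by
    have e : 1 / (1 + s ^ 2) - 1 / (1 + t ^ 2) = (s - t) * (-(s + t) / ((1 + s ^ 2) * (1 + t ^ 2))) := by
      field_simp; ring
    rw [e, abs_mul]
    refine mul_le_of_le_one_right (abs_nonneg _) ?_
    rw [abs_div, abs_neg, abs_of_pos (by positivity : 0 < (1 + s ^ 2) * (1 + t ^ 2)),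
      div_le_one (by positivity), abs_le]
    constructor <;> nlinarith [sq_nonneg (s * t), sq_nonneg (s - 1), sq_nonneg (t - 1),
      sq_nonneg (s + 1), sq_nonneg (t + 1), sq_nonneg s, sq_nonneg t]
  have e : squashDeriv x - squashDeriv y
      = 2 / Real.pi * (50 * (1 / (1 + s ^ 2) - 1 / (1 + t ^ 2))) := by
    simp only [squashDeriv, s, t]; ring
  have e2 : |s - t| = 50 * |x - y| := by
    rw [show s - t = 50 * (x - y) by simp only [s, t]; ring, abs_mul]; norm_num
  rw [e, abs_mul, abs_mul, abs_of_pos two_div_pi_pos, abs_of_pos (by norm_num : (0 : ℝ) < 50)]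
  rw [e2] at key
  have h0 := abs_nonneg (1 / (1 + s ^ 2) - 1 / (1 + t ^ 2))
  nlinarith [two_div_pi_le_one, two_div_pi_pos]

/-- First-order Taylor expansion, from the Lipschitz bound 2500 on the derivative. -/
lemma abs_squash_add_sub_le (x h : ℝ) :
    |squash (x + h) - squash x - squashDeriv x * h| ≤ 2500 * h ^ 2 := by
  have hd : ∀ s ∈ Metric.closedBall x |h|, HasDerivWithinAt (fun s => squash s - squashDeriv x * s)
      (squashDeriv s - squashDeriv x) (Metric.closedBall x |h|) s := fun s _ => by
    have := (hasDerivAt_squash s).sub ((hasDerivAt_id s).const_mul (squashDeriv x))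
    rw [mul_one] at this
    exact this.hasDerivWithinAt
  have hb : ∀ s ∈ Metric.closedBall x |h|, ‖squashDeriv s - squashDeriv x‖ ≤ 2500 * |h| := by
    intro s hs
    rw [Metric.mem_closedBall, Real.dist_eq] at hs
    exact (abs_squashDeriv_sub_le s x).trans (by gcongr)
  have := (convex_closedBall x |h|).norm_image_sub_le_of_norm_hasDerivWithin_le hd hb
    (Metric.mem_closedBall_self (abs_nonneg h))
    (show x + h ∈ Metric.closedBall x |h| by simp)
  rw [Real.norm_eq_abs, Real.norm_eq_abs, add_sub_cancel_left, mul_assoc, abs_mul_abs_self] at this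
  calc _ = |squash (x + h) - squashDeriv x * (x + h) - (squash x - squashDeriv x * x)| := by
        congr 1; ring
    _ ≤ 2500 * h ^ 2 := by rw [sq]; exact this

lemma integrable_squash_comp {α : Type*} [MeasurableSpace α] {μ : Measure α} [IsFiniteMeasure μ]
    {f : α → ℝ} (hf : Measurable f) : Integrable (fun x => squash (f x)) μ :=
  Integrable.of_bound (measurable_squash.comp hf).aestronglyMeasurable 1
    (ae_of_all _ fun x => by rw [Real.norm_eq_abs]; exact abs_squash_le _)

lemma integrable_squashDeriv_comp {α : Type*} [MeasurableSpace α] {μ : Measure α}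
    [IsFiniteMeasure μ] {f : α → ℝ} (hf : Measurable f) :
    Integrable (fun x => squashDeriv (f x)) μ :=
  Integrable.of_bound (measurable_squashDeriv.comp hf).aestronglyMeasurable 50
    (ae_of_all _ fun x => by
      rw [Real.norm_eq_abs, abs_of_nonneg (squashDeriv_nonneg _)]; exact squashDeriv_le _)

lemma integrable_mul_squash : Integrable (fun x => x * squash x) (gaussianReal 0 1) := by
  refine integrable_id_gaussianReal.norm.mono' (by fun_prop) (ae_of_all _ fun x => ?_)
  rw [norm_mul, Real.norm_eq_abs (squash x)]
  exact mul_le_of_le_one_right (norm_nonneg _) (abs_squash_le x)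

lemma integral_squash : ∫ x, squash x ∂gaussianReal 0 1 = 0 := by
  have h : ∫ x, squash x ∂gaussianReal 0 1 = ∫ x, squash (-x) ∂gaussianReal 0 1 := by
    have hm : (gaussianReal 0 1).map (fun x : ℝ => -x) = gaussianReal 0 1 := by
      rw [gaussianReal_map_neg]; simp
    conv_lhs => rw [← hm]
    rw [integral_map (by fun_prop) (by fun_prop)]
  simp_rw [squash_neg] at h
  rw [integral_neg] at h
  linarith

/-- The correlation of `squash` with the identity. -/
noncomputable def squashCorr : ℝ := ∫ x, x * squash x ∂gaussianReal 0 1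

/-- Gaussian integration by parts (Stein's identity), since the density g satisfies g' = -x g. -/
lemma integral_squashDeriv : ∫ x, squashDeriv x ∂gaussianReal 0 1 = squashCorr := by
  set g : ℝ → ℝ := gaussianPDFReal 0 1 with hg
  have hgd : ∀ x, HasDerivAt g (-(x * g x)) x := by
    intro x
    have h1 : HasDerivAt (fun x : ℝ => -(x - 0) ^ 2 / (2 * ((1 : ℝ≥0) : ℝ))) (-x) x := by
      have := ((hasDerivAt_id x).pow 2).neg.div_const 2
      simp only [NNReal.coe_one, sub_zero, mul_one]
      exact this.congr_deriv (by simp only [id]; ring)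
    have h2 := (h1.exp).const_mul ((Real.sqrt (2 * Real.pi * ((1 : ℝ≥0) : ℝ)))⁻¹)
    refine HasDerivAt.congr_deriv (f := g) h2 ?_
    simp only [hg, gaussianPDFReal]
    ring
  have hgi : Integrable g := integrable_gaussianPDFReal 0 1
  have hgx : ∀ f : ℝ → ℝ, Integrable f (gaussianReal 0 1) → Integrable (fun x => g x * f x) := by
    intro f hf
    rw [gaussianReal_of_var_ne_zero _ one_ne_zero,
      integrable_withDensity_iff_integrable_smul' (by fun_prop) (by simp [gaussianPDF])] at hf
    refine hf.congr (ae_of_all _ fun x => ?_)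
    simp only [toReal_gaussianPDF, smul_eq_mul, hg]
  have h := integral_mul_deriv_eq_deriv_mul_of_integrable
    (u := squash) (u' := squashDeriv) (v := g) (v' := fun x => -(x * g x))
    (fun x _ => hasDerivAt_squash x) (fun x _ => hgd x)
    ((hgx _ integrable_mul_squash).neg.congr (ae_of_all _ fun x => by
      simp only [Pi.neg_apply, Pi.mul_apply]; ring))
    ((hgx _ (integrable_squashDeriv_comp measurable_id)).congr (ae_of_all _ fun x => by
      simp only [Pi.mul_apply, id]; ring))
    ((hgx _ (integrable_squash_comp measurable_id)).congr (ae_of_all _ fun x => by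
      simp only [Pi.mul_apply, id]; ring))
  rw [squashCorr, integral_gaussianReal_eq_integral_smul one_ne_zero,
    integral_gaussianReal_eq_integral_smul one_ne_zero]
  have e1 : ∀ x, gaussianPDFReal 0 1 x • squashDeriv x = squashDeriv x * g x := fun x => by
    rw [smul_eq_mul, mul_comm]
  have e2 : ∀ x, gaussianPDFReal 0 1 x • (x * squash x) = -(squash x * -(x * g x)) := fun x => by
    rw [smul_eq_mul]; ring
  simp_rw [e1, e2]
  rw [integral_neg, h, neg_neg]

lemma integral_abs_gaussianReal :
    ∫ x, |x| ∂gaussianReal 0 1 = 2 / Real.sqrt (2 * Real.pi) := by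
  rw [integral_gaussianReal_eq_integral_smul one_ne_zero]
  have e : ∀ x : ℝ, gaussianPDFReal 0 1 x • |x| =
      (fun s : ℝ => (Real.sqrt (2 * Real.pi))⁻¹ * (s * Real.exp (-(1 / 2) * s ^ 2))) |x| := by
    intro x
    simp only [gaussianPDFReal, sq_abs, smul_eq_mul, NNReal.coe_one, mul_one, sub_zero]
    rw [show -x ^ 2 / 2 = -(1 / 2) * x ^ 2 by ring]
    ring
  simp_rw [e]
  rw [integral_comp_abs
    (f := fun s : ℝ => (Real.sqrt (2 * Real.pi))⁻¹ * (s * Real.exp (-(1 / 2) * s ^ 2))),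
    integral_const_mul]
  have h := integral_rpow_mul_exp_neg_mul_rpow (p := 2) (q := 1) (b := 1 / 2)
    (by norm_num) (by norm_num) (by norm_num)
  have h2 : ∫ x in Set.Ioi (0 : ℝ), x * Real.exp (-(1 / 2) * x ^ 2) = 1 := by
    have e3 : ∀ x : ℝ, x ^ (1 : ℝ) * Real.exp (-(1 / 2) * x ^ (2 : ℝ)) =
        x * Real.exp (-(1 / 2) * x ^ 2) := fun x => by
      rw [Real.rpow_one, Real.rpow_two]
    simp_rw [e3] at h
    rw [h]
    norm_num [Real.rpow_neg_one]
  rw [h2]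
  ring

lemma arctan_le_self {x : ℝ} (hx : 0 ≤ x) : Real.arctan x ≤ x := by
  have := Real.le_tan (Real.arctan_nonneg.2 hx) (Real.arctan_lt_pi_div_two x)
  rwa [Real.tan_arctan] at this

/-- For x > 0 the deficit π/2 - arctan(50x) equals arctan(1/(50x)), which is at most 1/(50x). -/
lemma abs_sub_le_mul_squash (x : ℝ) : |x| - 2 / Real.pi / 50 ≤ x * squash x := by
  wlog hx : 0 < x generalizing x
  · rcases (not_lt.1 hx).eq_or_lt with rfl | hx
    · simp; positivity
    · have := this (-x) (by linarith)
      rwa [abs_neg, squash_neg, neg_mul_neg] at this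
  have h := Real.arctan_inv_of_pos (show 0 < 50 * x by positivity)
  have h2 := arctan_le_self (show 0 ≤ (50 * x)⁻¹ by positivity)
  have h3 : Real.arctan (50 * x) ≥ Real.pi / 2 - (50 * x)⁻¹ := by linarith
  rw [abs_of_pos hx, squash]
  calc x - 2 / Real.pi / 50 = x * (2 / Real.pi * (Real.pi / 2 - (50 * x)⁻¹)) := by
        have := Real.pi_pos.ne'
        field_simp
    _ ≤ _ := by gcongr

/-- Compares with 𝔼|x| = √(2/π) ≈ 0.798. The slope factor 50 in `squash` makes the loss small enough
for the square to exceed 0.614, above the threshold 3/5; the sign function itself would give 2/π ≈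
0.637. -/
lemma squashCorr_ge : 0.784 ≤ squashCorr := by
  have h1 : ∫ x, (|x| - 2 / Real.pi / 50) ∂gaussianReal 0 1 ≤ squashCorr :=
    integral_mono (integrable_id_gaussianReal.norm.sub (integrable_const _)) integrable_mul_squash
      abs_sub_le_mul_squash
  have hi : Integrable (fun x : ℝ => |x|) (gaussianReal 0 1) := integrable_id_gaussianReal.norm
  rw [integral_sub hi (integrable_const _), integral_abs_gaussianReal] at h1
  simp only [integral_const, probReal_univ, one_smul] at h1
  have h2 : Real.sqrt (2 * Real.pi) ≤ 2.509 := by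
    rw [Real.sqrt_le_left (by norm_num)]
    linarith [Real.pi_lt_d4]
  have h3 : (0.797 : ℝ) ≤ 2 / Real.sqrt (2 * Real.pi) := by
    rw [le_div_iff₀ (Real.sqrt_pos.2 (by positivity))]
    linarith
  have h4 : 2 / Real.pi ≤ 0.64 := by
    rw [div_le_iff₀ Real.pi_pos]; linarith [Real.pi_gt_d2]
  linarith

lemma squashCorr_le : squashCorr ≤ 1 := by
  have h1 : squashCorr ≤ ∫ x, (x ^ 2 / 2 + 1 / 2) ∂gaussianReal 0 1 := by
    refine integral_mono integrable_mul_squash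
      ((integrable_sq_gaussianReal.div_const 2).add (integrable_const _)) fun x => ?_
    have := abs_le.1 (abs_squash_le x)
    show x * squash x ≤ x ^ 2 / 2 + 1 / 2
    nlinarith [sq_nonneg (x - squash x)]
  rw [integral_add (integrable_sq_gaussianReal.div_const 2) (integrable_const _), integral_div,
    integral_sq_gaussianReal] at h1
  simp at h1
  linarith


/-! ### The smoothed correlation -/

section GaussianPair

variable {J : Type*} [Fintype J]

lemma map_sum_mul_pi {v : J → ℝ} (hv : ∑ j, v j ^ 2 = 1) :
    (Measure.pi fun _ : J => gaussianReal 0 1).map (fun u => ∑ j, v j * u j) = gaussianReal 0 1 := by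
  have hn : ‖(WithLp.toLp 2 v : EuclideanSpace ℝ J)‖ = 1 := by
    rw [← sq_eq_sq₀ (norm_nonneg _) zero_le_one, EuclideanSpace.norm_sq_eq]
    simpa using hv
  have h := map_inner_stdGaussian hn
  rw [← map_pi_eq_stdGaussian, Measure.map_map (by fun_prop) (by fun_prop)] at h
  refine Eq.trans ?_ h
  congr 1
  ext u
  simp [PiLp.inner_apply, mul_comm]

lemma integral_abs_gaussianReal_le : ∫ x, |x| ∂gaussianReal 0 1 ≤ 1 := by
  have h1 : ∫ x, |x| ∂gaussianReal 0 1 ≤ ∫ x, (x ^ 2 / 2 + 1 / 2) ∂gaussianReal 0 1 := by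
    refine integral_mono integrable_id_gaussianReal.norm
      ((integrable_sq_gaussianReal.div_const 2).add (integrable_const _)) fun x => ?_
    show |x| ≤ x ^ 2 / 2 + 1 / 2
    nlinarith [sq_nonneg (|x| - 1), sq_abs x]
  rw [integral_add (integrable_sq_gaussianReal.div_const 2) (integrable_const _), integral_div,
    integral_sq_gaussianReal] at h1
  simp at h1
  linarith

/-- Expand in c: order zero vanishes because `squash` is odd, order one is the subtracted term, and
the remainder has mean at most 2500c² as 𝔼s² = 1. -/
lemma abs_integral_squash_affine_sub_le (r c : ℝ) :
    |∫ s, squash (r + c * s) * squash s ∂gaussianReal 0 1 - squashDeriv r * c * squashCorr|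
      ≤ 2500 * c ^ 2 := by
  have i1 : Integrable (fun s => squash (r + c * s) * squash s) (gaussianReal 0 1) :=
    (integrable_squash_comp (f := fun s => r + c * s) (by fun_prop)).mul_bdd (c := 1)
      (by fun_prop) (ae_of_all _ fun s => by rw [Real.norm_eq_abs]; exact abs_squash_le s)
  have i2 : Integrable (fun s => squash r * squash s) (gaussianReal 0 1) :=
    (integrable_squash_comp measurable_id).const_mul _
  have i3 : Integrable (fun s => squashDeriv r * c * (s * squash s)) (gaussianReal 0 1) :=
    integrable_mul_squash.const_mul _
  have i4 : Integrable (fun s => squash (r + c * s) * squash s - squash r * squash s)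
      (gaussianReal 0 1) := i1.sub i2
  have e : ∫ s, (squash (r + c * s) * squash s - squash r * squash s
      - squashDeriv r * c * (s * squash s)) ∂gaussianReal 0 1
      = ∫ s, squash (r + c * s) * squash s ∂gaussianReal 0 1 - squashDeriv r * c * squashCorr := by
    rw [integral_sub i4 i3, integral_sub i1 i2, integral_const_mul, integral_const_mul,
      integral_squash, squashCorr]
    ring
  rw [← e]
  have h := norm_integral_le_of_norm_le (integrable_sq_gaussianReal.const_mul (2500 * c ^ 2))
    (f := fun s => squash (r + c * s) * squash s - squash r * squash s
      - squashDeriv r * c * (s * squash s)) (ae_of_all _ fun s => by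
      rw [Real.norm_eq_abs, show squash (r + c * s) * squash s - squash r * squash s
        - squashDeriv r * c * (s * squash s) =
        (squash (r + c * s) - squash r - squashDeriv r * (c * s)) * squash s by ring, abs_mul]
      have h1 := abs_squash_add_sub_le r (c * s)
      have h2 := abs_squash_le s
      calc _ ≤ (2500 * (c * s) ^ 2) * 1 := by gcongr
        _ = _ := by ring)
  rwa [integral_const_mul, integral_sq_gaussianReal, mul_one, Real.norm_eq_abs] at h

/-- Split the sum as R + v x · u x with R independent of u x and expand around R. Then replace the
derivative at R by the derivative at the full sum, which is standard Gaussian, so Stein's identity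
evaluates the mean. Each of the two steps costs 2500(v x)². -/
lemma abs_integral_squash_sum_mul_squash_sub_le {v : J → ℝ} (hv : ∑ j, v j ^ 2 = 1) (x : J) :
    |∫ u, squash (∑ j, v j * u j) * squash (u x) ∂Measure.pi (fun _ : J => gaussianReal 0 1)
      - v x * squashCorr ^ 2| ≤ 5000 * v x ^ 2 := by
  classical
  set μ := Measure.pi fun _ : J => gaussianReal 0 1 with hμ
  set R : (J → ℝ) → ℝ := fun u => ∑ j ∈ Finset.univ.erase x, v j * u j with hR
  have hb : ∀ u, ∑ j, v j * u j = R u + v x * u x := fun u => by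
    rw [hR, ← Finset.sum_erase_add _ _ (Finset.mem_univ x)]
  have hRm : Measurable R := by simp only [hR]; fun_prop
  have hRu : ∀ u s, R (Function.update u x s) = R u := fun u s =>
    Finset.sum_congr rfl fun j hj => by rw [Function.update_of_ne (Finset.ne_of_mem_erase hj)]
  have hmp := measurePreserving_update (fun _ : J => gaussianReal 0 1) x
  have hev := measurePreserving_eval (fun _ : J => gaussianReal 0 1) x
  simp_rw [hb]
  have e1 : ∫ u, squash (R u + v x * u x) * squash (u x) ∂μ
      = ∫ u, ∫ s, squash (R u + v x * s) * squash s ∂gaussianReal 0 1 ∂μ := by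
    have hm : Measurable fun u : J → ℝ => squash (R u + v x * u x) * squash (u x) := by fun_prop
    conv_lhs => rw [hμ, ← hmp.map_eq]
    rw [integral_map hmp.measurable.aemeasurable hm.aestronglyMeasurable]
    simp only [hRu, Function.update_self]
    rw [integral_prod]
    refine Integrable.of_bound (C := 1) (Measurable.aestronglyMeasurable (by fun_prop))
      (ae_of_all _ fun p => ?_)
    rw [norm_mul]
    exact mul_le_one₀ (abs_squash_le _) (norm_nonneg _) (abs_squash_le _)
  have hψ : Integrable (fun u => squashDeriv (R u)) μ := integrable_squashDeriv_comp hRm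
  have hψb : Integrable (fun u => squashDeriv (R u + v x * u x)) μ :=
    integrable_squashDeriv_comp (by fun_prop)
  have hI : Integrable (fun u => ∫ s, squash (R u + v x * s) * squash s ∂gaussianReal 0 1) μ := by
    refine Integrable.of_bound (C := 1) ?_ (ae_of_all _ fun u => ?_)
    · exact (Measurable.stronglyMeasurable (f := fun p : (J → ℝ) × ℝ =>
        squash (R p.1 + v x * p.2) * squash p.2) (by fun_prop)).integral_prod_right'.aestronglyMeasurable
    · refine (norm_integral_le_of_norm_le_const (C := 1) (ae_of_all _ fun s => ?_)).trans (by simp)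
      rw [norm_mul]
      exact mul_le_one₀ (abs_squash_le _) (norm_nonneg _) (abs_squash_le _)
  have h1 : |∫ u, squash (R u + v x * u x) * squash (u x) ∂μ
      - (∫ u, squashDeriv (R u) ∂μ) * (v x * squashCorr)| ≤ 2500 * v x ^ 2 := by
    rw [e1, ← integral_mul_const, ← integral_sub hI (hψ.mul_const _), ← Real.norm_eq_abs]
    refine (norm_integral_le_of_norm_le_const (C := 2500 * v x ^ 2)
      (ae_of_all _ fun u => ?_)).trans (by simp)
    rw [← mul_assoc]
    exact abs_integral_squash_affine_sub_le _ _
  have h2 : |∫ u, squashDeriv (R u) ∂μ - squashCorr| ≤ 2500 * |v x| := by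
    -- R alone has variance below 1 unless v x = 0; adding the omitted term restores the standard
    -- Gaussian law.
    have e2 : squashCorr = ∫ u, squashDeriv (R u + v x * u x) ∂μ := by
      simp_rw [← hb]
      have hm : Measurable fun u : J → ℝ => ∑ j, v j * u j := by fun_prop
      rw [← integral_squashDeriv]
      conv_lhs => rw [← map_sum_mul_pi hv]
      rw [integral_map hm.aemeasurable (by fun_prop)]
    have hux : Integrable (fun u : J → ℝ => |u x|) μ :=
      hev.integrable_comp_of_integrable (g := fun s : ℝ => |s|) integrable_id_gaussianReal.norm
    have hux1 : ∫ u, |u x| ∂μ ≤ 1 := by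
      refine le_trans (le_of_eq ?_) integral_abs_gaussianReal_le
      conv_rhs => rw [← hev.map_eq]
      rw [integral_map (measurable_pi_apply x).aemeasurable (by fun_prop)]
    rw [e2, ← integral_sub hψ hψb, ← Real.norm_eq_abs]
    refine (norm_integral_le_of_norm_le (hux.const_mul (2500 * |v x|)) (ae_of_all _ fun u => ?_)).trans ?_
    · refine (abs_squashDeriv_sub_le _ _).trans (le_of_eq ?_)
      rw [show R u - (R u + v x * u x) = -(v x * u x) by ring, abs_neg, abs_mul, mul_assoc]
    · rw [integral_const_mul]
      exact mul_le_of_le_one_right (by positivity) hux1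
  have hκ0 : 0 ≤ squashCorr := le_trans (by norm_num) squashCorr_ge
  have h3 : |(∫ u, squashDeriv (R u) ∂μ) * (v x * squashCorr) - v x * squashCorr ^ 2|
      ≤ 2500 * v x ^ 2 := by
    rw [show (∫ u, squashDeriv (R u) ∂μ) * (v x * squashCorr) - v x * squashCorr ^ 2
      = (∫ u, squashDeriv (R u) ∂μ - squashCorr) * v x * squashCorr by ring, abs_mul, abs_mul,
      abs_of_nonneg hκ0]
    calc _ ≤ 2500 * |v x| * |v x| * 1 := by
          gcongr
          exact squashCorr_le
      _ = _ := by rw [mul_one, mul_assoc, abs_mul_abs_self, sq]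
  calc _ ≤ _ := abs_sub_le _ _ _
    _ ≤ 2500 * v x ^ 2 + 2500 * v x ^ 2 := add_le_add h1 h3
    _ = _ := by ring

end GaussianPair

variable {n : ℕ}

/-- The value of `Φ` in terms of `g`, which carries the first `k - 2` functions, and of the last two
functions. -/
noncomputable def pairPhi (g a b : Cube n → ℝ) : ℝ :=
  (2 ^ n)⁻¹ * ∑ y, b y * twist g a y

/-- The expected value of `Φ` after `squash`-rounding of `f_{k-1} = u` and `f_k = V u`. -/
noncomputable def smoothPhi (g u : Cube n → ℝ) : ℝ :=
  pairPhi g (fun x => squash (u x)) fun y => squash (twist g u y)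

lemma twist_eq_sum (g a : Cube n → ℝ) (y : Cube n) :
    twist g a y = ∑ x, (rootN n)⁻¹ * (chi x y * g x) * a x := by
  simp only [twist, had, Finset.mul_sum]
  exact Finset.sum_congr rfl fun x _ => by ring

@[fun_prop] lemma continuous_had {α : Type*} [TopologicalSpace α] {f : α → Cube n → ℝ}
    (hf : Continuous f) (y : Cube n) : Continuous fun a => had (f a) y := by
  unfold had; fun_prop

@[fun_prop] lemma continuous_twist (g : Cube n → ℝ) {α : Type*} [TopologicalSpace α]
    {f : α → Cube n → ℝ} (hf : Continuous f) (y : Cube n) : Continuous fun a => twist g (f a) y := by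
  unfold twist; fun_prop

lemma sum_twist_coeff_sq {g : Cube n → ℝ} (hg : ∑ x, g x ^ 2 = 2 ^ n) (y : Cube n) :
    ∑ x, ((rootN n)⁻¹ * (chi x y * g x)) ^ 2 = 1 := by
  simp_rw [mul_pow, chi_sq, one_mul, inv_pow, rootN_sq]
  rw [← Finset.mul_sum, hg]
  exact inv_mul_cancel₀ (by positivity)

/-- Let v be a row of V, a unit vector. Weighting the pair correlations by v gives squashCorr² ∑ v
x² with error at most 5000 ∑ |v x|³, and |v x| ≤ B/√N. -/
lemma integral_smoothPhi_ge {g : Cube n → ℝ} (hg : ∑ x, g x ^ 2 = 2 ^ n) {B : ℝ}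
    (hB : ∀ x, |g x| ≤ B) :
    squashCorr ^ 2 - 5000 * (B / rootN n) ≤
      ∫ u, smoothPhi g u ∂Measure.pi (fun _ : Cube n => gaussianReal 0 1) := by
  set μ := Measure.pi fun _ : Cube n => gaussianReal 0 1
  have hr := rootN_pos n
  have hi : ∀ y x, Integrable (fun u : Cube n → ℝ => squash (twist g u y) * squash (u x)) μ := by
    intro y x
    refine Integrable.of_bound (C := 1) (Measurable.aestronglyMeasurable ?_)
      (ae_of_all _ fun p => ?_)
    · simp_rw [twist_eq_sum]; fun_prop
    · rw [norm_mul]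
      exact mul_le_one₀ (abs_squash_le _) (norm_nonneg _) (abs_squash_le _)
  have e : ∫ u, smoothPhi g u ∂μ = (2 ^ n)⁻¹ * ∑ y, ∑ x, (rootN n)⁻¹ * (chi x y * g x) *
      ∫ u, squash (twist g u y) * squash (u x) ∂μ := by
    have e1 : ∀ u, smoothPhi g u = (2 ^ n)⁻¹ * ∑ y, ∑ x, (rootN n)⁻¹ * (chi x y * g x) *
        (squash (twist g u y) * squash (u x)) := fun u => by
      simp only [smoothPhi, pairPhi, twist_eq_sum g (fun x => squash (u x)), Finset.mul_sum]
      refine Finset.sum_congr rfl fun y _ => Finset.sum_congr rfl fun x _ => by ring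
    simp_rw [e1]
    rw [integral_const_mul, integral_finsetSum _ fun y _ =>
      integrable_finsetSum _ fun x _ => (hi y x).const_mul _]
    congr 1
    refine Finset.sum_congr rfl fun y _ => ?_
    rw [integral_finsetSum _ fun x _ => (hi y x).const_mul _]
    exact Finset.sum_congr rfl fun x _ => integral_const_mul _ _
  rw [e]
  have key : ∀ y, squashCorr ^ 2 - 5000 * (B / rootN n) ≤
      ∑ x, (rootN n)⁻¹ * (chi x y * g x) * ∫ u, squash (twist g u y) * squash (u x) ∂μ := by
    intro y
    set v : Cube n → ℝ := fun x => (rootN n)⁻¹ * (chi x y * g x) with hv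
    have hv1 : ∑ x, v x ^ 2 = 1 := sum_twist_coeff_sq hg y
    have hvB : ∀ x, |v x| ≤ B / rootN n := fun x => by
      rw [hv, abs_mul, abs_mul, abs_chi, one_mul, abs_of_pos (inv_pos.2 hr), inv_mul_eq_div]
      exact div_le_div_of_nonneg_right (hB x) hr.le
    calc squashCorr ^ 2 - 5000 * (B / rootN n)
        = ∑ x, v x ^ 2 * (squashCorr ^ 2 - 5000 * (B / rootN n)) := by
          rw [← Finset.sum_mul, hv1, one_mul]
      _ ≤ _ := by
          refine Finset.sum_le_sum fun x _ => ?_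
          have h := abs_integral_squash_sum_mul_squash_sub_le hv1 x
          have hbt : ∀ u, ∑ j, v j * u j = twist g u y := fun u => (twist_eq_sum g u y).symm
          simp_rw [hbt] at h
          simp only [hv] at hvB
          set I := ∫ u, squash (twist g u y) * squash (u x) ∂μ
          set w := (rootN n)⁻¹ * (chi x y * g x)
          have h2 : |w * (I - w * squashCorr ^ 2)| ≤ B / rootN n * (5000 * w ^ 2) := by
            rw [abs_mul]
            exact mul_le_mul (hvB x) h (abs_nonneg _) ((abs_nonneg _).trans (hvB x))
          have h3 := (abs_le.1 h2).1
          show w ^ 2 * _ ≤ w * I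
          nlinarith
  calc squashCorr ^ 2 - 5000 * (B / rootN n)
      = (2 ^ n)⁻¹ * ∑ _y : Cube n, (squashCorr ^ 2 - 5000 * (B / rootN n)) := by
        rw [Finset.sum_const, Finset.card_univ, card_cube, nsmul_eq_mul]
        push_cast
        field_simp
    _ ≤ _ := by
        refine mul_le_mul_of_nonneg_left (Finset.sum_le_sum fun y _ => key y) (by positivity)

lemma sum_twist_sq (g a : Cube n → ℝ) : ∑ y, twist g a y ^ 2 = ∑ x, (a x * g x) ^ 2 :=
  sum_had_sq _

lemma sum_twist_sq_le {g a : Cube n → ℝ} (hg : ∑ x, g x ^ 2 = 2 ^ n) (ha : ∀ x, |a x| ≤ 1) :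
    ∑ y, twist g a y ^ 2 ≤ 2 ^ n := by
  rw [sum_twist_sq, ← hg]
  refine Finset.sum_le_sum fun x _ => ?_
  rw [mul_pow]
  exact mul_le_of_le_one_left (sq_nonneg _) ((sq_le_one_iff_abs_le_one _).2 (ha x))

/-- Cauchy–Schwarz and Parseval. -/
lemma abs_pairPhi_le {g a b : Cube n → ℝ} (hg : ∑ x, g x ^ 2 = 2 ^ n) (ha : ∀ x, |a x| ≤ 1)
    (hb : ∀ y, |b y| ≤ 1) : |pairPhi g a b| ≤ 1 := by
  have h := sum_twist_sq_le hg ha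
  have h2 : ∑ y : Cube n, b y ^ 2 ≤ 2 ^ n := by
    refine (Finset.sum_le_sum fun y _ => (sq_le_one_iff_abs_le_one _).2 (hb y)).trans ?_
    rw [Finset.sum_const, Finset.card_univ, card_cube]
    simp
  have h3 : (∑ y, b y * twist g a y) ^ 2 ≤ (2 ^ n) ^ 2 :=
    (Finset.sum_mul_sq_le_sq_mul_sq Finset.univ b (twist g a)).trans
      ((mul_le_mul h2 h (Finset.sum_nonneg fun _ _ => sq_nonneg _) (by positivity)).trans
        (le_of_eq (sq _).symm))
  have h4 := abs_le_of_sq_le_sq h3 (by positivity)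
  rw [pairPhi, abs_mul, abs_of_pos (by positivity : (0 : ℝ) < (2 ^ n)⁻¹),
    inv_mul_le_one₀ (by positivity)]
  exact h4

lemma abs_smoothPhi_le {g : Cube n → ℝ} (hg : ∑ x, g x ^ 2 = 2 ^ n) (u : Cube n → ℝ) :
    |smoothPhi g u| ≤ 1 :=
  abs_pairPhi_le hg (fun _ => abs_squash_le _) fun _ => abs_squash_le _

/-- The gradient of `smoothPhi g`. -/
noncomputable def smoothGrad (g u : Cube n → ℝ) (x : Cube n) : ℝ :=
  (2 ^ n)⁻¹ * (g x * squashDeriv (u x) * had (fun y => squash (twist g u y)) x +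
    g x * had (fun y => squashDeriv (twist g u y) * twist g (fun x => squash (u x)) y) x)

lemma sum_mul_twist (f g a : Cube n → ℝ) : ∑ y, f y * twist g a y = ∑ x, g x * had f x * a x := by
  rw [twist, ← sum_had_mul]
  exact Finset.sum_congr rfl fun x _ => by ring

lemma hasFDerivAt_smoothPhi (g : Cube n → ℝ) (a : EuclideanSpace ℝ (Cube n)) :
    HasFDerivAt (fun a : EuclideanSpace ℝ (Cube n) => smoothPhi g a)
      (innerSL ℝ (WithLp.toLp 2 (smoothGrad g a) : EuclideanSpace ℝ (Cube n))) a := by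
  have hp : ∀ x, HasFDerivAt (fun a : EuclideanSpace ℝ (Cube n) => a x)
      (EuclideanSpace.proj x : EuclideanSpace ℝ (Cube n) →L[ℝ] ℝ) a := fun x =>
    (EuclideanSpace.proj x : EuclideanSpace ℝ (Cube n) →L[ℝ] ℝ).hasFDerivAt
  have hb : ∀ y, HasFDerivAt (fun a : EuclideanSpace ℝ (Cube n) => twist g a y)
      (∑ x, ((rootN n)⁻¹ * (chi x y * g x)) • (EuclideanSpace.proj x :
        EuclideanSpace ℝ (Cube n) →L[ℝ] ℝ)) a := fun y => by
    simp_rw [twist_eq_sum]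
    exact HasFDerivAt.fun_sum fun x _ => (hp x).const_mul _
  have hβ : ∀ y, HasFDerivAt
      (fun a : EuclideanSpace ℝ (Cube n) => twist g (fun x => squash (a x)) y)
      (∑ x, ((rootN n)⁻¹ * (chi x y * g x)) • (squashDeriv (a x) • (EuclideanSpace.proj x :
        EuclideanSpace ℝ (Cube n) →L[ℝ] ℝ))) a := fun y => by
    simp_rw [twist_eq_sum]
    exact HasFDerivAt.fun_sum fun x _ =>
      ((hasDerivAt_squash (a x)).comp_hasFDerivAt a (hp x)).const_mul _
  have h := (HasFDerivAt.fun_sum (u := Finset.univ) fun y (_ : y ∈ Finset.univ) =>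
    ((hasDerivAt_squash (twist g a y)).comp_hasFDerivAt a (hb y)).mul (hβ y)).const_mul
      ((2 ^ n : ℝ)⁻¹)
  refine HasFDerivAt.congr_fderiv (f := fun a : EuclideanSpace ℝ (Cube n) => smoothPhi g a) h ?_
  ext d
  have e1 : ∀ y, ∑ x, (rootN n)⁻¹ * (chi x y * g x) * d x = twist g d y := fun y =>
    (twist_eq_sum g d y).symm
  have e2 : ∀ y, ∑ x, (rootN n)⁻¹ * (chi x y * g x) * (squashDeriv (a x) * d x) =
      twist g (fun x => squashDeriv (a x) * d x) y := fun y =>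
    (twist_eq_sum g (fun x => squashDeriv (a x) * d x) y).symm
  have e3 := sum_mul_twist (fun y => squash (twist g a y)) g (fun x => squashDeriv (a x) * d x)
  have e4 := sum_mul_twist (fun y => squashDeriv (twist g a y) * twist g (fun x => squash (a x)) y) g d
  have e5 : inner ℝ (WithLp.toLp 2 (smoothGrad g a) : EuclideanSpace ℝ (Cube n)) d
      = ∑ x, smoothGrad g a x * d x := by
    simp [PiLp.inner_apply, mul_comm]
  have e7 : ∀ x, (EuclideanSpace.proj x : EuclideanSpace ℝ (Cube n) →L[ℝ] ℝ) d = d x := fun _ => rfl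
  rw [innerSL_apply_apply, e5]
  simp only [_root_.smul_apply, _root_.sum_apply, _root_.add_apply, smul_eq_mul, e7, e1, e2,
    Function.comp]
  rw [Finset.sum_add_distrib, e3]
  have e6 : ∑ y, twist g (fun x => squash (a x)) y * (squashDeriv (twist g a y) * twist g d y)
      = ∑ x, g x * had (fun y => squashDeriv (twist g a y) * twist g (fun x => squash (a x)) y) x
        * d x := by
    rw [← e4]
    exact Finset.sum_congr rfl fun y _ => by ring
  rw [e6, ← Finset.sum_add_distrib, Finset.mul_sum]
  refine Finset.sum_congr rfl fun x _ => ?_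
  rw [smoothGrad]
  ring

/-- Apart from factors bounded by B and 50, both terms of the gradient are Hadamard transforms of
functions of square norm O(N); the prefactor 1/N leaves O(B²/N). -/
lemma sum_smoothGrad_sq_le {g : Cube n → ℝ} (hg : ∑ x, g x ^ 2 = 2 ^ n) {B : ℝ}
    (hB : ∀ x, |g x| ≤ B) (u : Cube n → ℝ) :
    ∑ x, smoothGrad g u x ^ 2 ≤ 10000 * (B ^ 2 / 2 ^ n) := by
  set P := had fun y => squash (twist g u y) with hP
  set Q := had fun y => squashDeriv (twist g u y) * twist g (fun x => squash (u x)) y with hQ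
  have hB0 : 0 ≤ B := (abs_nonneg _).trans (hB 0)
  have hψ : ∀ s, squashDeriv s ^ 2 ≤ 2500 := fun s => by
    nlinarith [squashDeriv_nonneg s, squashDeriv_le s]
  have hP2 : ∑ x, P x ^ 2 ≤ 2 ^ n := by
    rw [hP, sum_had_sq]
    refine (Finset.sum_le_sum fun y _ => (sq_le_one_iff_abs_le_one _).2 (abs_squash_le _)).trans ?_
    rw [Finset.sum_const, Finset.card_univ, card_cube]
    simp
  have hQ2 : ∑ x, Q x ^ 2 ≤ 2500 * 2 ^ n := by
    rw [hQ, sum_had_sq]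
    calc _ ≤ ∑ y, 2500 * twist g (fun x => squash (u x)) y ^ 2 := by
          refine Finset.sum_le_sum fun y _ => ?_
          rw [mul_pow]
          exact mul_le_mul_of_nonneg_right (hψ _) (sq_nonneg _)
      _ ≤ _ := by
          rw [← Finset.mul_sum]
          exact mul_le_mul_of_nonneg_left (sum_twist_sq_le hg fun x => abs_squash_le _) (by norm_num)
  have hpt : ∀ x, smoothGrad g u x ^ 2 ≤
      ((2 ^ n)⁻¹ ^ 2 * B ^ 2) * (5000 * P x ^ 2 + 2 * Q x ^ 2) := by
    intro x
    have e : smoothGrad g u x = (2 ^ n)⁻¹ * (g x * (squashDeriv (u x) * P x + Q x)) := by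
      rw [smoothGrad]; ring
    have hgx : g x ^ 2 ≤ B ^ 2 := sq_le_sq' (neg_le_of_abs_le (hB x)) (le_of_abs_le (hB x))
    have h1 : (squashDeriv (u x) * P x + Q x) ^ 2 ≤ 5000 * P x ^ 2 + 2 * Q x ^ 2 := by
      have := mul_le_mul_of_nonneg_right (hψ (u x)) (sq_nonneg (P x))
      nlinarith [sq_nonneg (squashDeriv (u x) * P x - Q x)]
    rw [e, mul_pow, mul_pow, mul_assoc]
    exact mul_le_mul_of_nonneg_left (mul_le_mul hgx h1 (sq_nonneg _) (sq_nonneg _)) (by positivity)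
  calc _ ≤ ∑ x, ((2 ^ n)⁻¹ ^ 2 * B ^ 2) * (5000 * P x ^ 2 + 2 * Q x ^ 2) :=
        Finset.sum_le_sum fun x _ => hpt x
    _ = ((2 ^ n)⁻¹ ^ 2 * B ^ 2) * (5000 * ∑ x, P x ^ 2 + 2 * ∑ x, Q x ^ 2) := by
        rw [← Finset.mul_sum, Finset.sum_add_distrib, Finset.mul_sum, Finset.mul_sum]
    _ ≤ ((2 ^ n)⁻¹ ^ 2 * B ^ 2) * (5000 * 2 ^ n + 2 * (2500 * 2 ^ n)) :=
        mul_le_mul_of_nonneg_left (by linarith) (by positivity)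
    _ = _ := by field_simp; ring

lemma continuous_smoothGrad (g : Cube n → ℝ) (x : Cube n) :
    Continuous fun u : Cube n → ℝ => smoothGrad g u x := by
  have h1 : Continuous fun u : Cube n → ℝ => had (fun y => squash (twist g u y)) x :=
    continuous_had (continuous_pi fun y => continuous_squash.comp (by fun_prop)) x
  have h2 : ∀ y, Continuous fun u : Cube n → ℝ => twist g (fun x => squash (u x)) y := fun y =>
    continuous_twist g (continuous_pi fun x => continuous_squash.comp (by fun_prop)) y
  have h3 : Continuous fun u : Cube n → ℝ =>
      had (fun y => squashDeriv (twist g u y) * twist g (fun x => squash (u x)) y) x :=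
    continuous_had (continuous_pi fun y =>
      (continuous_squashDeriv.comp (by fun_prop)).mul (h2 y)) x
  have h4 : Continuous fun u : Cube n → ℝ => squashDeriv (u x) :=
    continuous_squashDeriv.comp (by fun_prop)
  unfold smoothGrad
  fun_prop

lemma variance_smoothPhi_le {g : Cube n → ℝ} (hg : ∑ x, g x ^ 2 = 2 ^ n) {B : ℝ}
    (hB : ∀ x, |g x| ≤ B) :
    Var[smoothPhi g; Measure.pi fun _ : Cube n => gaussianReal 0 1] ≤ 20000 * (B ^ 2 / 2 ^ n) := by
  have hc : Continuous fun a : EuclideanSpace ℝ (Cube n) => smoothPhi g a :=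
    continuous_iff_continuousAt.2 fun a => (hasFDerivAt_smoothPhi g a).continuousAt
  have h := variance_stdGaussian_le (fun a => hasFDerivAt_smoothPhi g a)
    ((PiLp.continuous_toLp 2 _).comp
      (continuous_pi fun x => (continuous_smoothGrad g x).comp (PiLp.continuous_ofLp 2 _)))
    (L := 10000 * (B ^ 2 / 2 ^ n)) (C := 1)
    (fun a => by
      rw [EuclideanSpace.norm_sq_eq]
      simpa using sum_smoothGrad_sq_le hg hB a)
    (fun a => abs_smoothPhi_le hg a)
  rw [← map_pi_eq_stdGaussian, variance_map hc.aemeasurable (by fun_prop)] at h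
  refine le_trans (le_of_eq ?_) (h.trans (le_of_eq (by ring)))
  rfl


/-! ### Randomized rounding -/

/-- A random sign with expectation `squash v`, when `u` is uniform on `[-1, 1]`. -/
noncomputable def roundBit (u v : ℝ) : ℝ := if u < squash v then 1 else -1

lemma roundBit_eq (u v : ℝ) : roundBit u v = 1 ∨ roundBit u v = -1 := by
  unfold roundBit; split_ifs <;> simp

lemma abs_roundBit (u v : ℝ) : |roundBit u v| = 1 := by
  rcases roundBit_eq u v with h | h <;> simp [h]

@[fun_prop] lemma measurable_roundBit {α : Type*} [MeasurableSpace α] {f g : α → ℝ}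
    (hf : Measurable f) (hg : Measurable g) : Measurable fun a => roundBit (f a) (g a) :=
  Measurable.ite (measurableSet_lt hf (measurable_squash.comp hg)) measurable_const measurable_const

/-- The uniform distribution on `[-1, 1]`. -/
noncomputable def seedLaw : Measure ℝ := (2⁻¹ : ℝ≥0∞) • volume.restrict (Set.Ioc (-1) 1)

instance : IsProbabilityMeasure seedLaw := by
  constructor
  rw [seedLaw, Measure.smul_apply, Measure.restrict_apply_univ, Real.volume_Ioc, smul_eq_mul]
  norm_num
  exact ENNReal.inv_mul_cancel (by norm_num) (by norm_num)

lemma seedLaw_real_Iio {s : ℝ} (hs : |s| ≤ 1) : seedLaw.real (Set.Iio s) = (s + 1) / 2 := by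
  have h : Set.Iio s ∩ Set.Ioc (-1) 1 = Set.Ioo (-1) s := by
    ext x
    simp only [Set.mem_inter_iff, Set.mem_Iio, Set.mem_Ioc, Set.mem_Ioo]
    have := (abs_le.1 hs).2
    constructor
    · rintro ⟨h1, h2, -⟩; exact ⟨h2, h1⟩
    · rintro ⟨h1, h2⟩; exact ⟨h2, h1, by linarith⟩
  rw [measureReal_def, seedLaw, Measure.smul_apply, Measure.restrict_apply measurableSet_Iio, h,
    Real.volume_Ioo, smul_eq_mul, ENNReal.toReal_mul,
    ENNReal.toReal_ofReal (by linarith [(abs_le.1 hs).1])]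
  simp
  ring

lemma integral_roundBit (v : ℝ) : ∫ u, roundBit u v ∂seedLaw = squash v := by
  have e : ∀ u, roundBit u v = (Set.Iio (squash v)).indicator (fun _ => (2 : ℝ)) u - 1 := by
    intro u
    unfold roundBit
    by_cases h : u < squash v
    · rw [if_pos h, Set.indicator_of_mem (Set.mem_Iio.2 h)]; norm_num
    · rw [if_neg h, Set.indicator_of_notMem (by simpa using h)]; norm_num
  simp_rw [e]
  rw [integral_sub ((integrable_const _).indicator measurableSet_Iio) (integrable_const _),
    integral_indicator measurableSet_Iio, setIntegral_const, seedLaw_real_Iio (abs_squash_le v)]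
  simp

/-- The variance of a sum of independent bounded terms. It serves both for the rounding seeds and
for the Gaussian values of f_k under 𝓤. -/
lemma integral_sum_sub_sq_le {J : Type*} [Fintype J] (μ : Measure ℝ) [IsProbabilityMeasure μ]
    (c : J → ℝ) {X : J → ℝ → ℝ} (hX : ∀ j, Measurable (X j)) (hX1 : ∀ j s, |X j s| ≤ 1) :
    ∫ u, (∑ j, c j * X j (u j) - ∑ j, c j * ∫ s, X j s ∂μ) ^ 2 ∂Measure.pi (fun _ : J => μ)
      ≤ ∑ j, c j ^ 2 := by
  have hL : ∀ j, MemLp (fun s => c j * X j s) 2 μ := fun j =>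
    MemLp.of_bound ((hX j).const_mul _).aestronglyMeasurable |c j| (ae_of_all _ fun s => by
      rw [Real.norm_eq_abs, abs_mul]
      exact mul_le_of_le_one_right (abs_nonneg _) (hX1 j s))
  have hv := variance_sum_pi (μ := fun _ : J => μ) hL
  have hm : Measurable (∑ j, fun u : J → ℝ => c j * X j (u j)) := by fun_prop
  have hmean : ∫ u, (∑ j, fun u : J → ℝ => c j * X j (u j)) u ∂Measure.pi (fun _ : J => μ)
      = ∑ j, c j * ∫ s, X j s ∂μ := by
    simp only [Finset.sum_apply]
    have hi : ∀ j, Integrable (fun u : J → ℝ => c j * X j (u j)) (Measure.pi fun _ : J => μ) :=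
      fun j => (measurePreserving_eval (fun _ : J => μ) j).integrable_comp_of_integrable
        ((hL j).integrable (by norm_num))
    rw [integral_finsetSum _ fun j _ => hi j]
    refine Finset.sum_congr rfl fun j _ => ?_
    have hev := measurePreserving_eval (fun _ : J => μ) j
    rw [← integral_const_mul]
    conv_rhs => rw [← hev.map_eq]
    rw [integral_map (measurable_pi_apply j).aemeasurable
      ((hX j).const_mul _).aestronglyMeasurable]
  rw [variance_eq_integral hm.aemeasurable, hmean] at hv
  simp only [Finset.sum_apply] at hv
  rw [hv]
  refine Finset.sum_le_sum fun j _ => ?_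
  refine (variance_le_expectation_sq (hL j).1).trans ?_
  refine (integral_mono_of_nonneg (ae_of_all _ fun s => sq_nonneg _) (integrable_const (c j ^ 2))
    (ae_of_all _ fun s => ?_)).trans (by simp)
  simp only [Pi.pow_apply]
  rw [mul_pow]
  exact mul_le_of_le_one_right (sq_nonneg _) ((sq_le_one_iff_abs_le_one _).2 (hX1 j s))

/-! ### Second moments of the error made by randomized rounding -/

section Second

variable {n : ℕ}

/-- The law of the seeds with which the last two functions are rounded. -/
noncomputable def seeds (n : ℕ) : Measure ((Cube n → ℝ) × (Cube n → ℝ)) :=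
  (Measure.pi fun _ => seedLaw).prod (Measure.pi fun _ => seedLaw)

instance : IsProbabilityMeasure (seeds n) := by unfold seeds; infer_instance

lemma pairPhi_eq_sum_right (g a b : Cube n → ℝ) :
    pairPhi g a b = ∑ y, (2 ^ n)⁻¹ * twist g a y * b y := by
  rw [pairPhi, Finset.mul_sum]
  exact Finset.sum_congr rfl fun y _ => by ring

lemma pairPhi_eq_sum_left (g a b : Cube n → ℝ) :
    pairPhi g a b = ∑ x, (2 ^ n)⁻¹ * (g x * had b x) * a x := by
  rw [pairPhi, sum_mul_twist, Finset.mul_sum]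
  exact Finset.sum_congr rfl fun y _ => by ring

lemma measurable_pairPhi {α : Type*} [MeasurableSpace α] {g a b : α → Cube n → ℝ}
    (hg : ∀ x, Measurable fun u => g u x) (ha : ∀ x, Measurable fun u => a u x)
    (hb : ∀ x, Measurable fun u => b u x) : Measurable fun u => pairPhi (g u) (a u) (b u) := by
  unfold pairPhi
  exact (Finset.measurable_sum _ fun y _ => (hb y).mul (measurable_twist hg ha y)).const_mul _

lemma sum_sq_right_le {g a : Cube n → ℝ} (hg : ∑ x, g x ^ 2 = 2 ^ n) (ha : ∀ x, |a x| ≤ 1) :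
    ∑ y, ((2 ^ n)⁻¹ * twist g a y) ^ 2 ≤ (2 ^ n)⁻¹ := by
  simp_rw [mul_pow]
  rw [← Finset.mul_sum]
  calc _ ≤ ((2 ^ n : ℝ)⁻¹) ^ 2 * 2 ^ n :=
        mul_le_mul_of_nonneg_left (sum_twist_sq_le hg ha) (by positivity)
    _ = _ := by field_simp

lemma sum_sq_left_le {g b : Cube n → ℝ} {B : ℝ} (hB : ∀ x, |g x| ≤ B) (hb : ∀ x, |b x| ≤ 1) :
    ∑ x, ((2 ^ n)⁻¹ * (g x * had b x)) ^ 2 ≤ B ^ 2 * (2 ^ n)⁻¹ := by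
  have h2 : ∑ y : Cube n, had b y ^ 2 ≤ 2 ^ n := by
    rw [sum_had_sq]
    refine (Finset.sum_le_sum fun y _ => (sq_le_one_iff_abs_le_one _).2 (hb y)).trans ?_
    rw [Finset.sum_const, Finset.card_univ, card_cube]
    simp
  calc _ ≤ ∑ x, ((2 ^ n : ℝ)⁻¹) ^ 2 * B ^ 2 * had b x ^ 2 := by
        refine Finset.sum_le_sum fun x _ => ?_
        rw [mul_pow, mul_pow, mul_assoc]
        refine mul_le_mul_of_nonneg_left (mul_le_mul_of_nonneg_right ?_ (sq_nonneg _))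
          (by positivity)
        exact sq_le_sq' (neg_le_of_abs_le (hB x)) (le_of_abs_le (hB x))
    _ ≤ ((2 ^ n : ℝ)⁻¹) ^ 2 * B ^ 2 * 2 ^ n := by
        rw [← Finset.mul_sum]
        exact mul_le_mul_of_nonneg_left h2 (by positivity)
    _ = _ := by field_simp

/-- Randomized rounding of the last two functions changes `Φ` little. -/
lemma integral_pairPhi_round_sub_sq_le {g : Cube n → ℝ} (hg : ∑ x, g x ^ 2 = 2 ^ n) {B : ℝ}
    (hB : ∀ x, |g x| ≤ B) (a b : Cube n → ℝ) :
    ∫ u, (pairPhi g (fun x => roundBit (u.1 x) (a x)) (fun y => roundBit (u.2 y) (b y))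
      - pairPhi g (fun x => squash (a x)) (fun y => squash (b y))) ^ 2 ∂seeds n
      ≤ 2 * (1 + B ^ 2) * (2 ^ n)⁻¹ := by
  set α : (Cube n → ℝ) → Cube n → ℝ := fun u x => roundBit (u x) (a x) with hα
  set β : (Cube n → ℝ) → Cube n → ℝ := fun u x => roundBit (u x) (b x) with hβ
  set φa : Cube n → ℝ := fun x => squash (a x) with hφa
  set φb : Cube n → ℝ := fun x => squash (b x) with hφb
  have hα1 : ∀ u x, |α u x| ≤ 1 := fun u x => (abs_roundBit _ _).le
  have hβ1 : ∀ u x, |β u x| ≤ 1 := fun u x => (abs_roundBit _ _).le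
  have hφa1 : ∀ x, |φa x| ≤ 1 := fun x => abs_squash_le _
  have hφb1 : ∀ x, |φb x| ≤ 1 := fun x => abs_squash_le _
  have hαm : ∀ x, Measurable fun u => α u x := fun x => by simp only [hα]; fun_prop
  have hβm : ∀ x, Measurable fun u => β u x := fun x => by simp only [hβ]; fun_prop
  set π := Measure.pi fun _ : Cube n => seedLaw
  -- `pairPhi` is bilinear, so the functions are rounded one at a time: here the last one, with the
  -- other already rounded.
  have h1 : ∀ u1, ∫ u2, (pairPhi g (α u1) (β u2) - pairPhi g (α u1) φb) ^ 2 ∂π ≤ (2 ^ n)⁻¹ := by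
    intro u1
    have h := integral_sum_sub_sq_le seedLaw (fun y => (2 ^ n)⁻¹ * twist g (α u1) y)
      (X := fun y s => roundBit s (b y)) (fun y => by fun_prop) fun y s => (abs_roundBit _ _).le
    simp only [integral_roundBit] at h
    simp only [pairPhi_eq_sum_right]
    exact h.trans (sum_sq_right_le hg (hα1 u1))
  -- Then the other one, against the mean of the last. Its coefficients carry g pointwise, hence the
  -- factor B².
  have h2 : ∫ u1, (pairPhi g (α u1) φb - pairPhi g φa φb) ^ 2 ∂π ≤ B ^ 2 * (2 ^ n)⁻¹ := by
    have h := integral_sum_sub_sq_le seedLaw (fun x => (2 ^ n)⁻¹ * (g x * had φb x))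
      (X := fun y s => roundBit s (a y)) (fun y => by fun_prop) fun y s => (abs_roundBit _ _).le
    simp only [integral_roundBit] at h
    simp only [pairPhi_eq_sum_left]
    exact h.trans (sum_sq_left_le hB hφb1)
  have hbd : ∀ s t : ℝ, |s| ≤ 1 → |t| ≤ 1 → ‖(s - t) ^ 2‖ ≤ 4 := fun s t hs ht => by
    rw [Real.norm_eq_abs, abs_of_nonneg (sq_nonneg _)]
    have := abs_le.1 hs; have := abs_le.1 ht
    nlinarith
  have m1 : Measurable fun u : (Cube n → ℝ) × (Cube n → ℝ) => pairPhi g (α u.1) (β u.2) :=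
    measurable_pairPhi (fun _ => measurable_const) (fun x => (hαm x).comp measurable_fst)
      fun x => (hβm x).comp measurable_snd
  have m2 : Measurable fun u : (Cube n → ℝ) => pairPhi g (α u) φb :=
    measurable_pairPhi (fun _ => measurable_const) hαm fun x => measurable_const
  have i1 : Integrable (fun u : (Cube n → ℝ) × (Cube n → ℝ) =>
      (pairPhi g (α u.1) (β u.2) - pairPhi g (α u.1) φb) ^ 2) (seeds n) :=
    Integrable.of_bound ((m1.sub (m2.comp measurable_fst)).pow_const 2).aestronglyMeasurable 4
      (ae_of_all _ fun u => hbd _ _ (abs_pairPhi_le hg (hα1 _) (hβ1 _))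
        (abs_pairPhi_le hg (hα1 _) hφb1))
  have i2 : Integrable (fun u : (Cube n → ℝ) =>
      (pairPhi g (α u) φb - pairPhi g φa φb) ^ 2) π :=
    Integrable.of_bound ((m2.sub measurable_const).pow_const 2).aestronglyMeasurable 4
      (ae_of_all _ fun u => hbd _ _ (abs_pairPhi_le hg (hα1 _) hφb1)
        (abs_pairPhi_le hg hφa1 hφb1))
  have i2' : Integrable (fun u : (Cube n → ℝ) × (Cube n → ℝ) =>
      (pairPhi g (α u.1) φb - pairPhi g φa φb) ^ 2) (seeds n) := i2.comp_fst π
  have h1' : ∫ u, (pairPhi g (α u.1) (β u.2) - pairPhi g (α u.1) φb) ^ 2 ∂seeds n ≤ (2 ^ n)⁻¹ := by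
    rw [seeds, integral_prod _ i1]
    exact (integral_mono_of_nonneg (ae_of_all _ fun u => integral_nonneg fun _ => sq_nonneg _)
      (integrable_const _) (ae_of_all _ h1)).trans (by simp)
  have h2' : ∫ u, (pairPhi g (α u.1) φb - pairPhi g φa φb) ^ 2 ∂seeds n ≤ B ^ 2 * (2 ^ n)⁻¹ := by
    rw [seeds, integral_fun_fst (fun u => (pairPhi g (α u) φb - pairPhi g φa φb) ^ 2)]
    simpa using h2
  calc _ ≤ ∫ u, (2 * (pairPhi g (α u.1) (β u.2) - pairPhi g (α u.1) φb) ^ 2 +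
        2 * (pairPhi g (α u.1) φb - pairPhi g φa φb) ^ 2) ∂seeds n := by
        refine integral_mono_of_nonneg (ae_of_all _ fun u => sq_nonneg _)
          ((i1.const_mul 2).add (i2'.const_mul 2)) (ae_of_all _ fun u => ?_)
        show (pairPhi g (α u.1) (β u.2) - pairPhi g φa φb) ^ 2 ≤ _
        nlinarith [sq_nonneg (pairPhi g (α u.1) (β u.2) - pairPhi g (α u.1) φb
          - (pairPhi g (α u.1) φb - pairPhi g φa φb))]
    _ ≤ _ := by
        rw [integral_add (i1.const_mul 2) (i2'.const_mul 2), integral_const_mul, integral_const_mul]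
        linarith

end Second


/-! ### From real to Boolean tuples -/

section Round

variable {k n : ℕ}

/-- Round the last two functions to signs. -/
noncomputable def round (hk : 2 ≤ k) (u : (Cube n → ℝ) × (Cube n → ℝ)) (z : Tuple k n) :
    Tuple k n :=
  overwrite decodeTwo z fun i => roundBit (Sum.elim u.1 u.2 i) (z (lastTwo hk i))

lemma overwrite_lastTwo (hk : 2 ≤ k) (z : Tuple k n) (w : Cube n ⊕ Cube n → ℝ)
    (i : Cube n ⊕ Cube n) : overwrite decodeTwo z w (lastTwo hk i) = w i := by
  rw [overwrite, (decodeTwo_eq_some hk _ i).2 rfl]; rfl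

lemma overwrite_overwrite {I J : Type*} (d : J → Option I) (z : J → ℝ) (w w' : I → ℝ) :
    overwrite d (overwrite d z w) w' = overwrite d z w' := by
  funext j
  unfold overwrite
  cases d j <;> rfl

lemma round_overwrite (hk : 2 ≤ k) (u : (Cube n → ℝ) × (Cube n → ℝ)) (z : Tuple k n)
    (w : Cube n ⊕ Cube n → ℝ) : round hk u (overwrite decodeTwo z w) =
      overwrite decodeTwo z fun i => roundBit (Sum.elim u.1 u.2 i) (w i) := by
  rw [round, overwrite_overwrite]
  simp_rw [overwrite_lastTwo]

lemma phi_overwrite (hk : 2 ≤ k) (z : Tuple k n) (w : Cube n ⊕ Cube n → ℝ) :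
    phi (overwrite decodeTwo z w) =
      pairPhi (iter z (k - 2)) (fun x => w (Sum.inl x)) fun y => w (Sum.inr y) := by
  rw [phi_eq (by omega), iter_overwrite_last hk]
  simp_rw [blk_overwrite_inr hk]
  rfl

lemma phi_round_overwrite (hk : 2 ≤ k) (u : (Cube n → ℝ) × (Cube n → ℝ)) (z : Tuple k n)
    (w : Cube n ⊕ Cube n → ℝ) : phi (round hk u (overwrite decodeTwo z w)) =
      pairPhi (iter z (k - 2)) (fun x => roundBit (u.1 x) (w (Sum.inl x)))
        fun y => roundBit (u.2 y) (w (Sum.inr y)) := by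
  rw [round_overwrite, phi_overwrite hk]
  rfl

lemma isBoolean_overwrite (hk : 2 ≤ k) {z : Tuple k n}
    (hz : ∀ i, i + 2 < k → ∀ x, blk z i x ^ 2 = 1) {w : Cube n ⊕ Cube n → ℝ}
    (hw : ∀ i, w i = 1 ∨ w i = -1) : IsBoolean (overwrite decodeTwo z w) := by
  intro p
  rw [overwrite]
  cases h : decodeTwo p with
  | some i => exact hw i
  | none =>
    have hp : p.1.val + 2 < k := by
      have h1 : p.1.val ≠ k - 2 := fun h1 => by simp [decodeTwo, h1] at h
      have h2 : p.1.val ≠ k - 1 := fun h2 => by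
        rw [decodeTwo, if_neg h1, if_pos h2] at h
        simp at h
      have := p.1.isLt
      omega
    have := hz p.1.val hp p.2
    rw [blk, dif_pos p.1.isLt] at this
    rw [sq] at this
    exact mul_self_eq_one_iff.1 this

lemma isBoolean_round_overwrite (hk : 2 ≤ k) (u : (Cube n → ℝ) × (Cube n → ℝ)) {z : Tuple k n}
    (hz : ∀ i, i + 2 < k → ∀ x, blk z i x ^ 2 = 1) (w : Cube n ⊕ Cube n → ℝ) :
    IsBoolean (round hk u (overwrite decodeTwo z w)) := by
  rw [round_overwrite]
  exact isBoolean_overwrite hk hz fun i => roundBit_eq _ _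

lemma measurable_round (hk : 2 ≤ k) {α : Type*} [MeasurableSpace α]
    {u : α → (Cube n → ℝ) × (Cube n → ℝ)} {z : α → Tuple k n} (hu : Measurable u)
    (hz : Measurable z) : Measurable fun a => round hk (u a) (z a) := by
  refine (measurable_overwrite decodeTwo).comp (hz.prodMk (measurable_pi_lambda _ fun i => ?_))
  refine measurable_roundBit ?_ ((measurable_pi_apply _).comp hz)
  rcases i with x | y
  · exact (measurable_pi_apply x).comp (measurable_fst.comp hu)
  · exact (measurable_pi_apply y).comp (measurable_snd.comp hu)

/-- For fixed seeds each rounded value depends on one real value, so an algorithm for the Boolean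
problem runs on the real oracle with the same number of queries. -/
lemma TreeFun.comp_round [Nonempty (Fin k × Cube n)] (hk : 2 ≤ k) {t : ℕ} {p : Tuple k n → ℝ}
    (hp : TreeFun t p) (u : (Cube n → ℝ) × (Cube n → ℝ)) :
    TreeFun t fun z => p (round hk u z) := by
  refine hp.comp (fun z => round hk u z) (measurable_round hk measurable_const measurable_id)
    fun j => Or.inr ?_
  unfold round overwrite
  cases h : decodeTwo j with
  | none => exact ⟨j, id, measurable_id, fun w => rfl⟩
  | some i => exact ⟨lastTwo hk i, fun v => roundBit (Sum.elim u.1 u.2 i) v, by fun_prop,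
      fun w => rfl⟩

lemma sub_sq_le_four {s t : ℝ} (hs : |s| ≤ 1) (ht : |t| ≤ 1) : ‖(s - t) ^ 2‖ ≤ 4 := by
  rw [Real.norm_eq_abs, abs_of_nonneg (sq_nonneg _)]
  have := abs_le.1 hs; have := abs_le.1 ht
  nlinarith

/-- Under the forrelated law, the rounded tuple mostly satisfies `Φ ≥ 3/5`. -/
lemma le_integral_round_forrelated (hk : 2 ≤ k) {B r : ℝ} {z : Tuple k n} (hz : Good B r z)
    (hB : 5000 * (B / rootN n) ≤ 1 / 1000) {q : Tuple k n → ℝ} (hq : Measurable q)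
    (hq1 : ∀ z, q z ∈ Set.Icc (0 : ℝ) 1) {m : ℝ} (hm : m ≤ 1)
    (hqm : ∀ z, IsBoolean z → 3 / 5 ≤ phi z → m ≤ q z) :
    m - 1000000000 * (1 + B ^ 2) * (2 ^ n)⁻¹ ≤ ∫ a, ∫ u, q (round hk u (overwrite decodeTwo z
      (Sum.elim a (twist (iter z (k - 2)) a)))) ∂seeds n ∂Measure.pi fun _ : Cube n => gaussianReal 0 1 := by
  set g := iter z (k - 2) with hgdef
  have hg : ∑ x, g x ^ 2 = 2 ^ n := sum_iter_sq_of_good hz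
  have hgB : ∀ x, |g x| ≤ B := hz.2.1
  set γ := Measure.pi fun _ : Cube n => gaussianReal 0 1
  set w : (Cube n → ℝ) → Cube n ⊕ Cube n → ℝ := fun a => Sum.elim a (twist g a) with hw
  set Ψ := smoothPhi g with hΨ
  set M := ∫ a, Ψ a ∂γ with hM
  set R : ((Cube n → ℝ) × (Cube n → ℝ)) → (Cube n → ℝ) → ℝ := fun u a =>
    pairPhi g (fun x => roundBit (u.1 x) (a x)) (fun y => roundBit (u.2 y) (twist g a y)) with hR
  -- 0.784² > 0.614, minus the error 1/1000; this leaves a gap of 0.01 above 3/5.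
  have hMge : 0.61 ≤ M := by
    have h1 := integral_smoothPhi_ge hg hgB
    have h2 := squashCorr_ge
    have h3 : (0.614 : ℝ) ≤ squashCorr ^ 2 := by nlinarith
    norm_num at h1 h3 ⊢
    linarith
  have hΨc : Continuous Ψ := by
    have : Continuous fun a : EuclideanSpace ℝ (Cube n) => smoothPhi g a :=
      continuous_iff_continuousAt.2 fun a => (hasFDerivAt_smoothPhi g a).continuousAt
    exact this.comp (PiLp.continuous_toLp 2 _)
  have hRm : ∀ a, Measurable fun u => R u a := fun a =>
    measurable_pairPhi (fun _ => measurable_const) (fun x => by fun_prop) fun x => by fun_prop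
  -- Chebyshev in pointwise form: if the promise fails then |M - R u a| ≥ 0.01, and 20000(s² + t²) ≥
  -- 10000(s + t)² ≥ 1 ≥ m.
  have hpt : ∀ a u, m ≤ q (round hk u (overwrite decodeTwo z (w a))) +
      20000 * ((R u a - Ψ a) ^ 2 + (Ψ a - M) ^ 2) := by
    intro a u
    have hq0 := (hq1 (round hk u (overwrite decodeTwo z (w a)))).1
    by_cases h : 3 / 5 ≤ R u a
    · have := hqm _ (isBoolean_round_overwrite hk u hz.1 (w a))
        (by rw [phi_round_overwrite]; exact h)
      nlinarith [sq_nonneg (R u a - Ψ a), sq_nonneg (Ψ a - M)]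
    · have h1 : (0.01 : ℝ) ≤ M - R u a := by norm_num at h hMge ⊢; linarith
      have h2 : (0.01 : ℝ) ^ 2 ≤ (M - R u a) ^ 2 := by gcongr
      nlinarith [sq_nonneg ((R u a - Ψ a) - (Ψ a - M))]
  have hwm : Measurable w := by
    refine measurable_pi_lambda _ fun i => ?_
    rcases i with x | y
    · exact measurable_pi_apply x
    · exact measurable_twist (g := fun _ => g) (a := fun a => a) (fun x => measurable_const)
        (fun x => measurable_pi_apply x) y
  have hmq : Measurable fun y : (Cube n → ℝ) × ((Cube n → ℝ) × (Cube n → ℝ)) =>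
      q (round hk y.2 (overwrite decodeTwo z (w y.1))) :=
    hq.comp (measurable_round hk measurable_snd ((measurable_overwrite decodeTwo).comp
      (measurable_const.prodMk (hwm.comp measurable_fst))))
  have hiq : ∀ a, Integrable (fun u => q (round hk u (overwrite decodeTwo z (w a)))) (seeds n) :=
    fun a => Integrable.of_mem_Icc 0 1 (hmq.comp measurable_prodMk_left).aemeasurable
      (ae_of_all _ fun _ => hq1 _)
  have hiR : ∀ a, Integrable (fun u => (R u a - Ψ a) ^ 2) (seeds n) := fun a =>
    Integrable.of_bound (((hRm a).sub_const _).pow_const 2).aestronglyMeasurable 4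
      (ae_of_all _ fun u => sub_sq_le_four
        (abs_pairPhi_le hg (fun _ => (abs_roundBit _ _).le) fun _ => (abs_roundBit _ _).le)
        (abs_smoothPhi_le hg a))
  have h1 : ∀ a, m ≤ ∫ u, q (round hk u (overwrite decodeTwo z (w a))) ∂seeds n +
      20000 * (2 * (1 + B ^ 2) * (2 ^ n)⁻¹ + (Ψ a - M) ^ 2) := by
    intro a
    have h2 : ∫ u, (R u a - Ψ a) ^ 2 ∂seeds n ≤ 2 * (1 + B ^ 2) * (2 ^ n)⁻¹ :=
      integral_pairPhi_round_sub_sq_le hg hgB a (twist g a)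
    have i1 : Integrable (fun u => (R u a - Ψ a) ^ 2 + (Ψ a - M) ^ 2) (seeds n) :=
      (hiR a).add (integrable_const _)
    have h3 := integral_mono (integrable_const (μ := seeds n) m)
      ((hiq a).add (i1.const_mul 20000)) (hpt a)
    simp only [Pi.add_apply] at h3
    rw [integral_add (hiq a) (i1.const_mul 20000), integral_const_mul,
      integral_add (hiR a) (integrable_const _)] at h3
    simp only [integral_const, probReal_univ, one_smul] at h3
    linarith
  have hiI : Integrable (fun a => ∫ u, q (round hk u (overwrite decodeTwo z (w a))) ∂seeds n) γ := by
    refine Integrable.of_mem_Icc 0 1 ?_ (ae_of_all _ fun a => ⟨integral_nonneg fun u => (hq1 _).1, ?_⟩)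
    · exact (hmq.stronglyMeasurable.integral_prod_right').measurable.aemeasurable
    · exact (integral_mono (hiq a) (integrable_const _) fun u => (hq1 _).2).trans (by simp)
  have hiV : Integrable (fun a => (Ψ a - M) ^ 2) γ := by
    refine Integrable.of_bound ((hΨc.measurable.sub_const _).pow_const 2).aestronglyMeasurable 4
      (ae_of_all _ fun a => sub_sq_le_four (abs_smoothPhi_le hg a) ?_)
    rw [hM, ← Real.norm_eq_abs]
    exact (norm_integral_le_of_norm_le_const (ae_of_all _ fun a => abs_smoothPhi_le hg a)).trans
      (by simp)
  have hV : ∫ a, (Ψ a - M) ^ 2 ∂γ ≤ 20000 * (B ^ 2 / 2 ^ n) := by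
    have := variance_smoothPhi_le hg hgB
    rwa [variance_eq_integral hΨc.measurable.aemeasurable] at this
  have i2 : Integrable (fun a => 2 * (1 + B ^ 2) * (2 ^ n)⁻¹ + (Ψ a - M) ^ 2) γ :=
    (integrable_const _).add hiV
  have h4 := integral_mono (integrable_const (μ := γ) m) (hiI.add (i2.const_mul 20000)) h1
  simp only [Pi.add_apply] at h4
  rw [integral_add hiI (i2.const_mul 20000), integral_const_mul,
    integral_add (integrable_const _) hiV] at h4
  simp only [integral_const, probReal_univ, one_smul] at h4
  have h5 : 0 < ((2 : ℝ) ^ n)⁻¹ := by positivity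
  rw [div_eq_mul_inv] at hV
  have h6 : 0 ≤ B ^ 2 * ((2 : ℝ) ^ n)⁻¹ := by positivity
  -- The constant: 20000(2(1 + B²) + 20000B²) ≤ 10⁹(1 + B²).
  nlinarith

/-- Under the uniform law, the rounded tuple mostly satisfies `|Φ| ≤ 1/100`. -/
lemma integral_round_uniform_le (hk : 2 ≤ k) {B r : ℝ} {z : Tuple k n} (hz : Good B r z)
    {q : Tuple k n → ℝ} (hq : Measurable q) (hq1 : ∀ z, q z ∈ Set.Icc (0 : ℝ) 1) {m : ℝ}
    (hm : 0 ≤ m) (hqm : ∀ z, IsBoolean z → |phi z| ≤ 1 / 100 → q z ≤ m) :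
    ∫ w, ∫ u, q (round hk u (overwrite decodeTwo z w)) ∂seeds n
      ∂Measure.pi (fun _ : Cube n ⊕ Cube n => gaussianReal 0 1)
      ≤ m + 1000000000 * (1 + B ^ 2) * (2 ^ n)⁻¹ := by
  set g := iter z (k - 2) with hgdef
  have hg : ∑ x, g x ^ 2 = 2 ^ n := sum_iter_sq_of_good hz
  have hgB : ∀ x, |g x| ≤ B := hz.2.1
  set γ := Measure.pi fun _ : Cube n ⊕ Cube n => gaussianReal 0 1 with hγ
  set Ψ : (Cube n ⊕ Cube n → ℝ) → ℝ := fun w =>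
    pairPhi g (fun x => squash (w (Sum.inl x))) fun y => squash (w (Sum.inr y)) with hΨ
  set R : ((Cube n → ℝ) × (Cube n → ℝ)) → (Cube n ⊕ Cube n → ℝ) → ℝ := fun u w =>
    pairPhi g (fun x => roundBit (u.1 x) (w (Sum.inl x))) (fun y => roundBit (u.2 y) (w (Sum.inr y)))
    with hR
  have hΨ1 : ∀ w, |Ψ w| ≤ 1 := fun w =>
    abs_pairPhi_le hg (fun _ => abs_squash_le _) fun _ => abs_squash_le _
  have hΨm : Measurable Ψ :=
    measurable_pairPhi (fun _ => measurable_const) (fun x => by fun_prop) fun x => by fun_prop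
  have hRm : ∀ w, Measurable fun u => R u w := fun a =>
    measurable_pairPhi (fun _ => measurable_const) (fun x => by fun_prop) fun x => by fun_prop
  -- The same pointwise Chebyshev bound around the centre 0 with gap 1/100.
  have hpt : ∀ w u, q (round hk u (overwrite decodeTwo z w)) ≤
      m + 20000 * ((R u w - Ψ w) ^ 2 + Ψ w ^ 2) := by
    intro w u
    have hq0 := (hq1 (round hk u (overwrite decodeTwo z w))).2
    by_cases h : |R u w| ≤ 1 / 100
    · have := hqm _ (isBoolean_round_overwrite hk u hz.1 w) (by rw [phi_round_overwrite]; exact h)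
      nlinarith [sq_nonneg (R u w - Ψ w), sq_nonneg (Ψ w)]
    · have h2 : (1 / 100 : ℝ) ^ 2 ≤ R u w ^ 2 := by
        rw [← sq_abs (R u w)]
        exact pow_le_pow_left₀ (by norm_num) (not_le.1 h).le 2
      nlinarith [sq_nonneg ((R u w - Ψ w) - Ψ w)]
  have hmq : Measurable fun y : (Cube n ⊕ Cube n → ℝ) × ((Cube n → ℝ) × (Cube n → ℝ)) =>
      q (round hk y.2 (overwrite decodeTwo z y.1)) :=
    hq.comp (measurable_round hk measurable_snd ((measurable_overwrite decodeTwo).comp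
      (measurable_const.prodMk measurable_fst)))
  have hiq : ∀ w, Integrable (fun u => q (round hk u (overwrite decodeTwo z w))) (seeds n) :=
    fun a => Integrable.of_mem_Icc 0 1 (hmq.comp measurable_prodMk_left).aemeasurable
      (ae_of_all _ fun _ => hq1 _)
  have hiR : ∀ w, Integrable (fun u => (R u w - Ψ w) ^ 2) (seeds n) := fun w =>
    Integrable.of_bound (((hRm w).sub_const _).pow_const 2).aestronglyMeasurable 4
      (ae_of_all _ fun u => sub_sq_le_four
        (abs_pairPhi_le hg (fun _ => (abs_roundBit _ _).le) fun _ => (abs_roundBit _ _).le) (hΨ1 w))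
  have h1 : ∀ w, ∫ u, q (round hk u (overwrite decodeTwo z w)) ∂seeds n ≤
      m + 20000 * (2 * (1 + B ^ 2) * (2 ^ n)⁻¹ + Ψ w ^ 2) := by
    intro w
    have h2 : ∫ u, (R u w - Ψ w) ^ 2 ∂seeds n ≤ 2 * (1 + B ^ 2) * (2 ^ n)⁻¹ :=
      integral_pairPhi_round_sub_sq_le hg hgB (fun x => w (Sum.inl x)) fun y => w (Sum.inr y)
    have i1 : Integrable (fun u => (R u w - Ψ w) ^ 2 + Ψ w ^ 2) (seeds n) :=
      (hiR w).add (integrable_const _)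
    have h3 := integral_mono (hiq w) ((integrable_const m).add (i1.const_mul 20000)) (hpt w)
    simp only [Pi.add_apply] at h3
    rw [integral_add (integrable_const m) (i1.const_mul 20000), integral_const_mul,
      integral_add (hiR w) (integrable_const _)] at h3
    simp only [integral_const, probReal_univ, one_smul] at h3
    linarith
  have hiV : Integrable (fun w => Ψ w ^ 2) γ :=
    Integrable.of_bound (hΨm.pow_const 2).aestronglyMeasurable 1 (ae_of_all _ fun w => by
      rw [Real.norm_eq_abs, abs_of_nonneg (sq_nonneg _)]
      exact (sq_le_one_iff_abs_le_one _).2 (hΨ1 w))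
  -- For a fixed f_{k-1} this is a sum of independent centred terms, as `squash` of a Gaussian has
  -- mean 0; no Poincaré inequality is needed here.
  have hV : ∫ w, Ψ w ^ 2 ∂γ ≤ (2 ^ n)⁻¹ := by
    have hs := measurePreserving_sumPiEquivProdPi_symm
      (fun _ : Cube n ⊕ Cube n => gaussianReal 0 1)
    rw [hγ, ← hs.map_eq, integral_map hs.measurable.aemeasurable
      (hΨm.pow_const 2).aestronglyMeasurable, integral_prod]
    · refine (integral_mono_of_nonneg (ae_of_all _ fun a => integral_nonneg fun b => sq_nonneg _)
        (integrable_const ((2 ^ n : ℝ)⁻¹)) (ae_of_all _ fun a => ?_)).trans (by simp)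
      have h := integral_sum_sub_sq_le (gaussianReal 0 1)
        (fun y => (2 ^ n)⁻¹ * twist g (fun x => squash (a x)) y)
        (X := fun _ s => squash s) (fun y => by fun_prop) fun y s => abs_squash_le _
      simp only [integral_squash, mul_zero, Finset.sum_const_zero, sub_zero] at h
      refine le_trans (le_of_eq ?_) (h.trans (sum_sq_right_le hg fun x => abs_squash_le _))
      refine integral_congr_ae (ae_of_all _ fun b => ?_)
      simp only [hΨ, pairPhi_eq_sum_right]
      rfl
    · exact hs.integrable_comp_of_integrable hiV
  have i2 : Integrable (fun w => 2 * (1 + B ^ 2) * (2 ^ n)⁻¹ + Ψ w ^ 2) γ :=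
    (integrable_const _).add hiV
  have h4 := integral_mono_of_nonneg (ae_of_all γ fun w => integral_nonneg fun u => (hq1 _).1)
    ((integrable_const m).add (i2.const_mul 20000)) (ae_of_all _ h1)
  simp only [Pi.add_apply] at h4
  rw [integral_add (integrable_const m) (i2.const_mul 20000), integral_const_mul,
    integral_add (integrable_const _) hiV] at h4
  simp only [integral_const, probReal_univ, one_smul] at h4
  have h5 : 0 < ((2 : ℝ) ^ n)⁻¹ := by positivity
  have h6 : 0 ≤ B ^ 2 * ((2 : ℝ) ^ n)⁻¹ := by positivity
  nlinarith

end Round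


/-! ### Reduction of the Boolean problem to the Real one -/

section Boolean

variable {k n : ℕ}

lemma sub_measureReal_compl_le_integral {α : Type*} [MeasurableSpace α] {μ : Measure α}
    [IsProbabilityMeasure μ] {s : Set α} (hs : MeasurableSet s) {f : α → ℝ} (hf : Measurable f)
    (hf1 : ∀ a, f a ∈ Set.Icc (0 : ℝ) 1) {c : ℝ} (hc : c ≤ 1) (h : ∀ a ∈ s, c ≤ f a) :
    c - μ.real sᶜ ≤ ∫ a, f a ∂μ := by
  have hi : Integrable (fun a => c - sᶜ.indicator (fun _ => (1 : ℝ)) a) μ :=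
    (integrable_const _).sub ((integrable_const _).indicator hs.compl)
  have h1 := integral_mono hi (Integrable.of_mem_Icc 0 1 hf.aemeasurable (ae_of_all _ hf1)) fun a => by
    by_cases ha : a ∈ s
    · simpa [ha] using h a ha
    · simp only [Set.mem_compl_iff, ha, not_false_eq_true, Set.indicator_of_mem]
      linarith [(hf1 a).1]
  rw [integral_sub (integrable_const _) ((integrable_const _).indicator hs.compl),
    integral_indicator hs.compl, setIntegral_const] at h1
  simpa using h1

lemma integral_le_add_measureReal_compl {α : Type*} [MeasurableSpace α] {μ : Measure α}
    [IsProbabilityMeasure μ] {s : Set α} (hs : MeasurableSet s) {f : α → ℝ} (hf : Measurable f)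
    (hf1 : ∀ a, f a ∈ Set.Icc (0 : ℝ) 1) {c : ℝ} (hc : 0 ≤ c) (h : ∀ a ∈ s, f a ≤ c) :
    ∫ a, f a ∂μ ≤ c + μ.real sᶜ := by
  have h1 := sub_measureReal_compl_le_integral (μ := μ) hs (f := fun a => 1 - f a) (by fun_prop)
    (fun a => ⟨by linarith [(hf1 a).2], by linarith [(hf1 a).1]⟩) (c := 1 - c) (by linarith)
    fun a ha => by linarith [h a ha]
  rw [integral_sub (integrable_const _)
    (Integrable.of_mem_Icc 0 1 hf.aemeasurable (ae_of_all _ hf1))] at h1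
  simp only [integral_const, probReal_univ, one_smul] at h1
  linarith

/-- Feed the truncated algorithm with a rounded real instance. Its acceptance probabilities under 𝓕
and 𝓤 differ by about 2ε, since the promise mostly holds, yet by at most D, since rounding preserves
trees. -/
theorem SolvesBoolean.two_mul_le {Ω : Type*} [MeasurableSpace Ω] (hk : 2 ≤ k)
    {A : QueryAlg (Fin k × Cube n) Ω} {P : Measure Ω} [IsProbabilityMeasure P] {ε : ℝ}
    (hε : ε ≤ 1 / 2) {T : ℝ≥0} (h : SolvesBoolean A P ε) (hT : BooleanCost A P T)
    (t : ℕ) {D : ℝ} (hD : ∀ p : Tuple k n → ℝ, TreeFun t p →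
      ∫ z, p z ∂forrelatedLaw k n - ∫ z, p z ∂uniformLaw k n ≤ D)
    {B r : ℝ} (hB : 5000 * (B / rootN n) ≤ 1 / 1000) :
    2 * ε ≤ D + T / (t + 1) + 2 * ((uniformLaw k n).real {z | ¬ Good B r z} +
      1000000000 * (1 + B ^ 2) * (2 ^ n)⁻¹) := by
  have : Nonempty (Fin k × Cube n) := ⟨(⟨0, by omega⟩, 0)⟩
  set η := 1000000000 * (1 + B ^ 2) * ((2 : ℝ) ^ n)⁻¹ with hη
  have hη0 : 0 ≤ η := by positivity
  set q : Tuple k n → ℝ := fun z => ∫ ω, A.accept t ω z ∂P with hq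
  have hiacc : ∀ z, Integrable (fun ω => A.accept t ω z) P := fun z =>
    Integrable.of_mem_Icc 0 1 (A.measurable_accept measurable_id measurable_const t).aemeasurable
      (ae_of_all _ fun _ => A.accept_mem_Icc t _ _)
  have hqm : Measurable q :=
    ((A.measurable_accept (α := Tuple k n × Ω) measurable_snd
      measurable_fst t).stronglyMeasurable.integral_prod_right').measurable
  have hq1 : ∀ z, q z ∈ Set.Icc (0 : ℝ) 1 := fun z =>
    ⟨integral_nonneg fun ω => (A.accept_mem_Icc t ω z).1,
      (integral_mono (hiacc z) (integrable_const _) fun ω => (A.accept_mem_Icc t ω z).2).trans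
        (by simp)⟩
  -- The cost bound is assumed only on promise inputs, so Markov's inequality is applied input by
  -- input; off the promise only 0 ≤ q ≤ 1 is used.
  have hyes : ∀ z, IsBoolean z → 3 / 5 ≤ phi z → 1 / 2 + ε - T / (t + 1) ≤ q z := by
    intro z hz hp
    have h1 := A.measureReal_outputs_true_le P (ω := fun ω => ω) (z := fun _ => z) measurable_id
      measurable_const t (hT z hz (Or.inr hp))
    linarith [(h z hz).2 hp]
  have hno : ∀ z, IsBoolean z → |phi z| ≤ 1 / 100 → q z ≤ 1 / 2 - ε := by
    intro z hz hp
    have h1 := A.measureReal_outputs_false_le P (ω := fun ω => ω) (z := fun _ => z) measurable_id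
      measurable_const t
    linarith [(h z hz).1 hp]
  set Q : Tuple k n → ℝ := fun z => ∫ u, q (round hk u z) ∂seeds n with hQ
  have hqr : Measurable fun y : Tuple k n × ((Cube n → ℝ) × (Cube n → ℝ)) => q (round hk y.2 y.1) :=
    hqm.comp (measurable_round hk measurable_snd measurable_fst)
  have hQm : Measurable Q := (hqr.stronglyMeasurable.integral_prod_right').measurable
  have hiq : ∀ z, Integrable (fun u => q (round hk u z)) (seeds n) := fun z =>
    Integrable.of_mem_Icc 0 1 (hqr.comp measurable_prodMk_left).aemeasurable
      (ae_of_all _ fun _ => hq1 _)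
  have hQ1 : ∀ z, Q z ∈ Set.Icc (0 : ℝ) 1 := fun z =>
    ⟨integral_nonneg fun u => (hq1 _).1,
      (integral_mono (hiq z) (integrable_const _) fun u => (hq1 _).2).trans (by simp)⟩
  have hG := measurableSet_good (k := k) (n := n) B r
  have hτ : (0 : ℝ) ≤ T / (t + 1) := by positivity
  have hF : 1 / 2 + ε - T / (t + 1) - η - (uniformLaw k n).real {z | Good B r z}ᶜ
      ≤ ∫ z, Q z ∂forrelatedLaw k n := by
    rw [integral_forrelatedLaw_eq hk hQm hQ1]
    have hm := hQm.comp (measurable_overwrite_twist (k := k) (n := n))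
    refine sub_measureReal_compl_le_integral hG
      (hm.stronglyMeasurable.integral_prod_right').measurable (fun z => ⟨integral_nonneg fun a =>
        (hQ1 _).1, ?_⟩) (by linarith) fun z hz => ?_
    · refine (integral_mono (Integrable.of_mem_Icc 0 1 (hm.comp measurable_prodMk_left).aemeasurable
        (ae_of_all _ fun _ => hQ1 _)) (integrable_const 1) fun a => (hQ1 _).2).trans (by simp)
    · exact le_integral_round_forrelated hk hz hB hqm hq1 (by linarith) hyes
  have hU : ∫ z, Q z ∂uniformLaw k n ≤ 1 / 2 - ε + η + (uniformLaw k n).real {z | Good B r z}ᶜ := by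
    rw [integral_uniformLaw_eq hk hQm hQ1]
    have hm := hQm.comp (measurable_overwrite (decodeTwo (k := k) (n := n)))
    refine integral_le_add_measureReal_compl hG
      (hm.stronglyMeasurable.integral_prod_right').measurable (fun z => ⟨integral_nonneg fun a =>
        (hQ1 _).1, ?_⟩) (by linarith) fun z hz => ?_
    · refine (integral_mono (Integrable.of_mem_Icc 0 1 (hm.comp measurable_prodMk_left).aemeasurable
        (ae_of_all _ fun _ => hQ1 _)) (integrable_const 1) fun a => (hQ1 _).2).trans (by simp)
    · exact integral_round_uniform_le hk hz hqm hq1 (by linarith) hno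
  -- Rounding seeds and internal seed together: for each fixed pair the acceptance value is a tree
  -- function of the real oracle.
  set ρ := (seeds n).prod P
  have hmρ : Measurable fun y : Tuple k n × (((Cube n → ℝ) × (Cube n → ℝ)) × Ω) =>
      A.accept t y.2.2 (round hk y.2.1 y.1) :=
    A.measurable_accept (measurable_snd.comp measurable_snd)
      (measurable_round hk (measurable_fst.comp measurable_snd) measurable_fst) t
  have hQρ : ∀ z, Q z = ∫ s, A.accept t s.2 (round hk s.1 z) ∂ρ := fun z => by
    rw [integral_prod]
    exact Integrable.of_mem_Icc 0 1 (hmρ.comp measurable_prodMk_left).aemeasurable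
      (ae_of_all _ fun _ => A.accept_mem_Icc t _ _)
  have hsw : ∀ (L : Measure (Tuple k n)) [IsProbabilityMeasure L],
      ∫ z, Q z ∂L = ∫ s, ∫ z, A.accept t s.2 (round hk s.1 z) ∂L ∂ρ := fun L _ => by
    simp_rw [hQρ]
    exact integral_integral_swap (Integrable.of_mem_Icc 0 1 hmρ.aemeasurable
      (ae_of_all _ fun _ => A.accept_mem_Icc t _ _))
  have hint : ∀ (L : Measure (Tuple k n)) [IsProbabilityMeasure L],
      Integrable (fun s => ∫ z, A.accept t s.2 (round hk s.1 z) ∂L) ρ := fun L _ =>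
    (Integrable.of_mem_Icc 0 1 hmρ.aemeasurable
      (ae_of_all (L.prod ρ) fun _ => A.accept_mem_Icc t _ _)).integral_prod_right
  have hdiff : ∫ z, Q z ∂forrelatedLaw k n - ∫ z, Q z ∂uniformLaw k n ≤ D := by
    rw [hsw, hsw, ← integral_sub (hint _) (hint _)]
    refine (integral_mono ((hint _).sub (hint _)) (integrable_const D) fun s => ?_).trans (by simp)
    exact hD _ ((A.treeFun_run s.2 t 0 Fin.elim0).comp_round hk s.1)
  have hc : {z : Tuple k n | Good B r z}ᶜ = {z | ¬ Good B r z} := rfl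
  rw [hc] at hF hU
  linarith

end Boolean


/-! ### The choice of parameters -/

lemma sqrt_le_rootN {n : ℕ} (h : (n : ℝ) ^ 7 ≤ 2 ^ n) : (n : ℝ) ^ 3 * Real.sqrt n ≤ rootN n := by
  refine Real.le_sqrt_of_sq_le ?_
  rw [mul_pow, Real.sq_sqrt (Nat.cast_nonneg n)]
  calc _ = (n : ℝ) ^ 7 := by ring
    _ ≤ _ := h

/-- From log N ≥ n/2 and √(1/2) ≥ 2/3: the factor is (1/8)(2/3) = 1/12. -/
lemma le_log_rpow {n : ℕ} :
    (n : ℝ) ^ 3 * Real.sqrt n / 12 ≤ Real.log ((2 : ℝ) ^ n) ^ (7 / 2 : ℝ) := by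
  have hn : (0 : ℝ) ≤ n := Nat.cast_nonneg n
  have h1 : (n : ℝ) / 2 ≤ Real.log ((2 : ℝ) ^ n) := by
    rw [Real.log_pow]
    nlinarith [Real.log_two_gt_d9]
  refine le_trans ?_ (Real.rpow_le_rpow (by positivity) h1 (by norm_num))
  rw [show (7 / 2 : ℝ) = 3 + 1 / 2 by norm_num, Real.rpow_add' (by positivity) (by norm_num),
    ← Real.sqrt_eq_rpow, show ((n : ℝ) / 2) ^ (3 : ℝ) = ((n : ℝ) / 2) ^ 3 by
      exact_mod_cast Real.rpow_natCast ((n : ℝ) / 2) 3]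
  have h2 : 2 / 3 * Real.sqrt n ≤ Real.sqrt (n / 2) := by
    refine Real.le_sqrt_of_sq_le ?_
    rw [mul_pow, Real.sq_sqrt hn]
    linarith
  calc (n : ℝ) ^ 3 * Real.sqrt n / 12 = ((n : ℝ) / 2) ^ 3 * (2 / 3 * Real.sqrt n) := by ring
    _ ≤ _ := by gcongr

lemma log_two_mul_le (n : ℕ) : Real.log (2 * (2 ^ n + 2 ^ n)) ≤ n + 2 := by
  rw [show (2 : ℝ) * (2 ^ n + 2 ^ n) = 2 ^ (n + 2) by ring, Real.log_pow]
  push_cast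
  have := Real.log_two_lt_d9
  have h : (0 : ℝ) ≤ n := Nat.cast_nonneg n
  nlinarith [Real.log_nonneg one_le_two]

lemma log_two_mul_nonneg (n : ℕ) : 0 ≤ Real.log (2 * (2 ^ n + 2 ^ n)) := by
  refine Real.log_nonneg ?_
  have := one_le_pow₀ (M₀ := ℝ) one_le_two (n := n)
  linarith

set_option maxHeartbeats 1000000 in
-- With B² = 6n and r of order n^{3/2}/√N the bad events have exponentially small probability. For t
-- about 4T/e the exponent 7/2 gives r t = O(1/(e n²)), so (r t)² log² N is O(1/n²). As this tends
-- to 0, no small constant in front of T is needed, only large n. All choices precede `k`.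
lemma exists_parameters {e : ℝ} (he : 0 < e) (he2 : e ≤ 1 / 2) {n : ℕ}
    (hn : 100000000000 / e ^ 2 ≤ n) (hn7 : (n : ℝ) ^ 7 ≤ 2 ^ n) {T : ℝ} (hT0 : 0 ≤ T)
    (hT : T < Real.sqrt ((2 : ℝ) ^ n) / Real.log ((2 : ℝ) ^ n) ^ (7 / 2 : ℝ)) :
    ∃ (t : ℕ) (B r : ℝ), T / (t + 1) ≤ e / 4 ∧ 5000 * (B / rootN n) ≤ 1 / 1000 ∧
      1000000000 * (1 + B ^ 2) * ((2 : ℝ) ^ n)⁻¹ ≤ e / 8 ∧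
      ∀ k, 2 ≤ k → (uniformLaw k n).real {z | ¬ Good B r z} ≤ e / 8 ∧
        ∀ p : Tuple k n → ℝ, TreeFun t p →
          ∫ z, p z ∂forrelatedLaw k n - ∫ z, p z ∂uniformLaw k n ≤ e / 2 := by
  have hx0 : (100000000000 : ℝ) / e ^ 2 > 0 := by positivity
  set x : ℝ := (n : ℝ) with hx
  have hxe : 100000000000 ≤ x * e ^ 2 := by rwa [div_le_iff₀ (by positivity)] at hn
  have hxpos : 0 < x := hx0.trans_le hn
  have hxe1 : 200000000000 ≤ x * e := by nlinarith [mul_pos hxpos he]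
  have hx1 : 400000000000 ≤ x := by nlinarith
  have hR := rootN_pos n
  have hR2 := rootN_sq n
  have hs : Real.sqrt x ^ 2 = x := Real.sq_sqrt hxpos.le
  have hs0 : 0 < Real.sqrt x := Real.sqrt_pos.2 hxpos
  have hsR := sqrt_le_rootN hn7
  rw [← hx] at hsR
  set B := Real.sqrt (6 * x) with hB
  have hB2 : B ^ 2 = 6 * x := Real.sq_sqrt (by positivity)
  have hB0 : 0 ≤ B := Real.sqrt_nonneg _
  have hB1 : 1 < B := Real.lt_sqrt_of_sq_lt (by linarith)
  have hB3 : B ≤ 3 * Real.sqrt x := by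
    rw [hB]
    refine Real.sqrt_le_iff.2 ⟨by positivity, ?_⟩
    rw [mul_pow, hs]; linarith
  set r := 24 * (x * Real.sqrt x) / rootN n with hr
  have hr0 : 0 < r := by positivity
  have hr2 : r ^ 2 * 2 ^ n = 576 * x ^ 3 := by
    rw [hr, div_pow, hR2, mul_pow, mul_pow, hs]
    field_simp
    norm_num
  have hrx : r ≤ 24 / x ^ 2 := by
    rw [hr, div_le_div_iff₀ hR (by positivity)]
    nlinarith
  have hBr : B / rootN n ≤ r := by
    rw [hr]
    refine div_le_div_of_nonneg_right (hB3.trans ?_) hR.le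
    nlinarith
  have hx2 : x ≤ x ^ 2 := by nlinarith
  have hrx1 : r ≤ 24 / x := hrx.trans (by gcongr)
  -- Markov's term T/(t + 1) is then at most e/4; the extra 1 keeps t positive when T = 0.
  set t := ⌈4 * T / e⌉₊ + 1 with ht
  have ht1 : (t : ℝ) ≤ 4 * T / e + 2 := by
    have := (Nat.ceil_lt_add_one (show 0 ≤ 4 * T / e by positivity)).le
    rw [ht]; push_cast; linarith
  have ht2 : 4 * T / e ≤ t + 1 := by
    have := Nat.le_ceil (4 * T / e)
    rw [ht]; push_cast; linarith
  have hTx : T ≤ 12 * rootN n / (x ^ 3 * Real.sqrt x) := by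
    refine hT.le.trans ?_
    have h := le_log_rpow (n := n)
    rw [← hx] at h
    calc _ ≤ rootN n / (x ^ 3 * Real.sqrt x / 12) := by
          rw [← rootN]
          exact div_le_div_of_nonneg_left hR.le (by positivity) h
      _ = _ := by field_simp
  have hrt : r * t ≤ 1200 / (e * x ^ 2) := by
    have h1 : r * T ≤ 288 / x ^ 2 := by
      calc r * T ≤ r * (12 * rootN n / (x ^ 3 * Real.sqrt x)) := by gcongr
        _ = 288 / x ^ 2 := by rw [hr]; field_simp; norm_num
    calc r * t ≤ r * (4 * T / e + 2) := by gcongr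
      _ = 4 / e * (r * T) + 2 * r := by ring
      _ ≤ 4 / e * (288 / x ^ 2) + 2 * (24 / x ^ 2) := by gcongr
      _ = (1152 + 48 * e) / (e * x ^ 2) := by field_simp; ring
      _ ≤ _ := by gcongr; linarith
  have hbad : (2 : ℝ) ^ n * (4 * Real.exp (-(B ^ 2 / 2)) + 2 * Real.exp (-(r ^ 2 * 2 ^ n / (8 * B ^ 4))))
      ≤ e / 8 := by
    have e1 : r ^ 2 * 2 ^ n / (8 * B ^ 4) = 2 * x := by
      rw [hr2, show B ^ 4 = (B ^ 2) ^ 2 by ring, hB2]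
      field_simp; norm_num
    have e2 : Real.exp (-(B ^ 2 / 2)) ≤ Real.exp (-(2 * x)) := Real.exp_le_exp.2 (by rw [hB2]; linarith)
    have e3 : (2 : ℝ) ^ n ≤ Real.exp x := by
      rw [hx, ← mul_one (n : ℝ), Real.exp_nat_mul]
      gcongr
      linarith [Real.add_one_le_exp (1 : ℝ)]
    have e4 : Real.exp x * Real.exp (-(2 * x)) = (Real.exp x)⁻¹ := by
      rw [← Real.exp_add, ← Real.exp_neg]; ring_nf
    have e5 : (Real.exp x)⁻¹ ≤ x⁻¹ := by
      gcongr; linarith [Real.add_one_le_exp x]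
    have e6 : x⁻¹ ≤ e / 48 := by
      rw [inv_le_comm₀ hxpos (by positivity), inv_div, div_le_iff₀ he]; linarith
    rw [e1]
    calc _ ≤ Real.exp x * (4 * Real.exp (-(2 * x)) + 2 * Real.exp (-(2 * x))) := by gcongr
      _ = 6 * (Real.exp x)⁻¹ := by rw [← e4]; ring
      _ ≤ _ := by linarith
  refine ⟨t, B, r, ?_, ?_, ?_, fun k hk => ?_⟩
  · rw [div_le_iff₀ he] at ht2
    rw [div_le_iff₀ (by positivity)]
    linarith
  · have : 24 / x ≤ 1 / 5000000 := by
      rw [div_le_div_iff₀ hxpos (by norm_num)]; linarith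
    linarith [hBr.trans hrx1]
  · rw [hB2, ← div_eq_mul_inv, div_le_iff₀ (by positivity)]
    have h7 : x ^ 2 ≤ 2 ^ n := by
      refine le_trans ?_ hn7
      exact pow_le_pow_right₀ (by linarith) (by norm_num)
    have h8 : e / 8 * x ^ 2 ≤ e / 8 * 2 ^ n := by gcongr
    have h9 : 200000000000 * x ≤ x * e * x := by gcongr
    have h10 : e / 8 * x ^ 2 = x * e * x / 8 := by ring
    linarith
  · have hg := (measureReal_not_good_le (n := n) hk hB1 hr0.le).trans hbad
    refine ⟨hg, fun p hp => ?_⟩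
    have hrt2 : r * t ≤ 1 / 2 := by
      refine hrt.trans ?_
      rw [div_le_div_iff₀ (by positivity) (by norm_num)]
      have h9 : 200000000000 * x ≤ x * e * x := by gcongr
      have h10 : e * x ^ 2 = x * e * x := by ring
      linarith
    have ht0 : 0 < t := Nat.succ_pos _
    -- The budget e/2 is e/8 for the bad event, e/4 for κ and e/8 for the entropy term.
    have h := integral_forrelatedLaw_sub_le hk ht0 hp hr0 hBr le_rfl hrt2
      (κ := e / 4) (by positivity) (by linarith)
    have h1 : (r * t) ^ 2 * (Real.log (2 * (2 ^ n + 2 ^ n)) ^ 2 + 7) / (e / 4) ≤ e / 8 := by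
      have h2 : Real.log (2 * (2 ^ n + 2 ^ n)) ^ 2 + 7 ≤ 4 * x ^ 2 := by
        have := pow_le_pow_left₀ (log_two_mul_nonneg n) (log_two_mul_le n) 2
        rw [← hx] at this
        nlinarith
      have h3 : 20000 * 20000 ≤ (x * e ^ 2) ^ 2 := by nlinarith
      calc _ ≤ (1200 / (e * x ^ 2)) ^ 2 * (4 * x ^ 2) / (e / 4) := by gcongr
        _ = 1440000 * 16 / (e ^ 3 * x ^ 2) := by field_simp; norm_num
        _ ≤ e / 8 := by
            rw [div_le_div_iff₀ (by positivity) (by norm_num)]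
            have h4 : e * (e ^ 3 * x ^ 2) = (x * e ^ 2) ^ 2 := by ring
            linarith
    linarith

lemma SolvesReal.mono {k n : ℕ} {Ω : Type*} [MeasurableSpace Ω] {P : Measure Ω}
    {A : QueryAlg (Fin k × Cube n) Ω} {ε e : ℝ} (h : SolvesReal A P ε) (he : e ≤ ε) :
    SolvesReal A P e := by
  unfold SolvesReal at h ⊢
  linarith

lemma SolvesBoolean.mono {k n : ℕ} {Ω : Type*} [MeasurableSpace Ω] {P : Measure Ω}
    {A : QueryAlg (Fin k × Cube n) Ω} {ε e : ℝ} (h : SolvesBoolean A P ε) (he : e ≤ ε) :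
    SolvesBoolean A P e := fun z hz =>
  ⟨fun h1 => by linarith [(h z hz).1 h1], fun h2 => by linarith [(h z hz).2 h2]⟩

end Forrelation

theorem mainTheorem7 (ε : ℝ) (hε : 0 < ε) :
    ∃ c : ℝ, 0 < c ∧ ∃ n₀ : ℕ, ∀ k : ℕ, 2 ≤ k → ∀ n : ℕ, n₀ ≤ n →
      ∀ (Ω : Type u) [MeasurableSpace Ω] (P : Measure Ω) [IsProbabilityMeasure P]
        (A : Forrelation.QueryAlg (Fin k × Forrelation.Cube n) Ω) (T : ℝ≥0),
        (Forrelation.SolvesReal A P ε → Forrelation.RealCost A P T →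
          c * (Real.sqrt ((2 : ℝ) ^ n) / Real.log ((2 : ℝ) ^ n) ^ (7 / 2 : ℝ)) ≤ (T : ℝ)) ∧
        (Forrelation.SolvesBoolean A P ε → Forrelation.BooleanCost A P T →
          c * (Real.sqrt ((2 : ℝ) ^ n) / Real.log ((2 : ℝ) ^ n) ^ (7 / 2 : ℝ)) ≤ (T : ℝ)) := by
  -- The parameter choice and the Boolean reduction assume an advantage of at most 1/2.
  set e := min ε (1 / 2) with he
  have he0 : 0 < e := lt_min hε (by norm_num)
  have he1 : e ≤ ε := min_le_left _ _
  have he2 : e ≤ 1 / 2 := min_le_right _ _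
  have h7 : ∀ᶠ n : ℕ in Filter.atTop, (n : ℝ) ^ 7 ≤ 2 ^ n := by
    have h := tendsto_pow_const_div_const_pow_of_one_lt 7 (one_lt_two (α := ℝ))
    filter_upwards [h.eventually (ge_mem_nhds one_pos)] with n hn
    rwa [div_le_one (by positivity)] at hn
  obtain ⟨n₁, hn₁⟩ := Filter.eventually_atTop.1 h7
  refine ⟨1, one_pos, max n₁ ⌈100000000000 / e ^ 2⌉₊, fun k hk n hn Ω _ P _ A T => ?_⟩
  have hn7 := hn₁ n ((le_max_left _ _).trans hn)
  have hnx : 100000000000 / e ^ 2 ≤ (n : ℝ) :=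
    (Nat.le_ceil _).trans (by exact_mod_cast (le_max_right _ _).trans hn)
  rw [one_mul]
  constructor
  · intro hA hT
    by_contra hlt
    obtain ⟨t, B, r, h1, -, -, h4⟩ := Forrelation.exists_parameters he0 he2 hnx hn7 T.coe_nonneg (not_le.1 hlt)
    have := (hA.mono he1).two_mul_le hk hT t (h4 k hk).2
    -- 2e ≤ e/2 + e/4 is absurd.
    linarith
  · intro hA hT
    by_contra hlt
    obtain ⟨t, B, r, h1, h2, h3, h4⟩ :=
      Forrelation.exists_parameters he0 he2 hnx hn7 T.coe_nonneg (not_le.1 hlt)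
    have := (hA.mono he1).two_mul_le hk he2 hT t (h4 k hk).2 (r := r) h2
    -- 2e ≤ e/2 + e/4 + 2(e/8 + e/8) = 5e/4 is absurd.
    linarith [(h4 k hk).1]
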